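/- **Setting.** Let $k$ be an algebraically closed field, $T$ a finite linearly ordered set with an equivalence relation $\sim$. A *parameterized bimodule problem given by matrices* $(\mathcal K,\mathcal M,H)$ over $(T,\sim)$ with parameters $\lambda_1,\dots,\lambda_i$ and domain $D\subseteq k^i$ consists of a $T\times T$-matrix $H$ with entries in $k[\lambda_1,\dots,\lambda_i]$ and $h_{ij}=0$ unless $i\sim j$; of a space $\mathcal M$ of $T\times T$-matrices; and of spaces $\mathcal K(x,y)$ ($x,y\in D$) of upper triangular matrices, $x$ and $y$ being the values of the parameters acting from the left and from the right, with $\mathcal K(x,y)\mathcal K(y,z)\subseteq\mathcal K(x,z)$, $\mathcal K(x,y)\mathcal M\subseteq\mathcal M$, $\mathcal M\mathcal K(x,y)\subseteq\mathcal M$ and $SH(y)-H(x)S\in\mathcal M$ for $S\in\mathcal K(x,y)$. A parameter is *attached* to a class $\mathcal I$ if it occurs in the entries $h_{ij}$ with $i,j\in\mathcal I$. The problem is *freely parameterized* if * each parameter is attached to exactly one class, and at most one parameter is attached to each class; a class with a parameter is called non-trivial, the others trivial; * $D$ is given by $g_1(\lambda_1)\cdots g_i(\lambda_i)\neq 0$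 with non-zero polynomials $g_l$ in one variable; write $g_{\mathcal I}$ for the polynomial belonging to the parameter of $\mathcal I$; * the radical is freely generated: there are matrices $\zeta_1,\dots,\zeta_m$, strictly upper triangular, $\zeta_j$ supported in the block of some pair of classes $(\mathcal I,\mathcal J)$, with entries polynomial in the left parameter of $\mathcal I$ and the right parameter of $\mathcal J$, such that for all $x,y\in D$ the matrices $\zeta_j(x,y)$ are linearly independent and $\mathcal K(x,y)$ consists of the sums of a combination of them and of a diagonal matrix with values $s_{\mathcal I}$ constant on the classes, where $s_{\mathcal I}=0$ if the values of the parameter of $\mathcal I$ in $x$ and $y$ differ. The dual basis $v_1,\dots,v_m$ is the set of dotted arrows. Let such a problem be given with size vector $\underline n$ (positive, constant on classes, equal to $1$ on non-trivial classes). Order positions by $(i,j)\prec(i',j')$ if $i>i'$, or $i=i'$ and $j<j'$. A position is free if, on its component of $\mathcal M$ (pair of classes), the entry there is not a linear combination of the earlier ones. Let $(p,q)$ be the first free position, $\rho$ the first element of the triangular basis of $\mathcal M$ (leading entry $1$ at $(p,q)$, $0$ at the other free positions of its component), $\mathcal P\ni p$, $\mathcal Q\ni q$ the classes and $a_1:\mathcal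 P\to\mathcal Q$ the dual basis element (the first arrow). Its differential is the $(p,q)$-entry of $SH-HS$ for $S$ in the radical, $$\delta(a_1)=\sum_{j=1}^m f_jv_j,$$ where $f_j$ is a polynomial in the parameter $\lambda$ of $\mathcal P$ (left multiplication) and the parameter $\mu$ of $\mathcal Q$ (right multiplication, also if $\mathcal P=\mathcal Q$), as far as these exist. A *reduction* at $a_1$ puts a matrix $\overline N$ at the first free block: *regularization* $\overline N=\emptyset$, applicable where the equation $(SH-HS)_{pq}=0$ does not hold on the radical; and, where it holds, *edge reduction* $\overline N=\begin{pmatrix}0&I_r\\0&0\end{pmatrix}$ if $\mathcal P\ne\mathcal Q$, $0\le r\le\min(n_{\mathcal P},n_{\mathcal Q})$, or *loop reduction* if $\mathcal P=\mathcal Q$, $\overline N$ being a Weyr matrix of size $n_{\mathcal P}$ whose pairwise different eigenvalues are fixed elements of $k$ or new parameters. In the induced problem $(\mathcal K',\mathcal M',H')$ the indices in $\mathcal P$, $\mathcal Q$ are split according to the rows and columns of $\overline N$ (each non-zero multiplicity of $\overline N$ being replaced by $1$ and becoming the new size of the corresponding class); $H'$ is $H$ blown up plus $\rho\otimes$ (the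 reduced $\overline N$); $\mathcal K'$ consists of the partitioned matrices $S$ over $\mathcal K$ for which the $(p,q)$-block of $SH'-H'S$ is $0$; and $\mathcal M'$ of the partitioned matrices over $\mathcal M$ with zero $(p,q)$-block. We say that the reduction *stays free on* $D'$ if $D'$ is a set of values of the old and new parameters whose old parts lie in $D$, the reduction is applicable for all left and right values from $D'$, and the induced problem with domain $D'$ is freely parameterized, with size vector $1$ at the non-trivial classes (thus all old parameters are preserved as free parameters). **Proposition.** For a given reduction there is a $D'$ on which it stays free if and only if $\delta(a_1)$ and the reduction have one of the following forms. Conversely, in each of these forms the reduction stays free on the domain $D'$ given by the polynomials $g'$ listed, all polynomials not mentioned being unchanged. **A1.** $\mathcal P$ and $\mathcal Q$ are both non-trivial (with parameters $\lambda$, $\mu$). 1. $\delta(a_1)=0$; $\overline N=(\lambda^0)$ with a fixed $\lambda^0\in k$ if $\mathcal P=\mathcal Q$; $\overline N=(0)$ if $\mathcal P\neq\mathcal Q$; and $g'=g$. 2. $\delta(a_1)\ne0$, the highest common factor of the $f_j(\lambda,\mu)$ is of the form $f(\lambda,\mu)=f_{\mathcal P}(\lambda)f_{\mathcal Q}(\mu)$,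 and the reduction is regularization. With $q_j=f_j/f$ and any non-zero polynomial $c(\lambda)=\sum_j s_j(\lambda,\mu)q_j(\lambda,\mu)$, $s_j\in k[\lambda,\mu]$ (one exists), one may take: if $\mathcal P=\mathcal Q$, $g'_{\mathcal P}(\lambda)=g_{\mathcal P}(\lambda)c(\lambda)f_{\mathcal P}(\lambda)f_{\mathcal Q}(\lambda)$; if $\mathcal P\ne\mathcal Q$, $g'_{\mathcal P}(\lambda)=g_{\mathcal P}(\lambda)c(\lambda)f_{\mathcal P}(\lambda)$ and $g'_{\mathcal Q}(\mu)=g_{\mathcal Q}(\mu)f_{\mathcal Q}(\mu)$. **A2.** $\mathcal P$ is non-trivial (with parameter $\lambda$) and $\mathcal Q$ is trivial. 1. $\delta(a_1)=0$; $\overline N=(0\,\cdots\,0\;0)$ and $g'_{\mathcal P}=g_{\mathcal P}$, or $\overline N=(0\,\cdots\,0\;1)$ and $g'_{(\mathcal P\cup\mathcal Q)'}=g_{\mathcal P}$ for the new class $(\mathcal P\cup\mathcal Q)'$ formed by $\mathcal P$ and a part of $\mathcal Q$. 2. $\delta(a_1)\neq 0$, regularization, $g'_{\mathcal P}(\lambda)=g_{\mathcal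 P}(\lambda)f(\lambda)$ with $f(\lambda)$ the highest common factor of the $f_j(\lambda)$. Dually, $\mathcal P$ is trivial and $\mathcal Q$ is non-trivial (with parameter $\mu$). * (1′) $\delta(a_1)=0$; $\overline N=(0\,\cdots\,0\;0)^T$ and $g'_{\mathcal Q}=g_{\mathcal Q}$, or $\overline N=(1\;0\,\cdots\,0)^T$ and $g'_{(\mathcal P\cup\mathcal Q)'}=g_{\mathcal Q}$. * (2′) $\delta(a_1)\ne0$, regularization, $g'_{\mathcal Q}(\mu)=g_{\mathcal Q}(\mu)f(\mu)$ with $f(\mu)$ the highest common factor of the $f_j(\mu)$. **A3.** $\mathcal P$ and $\mathcal Q$ are both trivial (so $f_j\in k$). 1. $\delta(a_1)=0$; $\overline N=W$ a Weyr matrix with fixed eigenvalues if $\mathcal P=\mathcal Q$; $\overline N=\begin{pmatrix}0&I_r\\0&0\end{pmatrix}$ of any rank if $\mathcal P\ne\mathcal Q$. 2. $\delta(a_1)\neq0$ and the reduction is regularization. 3. $\delta(a_1)=0$, $\mathcal P=\mathcal Q$ and $\overline N=W\oplus(\nu)$, where $W$ is a Weyr matrix (possibly of size $0$) with fixed eigenvalues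 and $\nu$ is a new parameter, with domain $k\setminus\{\text{eigenvalues of }W\}$. -/

import Mathlib

open MvPolynomial

universe u

/-! ### Parameterized bimodule problems given by matrices -/

/-- The data of a bimodule problem `(𝒦, ℳ, H)` given by matrices, with parameters.

* `T` is the finite linearly ordered index set, `V = T/∼` the set of equivalence classes
  and `cls` the projection, so that `i ∼ j` means `cls i = cls j`.
* `Par` is the set of parameters and `dom ⊆ k^Par` their domain.
* `H` is the fixed matrix; its entries are polynomials in the parameters.
* `K x y` is the space of matrices of `𝒦` when a matrix is multiplied from the left by the
  parameter values `x` and from the right by the parameter values `y` (the left and the right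
  action of a parameter on `𝒦` are distinguished).  Without parameters, `K` is one matrix space.
* `M` is the matrix bimodule `ℳ`. -/
structure ParamProblem (k : Type u) [Field k] where
  T : Type
  [ordT : LinearOrder T]
  [finT : Fintype T]
  V : Type
  cls : T → V
  Par : Type
  dom : Set (Par → k)
  H : Matrix T T (MvPolynomial Par k)
  K : (Par → k) → (Par → k) → Submodule k (Matrix T T k)
  M : Submodule k (Matrix T T k)

attribute [instance] ParamProblem.ordT ParamProblem.finT

namespace ParamProblem

variable {k : Type u} [Field k]

/-- The matrix `H` at the parameter values `x`. -/
noncomputable def Hat (P : ParamProblem k) (x : P.Par → k) : Matrix P.T P.T k :=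
  P.H.map (MvPolynomial.eval x)

/-- `S H - H S`, where the parameters act by `x` from the left and by `y` from the right.  It is
the value at `S` of the derivation of the bimodule problem. -/
noncomputable def dif (P : ParamProblem k) (x y : P.Par → k) (S : Matrix P.T P.T k) :
    Matrix P.T P.T k :=
  S * P.Hat y - P.Hat x * S

/-- The parameter `a` is attached to the class `I`: it occurs in the part of `H` belonging
to `I`. -/
def Attached (P : ParamProblem k) (a : P.Par) (I : P.V) : Prop :=
  ∃ i j, P.cls i = I ∧ P.cls j = I ∧ a ∈ (P.H i j).vars

/-- The class `I` is trivial: no parameter is attached to it. -/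
def Trivial (P : ParamProblem k) (I : P.V) : Prop := ∀ a, ¬ P.Attached a I

/-- A layer of the problem: elements `ζ w` of the radical of `𝒦`, homogeneous of type
`(src w, tgt w)`, with entries polynomial in the left parameter of `src w` and in the right
parameter of `tgt w`, which form a basis of the radical at all values of the parameters in the
domain.  The dual basis `v w` consists of the dotted arrows of the corresponding layered bocs; the
dotted arrows from `I` to `J` are free generators over `Γ'(I, I) ⊗ Γ'(J, J)`, which is what the
two clauses `indep` and `mem_iff` express.  A diagonal matrix with values `s I` belongs to
`K x y` when it is compatible with the parameters, i.e. `s I = 0` unless the left and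
the right value of the parameter of `I` agree. -/
structure Layer (P : ParamProblem k) where
  ι : Type
  [finι : Fintype ι]
  src : ι → P.V
  tgt : ι → P.V
  ζ : ι → Matrix P.T P.T (MvPolynomial (P.Par ⊕ P.Par) k)
  supp : ∀ w i j, ζ w i j ≠ 0 → i < j ∧ P.cls i = src w ∧ P.cls j = tgt w
  vars_left : ∀ w i j a, Sum.inl a ∈ (ζ w i j).vars → P.Attached a (src w)
  vars_right : ∀ w i j a, Sum.inr a ∈ (ζ w i j).vars → P.Attached a (tgt w)
  indep : ∀ x ∈ P.dom, ∀ y ∈ P.dom,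
    LinearIndependent k fun w => (ζ w).map (MvPolynomial.eval (Sum.elim x y))
  mem_iff : ∀ x ∈ P.dom, ∀ y ∈ P.dom, ∀ S : Matrix P.T P.T k,
    S ∈ P.K x y ↔ ∃ (s : P.V → k) (c : ι → k),
      (∀ I a, P.Attached a I → s I ≠ 0 → x a = y a) ∧
      S = Matrix.diagonal (fun i => s (P.cls i)) +
        ∑ w, c w • (ζ w).map (MvPolynomial.eval (Sum.elim x y))

attribute [instance] Layer.finι

/-- The domain cut out of affine space by polynomials `g a` in one parameter `a` each, i.e. by the
inequality `∏ g a ≠ 0`. -/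
def domOf {A : Type} (g : A → Polynomial k) : Set (A → k) :=
  {x | ∀ a, (g a).eval (x a) ≠ 0}

/-- A freely parameterized bimodule problem. -/
structure IsFreelyParameterized (P : ParamProblem k) : Prop where
  /-- `V` is the set of equivalence classes of `T`. -/
  cls_surj : Function.Surjective P.cls
  /-- `h i j = 0` unless `i ∼ j`. -/
  H_supp : ∀ i j, P.cls i ≠ P.cls j → P.H i j = 0
  /-- `𝒦` is upper triangular, with diagonal entries constant on classes and with a radical
  freely generated over the parameters. -/
  layer : Nonempty P.Layer
  /-- `𝒦` is closed under multiplication. -/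
  K_mul : ∀ x ∈ P.dom, ∀ y ∈ P.dom, ∀ z ∈ P.dom, ∀ S ∈ P.K x y, ∀ S' ∈ P.K y z,
    S * S' ∈ P.K x z
  /-- `ℳ` is a left and a right module. -/
  K_M : ∀ x ∈ P.dom, ∀ y ∈ P.dom, ∀ S ∈ P.K x y, ∀ m ∈ P.M, S * m ∈ P.M
  M_K : ∀ x ∈ P.dom, ∀ y ∈ P.dom, ∀ S ∈ P.K x y, ∀ m ∈ P.M, m * S ∈ P.M
  /-- The derivation has values in `ℳ`. -/
  dif_mem : ∀ x ∈ P.dom, ∀ y ∈ P.dom, ∀ S ∈ P.K x y, P.dif x y S ∈ P.M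
  /-- Every parameter belongs to exactly one class, and there is at most one parameter attached
  to each class. -/
  att_unique : ∀ a, ∃! I, P.Attached a I
  att_subsingleton : ∀ I a b, P.Attached a I → P.Attached b I → a = b
  /-- The parameters are independent: the domain is given by `g₁(λ₁) ⋯ gᵢ(λᵢ) ≠ 0`. -/
  dom_eq : ∃ g : P.Par → Polynomial k, (∀ a, g a ≠ 0) ∧ P.dom = domOf g

/-- The size vectors of a freely parameterized triple: sincere, and `1` at the classes with a
parameter.  (A class function on `V` is the same as a vector constant on equivalent indices.) -/
def IsSize (P : ParamProblem k) (n : P.V → ℕ) : Prop :=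
  (∀ I, 0 < n I) ∧ ∀ I a, P.Attached a I → n I = 1

/-! ### The first arrow and its differential -/

/-- The order on the positions of a matrix: `(i, j) ≺ (i', j')` if `i > i'`, or `i = i'` and
`j < j'`. -/
def Prec (P : ParamProblem k) (i j i' j' : P.T) : Prop := i' < i ∨ (i = i' ∧ j < j')

/-- `m` lies in the `(I, J)`-component `E_I ℳ E_J` of `ℳ`. -/
def InComp (P : ParamProblem k) (I J : P.V) (m : Matrix P.T P.T k) : Prop :=
  m ∈ P.M ∧ ∀ i j, m i j ≠ 0 → P.cls i = I ∧ P.cls j = J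

/-- The entry `(i, j)` of `ℳ` is a free one: on its component it is not a linear
combination of earlier entries. -/
def FreePos (P : ParamProblem k) (i j : P.T) : Prop :=
  ∃ m, P.InComp (P.cls i) (P.cls j) m ∧ m i j ≠ 0 ∧ ∀ i' j', P.Prec i' j' i j → m i' j' = 0

/-- `ρ` is the first element of the triangular basis of `ℳ`, with leading position `(p, q)`.  The
first arrow `a₁ : cls p → cls q` is the dual basis element. -/
structure IsFirst (P : ParamProblem k) (p q : P.T) (ρ : Matrix P.T P.T k) : Prop where
  free : P.FreePos p q
  first : ∀ i j, P.FreePos i j → (i = p ∧ j = q) ∨ P.Prec p q i j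
  comp : P.InComp (P.cls p) (P.cls q) ρ
  lead : ρ p q = 1
  other : ∀ i j, P.cls i = P.cls p → P.cls j = P.cls q → P.FreePos i j →
    ¬ (i = p ∧ j = q) → ρ i j = 0

/-- The coefficient `f w` of the dotted arrow `v w` in the differential
`δ(a₁) = ∑ x_{pl} h_{lq} - ∑ h_{pl} x_{lq} = ∑ f w • v w` of the first arrow.  The variables
`Sum.inl a` and `Sum.inr a` stand for the left and the right multiplication by `a`. -/
noncomputable def delta (P : ParamProblem k) (L : P.Layer) (p q : P.T) (w : L.ι) :
    MvPolynomial (P.Par ⊕ P.Par) k :=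
  ∑ l, L.ζ w p l * rename Sum.inr (P.H l q) - ∑ l, rename Sum.inl (P.H p l) * L.ζ w l q

/-- The system defining `𝒦` at `(x, y)` implies the equation
`∑ x_{pl} h_{lq} - ∑ h_{pl} x_{lq} = 0`. -/
def Implies (P : ParamProblem k) (p q : P.T) (x y : P.Par → k) : Prop :=
  ∀ S ∈ P.K x y, (∀ i, S i i = 0) → P.dif x y S p q = 0

end ParamProblem

/-! ### The three reductions -/

/-- A Weyr matrix `W ⊕ W'`: `W` has the fixed, pairwise different eigenvalues `c 0, …, c (α - 1)`
and `W'` has `β` new parameters as eigenvalues.  `e l r` is the number of Jordan blocks of size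
`r + 1` with the eigenvalue `l`. -/
structure WeyrData (k : Type u) where
  α : ℕ
  β : ℕ
  d : ℕ
  c : Fin α → k
  c_inj : Function.Injective c
  e : Fin α ⊕ Fin β → Fin d → ℕ
  e_ne : ∀ l, ∃ r, e l r ≠ 0

namespace WeyrData

variable {k : Type u}

/-- The size of the Weyr matrix. -/
def size (W : WeyrData k) : ℕ := ∑ l, ∑ r : Fin W.d, (r.val + 1) * W.e l r

/-- The Weyr matrix is the `1 × 1` matrix `(c₀)`. -/
def IsScalar (W : WeyrData k) (c₀ : k) : Prop :=
  W.α = 1 ∧ W.β = 0 ∧ (∀ a, W.c a = c₀) ∧ ∀ l r, W.e l r = if r.val = 0 then 1 else 0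

/-- The Weyr matrix is `W ⊕ (ν)` with `W` of fixed eigenvalues and one new parameter `ν`. -/
def IsAddParam (W : WeyrData k) : Prop :=
  W.β = 1 ∧ ∀ b r, W.e (Sum.inr b) r = if r.val = 0 then 1 else 0

/-- Labels `(l, g, r)` of rows and columns, ordered by the eigenvalue, then by `g`
increasingly, then by the size `r + 1` of the Jordan block decreasingly; `g` is the position in
the block. -/
abbrev Label (W : WeyrData k) : Type :=
  (Fin W.α ⊕ₗ Fin W.β) ×ₗ (Fin W.d ×ₗ (Fin W.d)ᵒᵈ)

def Label.ev {W : WeyrData k} (x : W.Label) : Fin W.α ⊕ Fin W.β := ofLex (ofLex x).1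

def Label.pos {W : WeyrData k} (x : W.Label) : Fin W.d := (ofLex (ofLex x).2).1

def Label.len {W : WeyrData k} (x : W.Label) : Fin W.d := OrderDual.ofDual (ofLex (ofLex x).2).2

/-- The label occurs in the Weyr matrix. -/
def Label.Valid {W : WeyrData k} (x : W.Label) : Prop :=
  x.pos ≤ x.len ∧ W.e x.ev x.len ≠ 0

end WeyrData

/-- A reduction at the first arrow, given by the matrix `N̄` put at the first free block.
* `reg`: regularization, `N̄ = ∅`.
* `edge r`: edge reduction, `N̄ = (0 I_r; 0 0)`.
* `loop W`: loop reduction, `N̄` is the Weyr matrix `W`. -/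
inductive Reduction (k : Type u) where
  | reg : Reduction k
  | edge (r : ℕ) : Reduction k
  | loop (W : WeyrData k) : Reduction k

namespace Reduction

/-- How the indices are split by a reduction: an index of class `I` is replaced by the indices
with labels `a`, `allowed I a`; `code I a` is the new class; `size` is the new size
vector; `β` is the number of new parameters; `U` is the reduced block replacing `N̄`. -/
structure Splitting (k : Type u) [Field k] (V Par : Type) where
  β : ℕ
  Lab : Type
  [ordLab : LinearOrder Lab]
  [finLab : Fintype Lab]
  Cod : Type
  allowed : V → Lab → Prop
  code : V → Lab → Cod
  size : Cod → ℕ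
  U : Lab → Lab → MvPolynomial (Par ⊕ Fin β) k

attribute [instance] Splitting.ordLab Splitting.finLab

variable {k : Type u} [Field k] {V Par : Type}

/-- Regularization: nothing is split and the new block is zero. -/
noncomputable def splitReg (n : V → ℕ) : Splitting k V Par where
  β := 0
  Lab := Unit
  Cod := V
  allowed _ _ := True
  code I _ := I
  size := n
  U _ _ := 0

open Classical in
/-- Edge reduction of rank `r` at `I₀ ≠ J₀`.  The label `0` stands for the first part of an index
and the label `1` for the second one; the first part of `I₀` (of size `r`) and the second part
of `J₀` form the new class `Sum.inr ()`; the other parts of `I₀` and `J₀` have sizes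
`n I₀ - r` and `n J₀ - r`.  Parts of size zero do not appear. -/
noncomputable def splitEdge (n : V → ℕ) (I₀ J₀ : V) (r : ℕ) : Splitting k V Par where
  β := 0
  Lab := Fin 2
  Cod := V ⊕ Unit
  allowed I a :=
    if I = I₀ then (a = 0 ∧ 0 < r) ∨ (a = 1 ∧ r < n I₀)
    else if I = J₀ then (a = 1 ∧ 0 < r) ∨ (a = 0 ∧ r < n J₀)
    else a = 0
  code I a := if (I = I₀ ∧ a = 0) ∨ (I = J₀ ∧ a = 1) then Sum.inr () else Sum.inl I
  size x := match x with
    | Sum.inl I => if I = I₀ ∨ I = J₀ then n I - r else n I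
    | Sum.inr _ => r
  U a b := if a = 0 ∧ b = 1 then 1 else 0

open Classical in
/-- Loop reduction at `I₀`.  An index of class `I₀` is replaced by the labels `(l, g, r)` of the
Weyr matrix `W` taken with all nonzero multiplicities replaced by one; the new class of `(l, g, r)`
is `(l, r)`, of size `e l r`. -/
noncomputable def splitLoop (n : V → ℕ) (I₀ : V) (W : WeyrData k) : Splitting k V Par where
  β := W.β
  Lab := WithBot W.Label
  Cod := V ⊕ ((Fin W.α ⊕ Fin W.β) × Fin W.d)
  allowed I a := if I = I₀ then ∃ x : W.Label, a = (x : WithBot W.Label) ∧ x.Valid else a = ⊥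
  code I a := match a with
    | some x => Sum.inr (WeyrData.Label.ev x, WeyrData.Label.len x)
    | none => Sum.inl I
  size x := match x with
    | Sum.inl I => n I
    | Sum.inr y => W.e y.1 y.2
  U a b := match a, b with
    | some x, some y =>
      if x = y then
        Sum.elim (fun i => MvPolynomial.C (W.c i)) (fun j => MvPolynomial.X (Sum.inr j))
          (WeyrData.Label.ev x)
      else if WeyrData.Label.ev x = WeyrData.Label.ev y ∧
          WeyrData.Label.len x = WeyrData.Label.len y ∧
          (WeyrData.Label.pos y).val = (WeyrData.Label.pos x).val + 1 then 1
      else 0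
    | _, _ => 0

/-- The splitting of a reduction at the arrow `I₀ → J₀`. -/
noncomputable def splitting (R : Reduction k) (n : V → ℕ) (I₀ J₀ : V) : Splitting k V Par :=
  match R with
  | reg => splitReg n
  | edge r => splitEdge n I₀ J₀ r
  | loop W => splitLoop n I₀ W

/-- The matrix `N̄` of the reduction is possible for the sizes: an edge reduction takes place
between different classes, with `r ≤ min`; a loop reduction at one class, with a Weyr matrix of
the right size. -/
def Fits (R : Reduction k) (n : V → ℕ) (I₀ J₀ : V) : Prop :=
  match R with
  | reg => True
  | edge r => I₀ ≠ J₀ ∧ r ≤ n I₀ ∧ r ≤ n J₀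
  | loop W => I₀ = J₀ ∧ W.size = n I₀

end Reduction

/-! ### The induced problem -/

namespace ParamProblem

variable {k : Type u} [Field k] (P : ParamProblem k)

/-- The new index set, ordered lexicographically. -/
abbrev NewT (s : Reduction.Splitting k P.V P.Par) : Type :=
  {x : P.T ×ₗ s.Lab // s.allowed (P.cls (ofLex x).1) (ofLex x).2}

variable {P} {s : Reduction.Splitting k P.V P.Par}

/-- The index of `T` below a new index. -/
def NewT.idx (x : P.NewT s) : P.T := (ofLex x.1).1

/-- The label of a new index. -/
def NewT.lab (x : P.NewT s) : s.Lab := (ofLex x.1).2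

/-- The new class of a new index. -/
def NewT.code (x : P.NewT s) : s.Cod := s.code (P.cls x.idx) x.lab

open Classical in
/-- The matrix over `T` formed by the entries with labels `(a, b)` of the blocks of a
partitioned matrix. -/
noncomputable def part (a b : s.Lab) (S : Matrix (P.NewT s) (P.NewT s) k) :
    Matrix P.T P.T k := fun i j =>
  if h : s.allowed (P.cls i) a ∧ s.allowed (P.cls j) b then
    S ⟨toLex (i, a), h.1⟩ ⟨toLex (j, b), h.2⟩
  else 0

theorem part_zero (a b : s.Lab) : part a b (0 : Matrix (P.NewT s) (P.NewT s) k) = 0 := by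
  ext i j; simp [part]

theorem part_add (a b : s.Lab) (S S' : Matrix (P.NewT s) (P.NewT s) k) :
    part a b (S + S') = part a b S + part a b S' := by
  ext i j; by_cases h : s.allowed (P.cls i) a ∧ s.allowed (P.cls j) b <;> simp [part, h]

theorem part_smul (a b : s.Lab) (t : k) (S : Matrix (P.NewT s) (P.NewT s) k) :
    part a b (t • S) = t • part a b S := by
  ext i j; by_cases h : s.allowed (P.cls i) a ∧ s.allowed (P.cls j) b <;> simp [part, h]

open Classical in
/-- The new matrix `H' = H_ñ + U ⊗ ρ`. -/
noncomputable def newH (s : Reduction.Splitting k P.V P.Par) (ρ : Matrix P.T P.T k) :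
    Matrix (P.NewT s) (P.NewT s) (MvPolynomial (P.Par ⊕ Fin s.β) k) := fun x y =>
  (if x.lab = y.lab then rename Sum.inl (P.H x.idx y.idx) else 0) +
    MvPolynomial.C (ρ x.idx y.idx) * s.U x.lab y.lab

/-- The `(p, q)`-block of `S H' - H' S` vanishes. -/
def BlockEq (p q : P.T) (H₁ H₂ S : Matrix (P.NewT s) (P.NewT s) k) [Fintype (P.NewT s)] : Prop :=
  ∀ x y : P.NewT s, x.idx = p → y.idx = q → (S * H₂ - H₁ * S) x y = 0

open Classical in
/-- The induced problem `(𝒦', ℳ', H')`, with a new domain `D`.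

`𝒦'` consists of the partitioned matrices over `𝒦` with `S H' = H' S` at the block `(p, q)`;
`ℳ'` consists of the partitioned matrices over `ℳ` with vanishing block `(p, q)`. -/
noncomputable def induced (s : Reduction.Splitting k P.V P.Par) (p q : P.T)
    (ρ : Matrix P.T P.T k) (D : Set (P.Par ⊕ Fin s.β → k)) : ParamProblem k where
  T := P.NewT s
  V := {c : s.Cod // ∃ x : P.NewT s, x.code = c}
  cls x := ⟨x.code, x, rfl⟩
  Par := P.Par ⊕ Fin s.β
  dom := D
  H := newH s ρ
  K x y :=
    { carrier := {S | (∀ a b, part a b S ∈ P.K (x ∘ Sum.inl) (y ∘ Sum.inl)) ∧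
        BlockEq p q ((newH s ρ).map (MvPolynomial.eval x)) ((newH s ρ).map (MvPolynomial.eval y)) S}
      zero_mem' := by
        refine ⟨fun a b => ?_, fun _ _ _ _ => by simp⟩
        rw [part_zero]; exact Submodule.zero_mem _
      add_mem' := by
        rintro S S' ⟨h₁, h₂⟩ ⟨h₃, h₄⟩
        refine ⟨fun a b => ?_, fun i j hi hj => ?_⟩
        · rw [part_add]; exact Submodule.add_mem _ (h₁ a b) (h₃ a b)
        · have e₁ := h₂ i j hi hj
          have e₂ := h₄ i j hi hj
          have : ∀ A B S S' : Matrix (P.NewT s) (P.NewT s) k,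
              (S + S') * B - A * (S + S') = (S * B - A * S) + (S' * B - A * S') := by
            intros; noncomm_ring
          rw [this, Matrix.add_apply, e₁, e₂, add_zero]
      smul_mem' := by
        rintro t S ⟨h₁, h₂⟩
        refine ⟨fun a b => ?_, fun i j hi hj => ?_⟩
        · rw [part_smul]; exact Submodule.smul_mem _ _ (h₁ a b)
        · have e₁ := h₂ i j hi hj
          rw [Matrix.smul_mul, Matrix.mul_smul, ← smul_sub, Matrix.smul_apply, e₁, smul_zero] }
  M :=
    { carrier := {m | (∀ a b, part a b m ∈ P.M) ∧ ∀ x y : P.NewT s, x.idx = p → y.idx = q →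
        m x y = 0}
      zero_mem' := by
        refine ⟨fun a b => ?_, fun _ _ _ _ => rfl⟩
        rw [part_zero]; exact Submodule.zero_mem _
      add_mem' := by
        rintro S S' ⟨h₁, h₂⟩ ⟨h₃, h₄⟩
        refine ⟨fun a b => ?_, fun i j hi hj => ?_⟩
        · rw [part_add]; exact Submodule.add_mem _ (h₁ a b) (h₃ a b)
        · rw [Matrix.add_apply, h₂ i j hi hj, h₄ i j hi hj, add_zero]
      smul_mem' := by
        rintro t S ⟨h₁, h₂⟩
        refine ⟨fun a b => ?_, fun i j hi hj => ?_⟩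
        · rw [part_smul]; exact Submodule.smul_mem _ _ (h₁ a b)
        · rw [Matrix.smul_apply, h₂ i j hi hj, smul_zero] }

/-- The reduction `R` applies at the parameter values `x` (from the left) and `y` (from the right):
regularization if the system for `𝒦` does not imply the equation
`∑ x_{pl} h_{lq} - ∑ h_{pl} x_{lq} = 0`, edge and loop reduction if it does. -/
def Applies (P : ParamProblem k) (R : Reduction k) (p q : P.T) (x y : P.Par → k) : Prop :=
  match R with
  | Reduction.reg => ¬ P.Implies p q x y
  | _ => P.Implies p q x y

/-- The splitting of the reduction `R` at the first arrow of `P`. -/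
noncomputable abbrev split (P : ParamProblem k) (n : P.V → ℕ) (p q : P.T) (R : Reduction k) :
    Reduction.Splitting k P.V P.Par :=
  R.splitting n (P.cls p) (P.cls q)

/-- On the domain `D` the problem induced by `R` is again freely parameterized (together with
the new size vector), and all the old parameters are still free.  The old parameters
are among the parameters of the induced problem, with values in the old domain, and the reduction
applies at all the values of the parameters in `D`. -/
structure StaysFree (P : ParamProblem k) (n : P.V → ℕ) (p q : P.T) (ρ : Matrix P.T P.T k)
    (R : Reduction k) (D : Set (P.Par ⊕ Fin (P.split n p q R).β → k)) : Prop where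
  sub : ∀ x ∈ D, x ∘ Sum.inl ∈ P.dom
  applies : ∀ x ∈ D, ∀ y ∈ D, P.Applies R p q (x ∘ Sum.inl) (y ∘ Sum.inl)
  free : (induced (P.split n p q R) p q ρ D).IsFreelyParameterized
  size : (induced (P.split n p q R) p q ρ D).IsSize fun c => (P.split n p q R).size c.1

/-! ### The list of reductions -/

/-- `f` is a highest common factor of the family `F`. -/
def IsHCF {A ι : Type} (f : MvPolynomial A k) (F : ι → MvPolynomial A k) : Prop :=
  (∀ w, f ∣ F w) ∧ ∀ h, (∀ w, h ∣ F w) → h ∣ f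

/-- The polynomial `f(λ)` in the left parameter `λ = a`. -/
noncomputable def leftPoly {A : Type} (a : A) (f : Polynomial k) : MvPolynomial (A ⊕ A) k :=
  Polynomial.aeval (MvPolynomial.X (Sum.inl a)) f

/-- The polynomial `f(μ)` in the right parameter `μ = a`. -/
noncomputable def rightPoly {A : Type} (a : A) (f : Polynomial k) : MvPolynomial (A ⊕ A) k :=
  Polynomial.aeval (MvPolynomial.X (Sum.inr a)) f

/-- `c(λ) = ∑ s w * q w` with `c ≠ 0`, where `F w = f * q w`. -/
def IsLocalizer {A ι : Type} [Fintype ι] (a : A) (f : MvPolynomial (A ⊕ A) k)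
    (F : ι → MvPolynomial (A ⊕ A) k) (c : Polynomial k) : Prop :=
  c ≠ 0 ∧ ∃ q s : ι → MvPolynomial (A ⊕ A) k,
    (∀ w, F w = f * q w) ∧ leftPoly a c = ∑ w, s w * q w

/-- Case A1: parameters `lam` at `cls p` and `mu` at `cls q`.  Here `g` are the localizing
polynomials before and `gN` those after the reduction. -/
def ListedA1 (P : ParamProblem k) (L : P.Layer) (p q : P.T) (g : P.Par → Polynomial k)
    (R : Reduction k) (gN : P.Par → Polynomial k) (lam mu : P.Par) : Prop :=
  ((∀ w, P.delta L p q w = 0) ∧ gN = g ∧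
    ((P.cls p = P.cls q ∧ ∃ (W : WeyrData k) (c₀ : k), R = Reduction.loop W ∧ W.IsScalar c₀) ∨
      (P.cls p ≠ P.cls q ∧ R = Reduction.edge 0))) ∨
  ((∃ w, P.delta L p q w ≠ 0) ∧ R = Reduction.reg ∧
    ∃ (fP fQ c : Polynomial k),
      IsHCF (leftPoly lam fP * rightPoly mu fQ) (P.delta L p q) ∧
      IsLocalizer lam (leftPoly lam fP * rightPoly mu fQ) (P.delta L p q) c ∧
      (∀ a, a ≠ lam → a ≠ mu → gN a = g a) ∧
      ((P.cls p = P.cls q ∧ gN lam = g lam * c * fP * fQ) ∨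
        (P.cls p ≠ P.cls q ∧ gN lam = g lam * c * fP ∧ gN mu = g mu * fQ)))

/-- Case A2: a parameter `lam` at `cls p` only. -/
def ListedA2 (P : ParamProblem k) (L : P.Layer) (p q : P.T) (g : P.Par → Polynomial k)
    (R : Reduction k) (gN : P.Par → Polynomial k) (lam : P.Par) : Prop :=
  ((∀ w, P.delta L p q w = 0) ∧ gN = g ∧ (R = Reduction.edge 0 ∨ R = Reduction.edge 1)) ∨
  ((∃ w, P.delta L p q w ≠ 0) ∧ R = Reduction.reg ∧
    ∃ f : Polynomial k, IsHCF (leftPoly lam f) (P.delta L p q) ∧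
      (∀ a, a ≠ lam → gN a = g a) ∧ gN lam = g lam * f)

/-- The dual of case A2: a parameter `mu` at `cls q` only. -/
def ListedA2Dual (P : ParamProblem k) (L : P.Layer) (p q : P.T) (g : P.Par → Polynomial k)
    (R : Reduction k) (gN : P.Par → Polynomial k) (mu : P.Par) : Prop :=
  ((∀ w, P.delta L p q w = 0) ∧ gN = g ∧ (R = Reduction.edge 0 ∨ R = Reduction.edge 1)) ∨
  ((∃ w, P.delta L p q w ≠ 0) ∧ R = Reduction.reg ∧
    ∃ f : Polynomial k, IsHCF (rightPoly mu f) (P.delta L p q) ∧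
      (∀ a, a ≠ mu → gN a = g a) ∧ gN mu = g mu * f)

/-- Case A3: no parameters at `cls p` and `cls q`.  `gN` are the localizing polynomials of the old
and `gNew` those of the new parameters. -/
def ListedA3 (P : ParamProblem k) (L : P.Layer) (p q : P.T) (g : P.Par → Polynomial k)
    (R : Reduction k) (gN : P.Par → Polynomial k) (gNew : ℕ → Polynomial k) : Prop :=
  gN = g ∧
  (((∀ w, P.delta L p q w = 0) ∧
      ((P.cls p = P.cls q ∧ ∃ W : WeyrData k, R = Reduction.loop W ∧ W.β = 0) ∨
        (P.cls p ≠ P.cls q ∧ ∃ r, R = Reduction.edge r))) ∨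
    ((∃ w, P.delta L p q w ≠ 0) ∧ R = Reduction.reg) ∨
    ((∀ w, P.delta L p q w = 0) ∧ P.cls p = P.cls q ∧
      ∃ W : WeyrData k, R = Reduction.loop W ∧ W.IsAddParam ∧
        gNew 0 = ∏ i, (Polynomial.X - Polynomial.C (W.c i))))

/-- `δ(a₁)` and the reduction `R` have one of the listed forms, with the localizing polynomials `gN`
(of the old parameters) and `gNew` (of the new parameters) after the reduction. -/
def Listed (P : ParamProblem k) (L : P.Layer) (p q : P.T) (g : P.Par → Polynomial k)
    (R : Reduction k) (gN : P.Par → Polynomial k) (gNew : ℕ → Polynomial k) : Prop :=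
  (∃ lam mu, P.Attached lam (P.cls p) ∧ P.Attached mu (P.cls q) ∧
    P.ListedA1 L p q g R gN lam mu) ∨
  (∃ lam, P.Attached lam (P.cls p) ∧ P.Trivial (P.cls q) ∧ P.ListedA2 L p q g R gN lam) ∨
  (∃ mu, P.Trivial (P.cls p) ∧ P.Attached mu (P.cls q) ∧ P.ListedA2Dual L p q g R gN mu) ∨
  (P.Trivial (P.cls p) ∧ P.Trivial (P.cls q) ∧ P.ListedA3 L p q g R gN gNew)

end ParamProblem

/-!
A matrix of the induced `𝒦'` is a partitioned matrix over `𝒦`, thus for each pair of labels a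
diagonal part `t` and a vector `c` of coefficients with respect to a basis of the radical of `𝒦`.
The only condition is the equation for the block `(p, q)` (`mem_K_iff_comb`): for every pair of
labels `∑ c w * f w + (t_p U - U t_q) = 0`, where `δ(a₁) = ∑ f w • v w` and `U` is the reduced new
block. In regularization `U = 0`, and in the other reductions `δ(a₁) = 0`, so the equation splits
into one for `c` and one for `t`, and the radical of the induced problem is freely generated as
soon as the solutions of both are (`SplitFrame.nonempty_layer`).

* *Coefficients* (`KernelFrame`).  If `δ(a₁) = 0` there is no condition.  Otherwise let `f` be the
  highest common factor and `q w = f w / f`.  These quotients have no common factor, so over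
  `k(λ)[μ]` they are unimodular, and `∑ s w * q w = c(λ)` for some `c ≠ 0`.  The kernel of the row
  `q` has a polynomial family of the right rank which, together with `s`, has a determinant `d(λ)
  ≠ 0`.  As long as `d` has a zero that is not a zero of `c`, the family can be improved to one
  with a determinant of smaller degree; in the end it is a basis of the kernel wherever `c ≠ 0`
  (`Polynomial.exists_kernel_frame`).
* *Diagonal parts* (`SplitFrame`).  For an edge reduction the solutions are scalars on the new
  classes and one entry for each class that is really split.  For a loop reduction they are the
  matrices intertwining Jordan blocks: Toeplitz matrices where the eigenvalues coincide and zero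
  elsewhere.  The left value of an eigenvalue has to differ from the right values of all the
  others.  A new parameter, which has a single block of size one, may have different left and
  right values itself; then the scalar on its block is zero, which is the compatibility condition
  in the definition of a layer.

This shows that the reduction stays free in the listed cases (`staysFree_reg`, `staysFree_edge`,
`staysFree_loop`).

Conversely, suppose that the reduction stays free on `D'`, which is given by polynomials and hence
Zariski dense.  For edge and loop reductions `δ(a₁)` vanishes at all values, hence is zero.  For
regularization the highest common factor `f(λ, μ)` has no zeros on an open set `a(λ) b(μ) ≠ 0`.
If it involves `μ`, then for almost all `λ₀` the polynomial `f(λ₀, μ)` has a root, which is one of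
the finitely many roots of `b`; one root `μ₀` occurs for infinitely many `λ₀`, and `μ - μ₀`
divides `f`.  Therefore `f` is a product `f₁(λ) f₂(μ)` (`Polynomial.exists_eq_mul_of_ne_zero`).
Two parameters must not be attached to the same class, which excludes an edge reduction of
positive rank between two non-trivial classes and new parameters in a loop at a non-trivial class.
Finally, the dimension of the radical is the same at all values of the parameters.  If a loop
reduction introduced two new parameters, or one with a Jordan block of size at least two, the
radical would become larger where the left value of a new eigenvalue meets the right value of
another one, or of the same one (`LoopSplitting.not_isFreelyParameterized`).
-/

/-! ### Unimodular rows over `k[λ][μ]` -/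

/-- A finite family of polynomials over the field of fractions has a common denominator in `R`. -/
theorem Polynomial.exists_clear_denominators {R K : Type*} [CommRing R] [IsDomain R] [Field K]
    [Algebra R K] [IsFractionRing R K] {ι : Type*} [Finite ι] (v : ι → Polynomial K) :
    ∃ r : R, r ≠ 0 ∧ ∃ w : ι → Polynomial R, ∀ i,
      (w i).map (algebraMap R K) = Polynomial.C (algebraMap R K r) * v i := by
  let _ : Algebra (Polynomial R) (Polynomial K) := Polynomial.algebra R K
  have : IsLocalization ((nonZeroDivisors R).map (Polynomial.C : R →+* Polynomial R))
    (Polynomial K) := Polynomial.isLocalization (nonZeroDivisors R) K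
  obtain ⟨⟨_, r, hr, rfl⟩, hb⟩ := IsLocalization.exist_integer_multiples_of_finite
    ((nonZeroDivisors R).map (Polynomial.C : R →+* Polynomial R)) v
  choose w hw using hb
  refine ⟨r, nonZeroDivisors.ne_zero hr, w, fun i => ?_⟩
  have h := hw i
  rw [Algebra.smul_def] at h
  refine h.trans ?_
  congr 1
  change Polynomial.map (algebraMap R K) (Polynomial.C r) = _
  rw [Polynomial.map_C]

/-- Bézout's identity for bivariate polynomials without a common factor: a non-zero polynomial in
the inner variable alone is a combination of them.  Over the field of fractions `k(λ)` the ideal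
they generate is principal, and by Gauss's lemma its generator is constant. -/
theorem Polynomial.exists_bezout_of_no_common_factor {k : Type*} [Field k] {ι : Type*} [Fintype ι]
    (q : ι → Polynomial (Polynomial k)) (hq : ∀ d, (∀ w, d ∣ q w) → IsUnit d) :
    ∃ (c : Polynomial k) (s : ι → Polynomial (Polynomial k)), c ≠ 0 ∧
      ∑ w, s w * q w = Polynomial.C c := by
  classical
  let K := FractionRing (Polynomial k)
  let m := algebraMap (Polynomial k) K
  have hinj : Function.Injective m := IsFractionRing.injective _ _
  have hinj' : Function.Injective (Polynomial.map m) := Polynomial.map_injective _ hinj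
  let _ : NormalizedGCDMonoid (Polynomial k) := Classical.choice inferInstance
  let J : Ideal (Polynomial K) := Ideal.span (Set.range fun w => (q w).map m)
  obtain ⟨f, hf⟩ : ∃ f, J = Ideal.span {f} :=
    (IsPrincipalIdealRing.principal J).principal
  have hdvd : ∀ w, f ∣ (q w).map m := fun w => by
    rw [← Ideal.mem_span_singleton, ← hf]
    exact Ideal.subset_span ⟨w, rfl⟩
  have hf0 : f ≠ 0 := by
    rintro rfl
    have : ∀ w, q w = 0 := fun w => hinj' (by simpa using hdvd w)
    exact not_isUnit_zero (hq 0 fun w => by rw [this w])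
  obtain ⟨r, hr, w, hw⟩ := Polynomial.exists_clear_denominators (R := Polynomial k) (K := K)
    (fun _ : Unit => f)
  have hr' : m r ≠ 0 := fun h => hr (hinj (by rw [h, map_zero]))
  have hw0 : w () ≠ 0 := fun h => by
    have := hw ()
    rw [h, Polynomial.map_zero, eq_comm, mul_eq_zero, Polynomial.C_eq_zero] at this
    exact this.elim hr' hf0
  have hct : (w ()).content ≠ 0 := by rwa [Ne, Polynomial.content_eq_zero_iff]
  have hct' : m (w ()).content ≠ 0 := fun h => hct (hinj (by rw [h, map_zero]))
  have hassoc : Associated ((w ()).primPart.map m) f := by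
    have h1 : Polynomial.C (m (w ()).content) * (w ()).primPart.map m = Polynomial.C (m r) * f := by
      rw [← hw (), ← Polynomial.map_C, ← Polynomial.map_mul, ← Polynomial.eq_C_content_mul_primPart]
    have u1 : IsUnit (Polynomial.C (m (w ()).content)) := Polynomial.isUnit_C.2 hct'.isUnit
    have u2 : IsUnit (Polynomial.C (m r)) := Polynomial.isUnit_C.2 hr'.isUnit
    exact (associated_isUnit_mul_left_iff u1).1 (h1 ▸ associated_unit_mul_left _ _ u2)
  have hunit : IsUnit (w ()).primPart := hq _ fun i => by
    obtain ⟨t, ht⟩ := hassoc.dvd.trans (hdvd i)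
    have hl : t ∈ Polynomial.lifts m :=
      ((Polynomial.isPrimitive_primPart _).map_mul_mem_lifts_iff).1
        ⟨q i, by rw [← ht]; rfl⟩
    obtain ⟨t', rfl⟩ := hl
    refine ⟨t', hinj' ?_⟩
    rw [ht, Polynomial.map_mul]; rfl
  have h1 : (1 : Polynomial K) ∈ J := by
    rw [hf, Ideal.mem_span_singleton]
    have := hunit.map (Polynomial.mapRingHom m)
    exact (hassoc.isUnit this).dvd
  obtain ⟨s, hs⟩ := (Submodule.mem_span_range_iff_exists_fun _).1 h1
  obtain ⟨r, hr, w, hw⟩ := Polynomial.exists_clear_denominators (R := Polynomial k) (K := K) s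
  refine ⟨r, w, hr, hinj' ?_⟩
  rw [Polynomial.map_sum, Polynomial.map_C]
  simp only [Polynomial.map_mul, show ∀ i, (w i).map m = _ from hw, mul_assoc]
  rw [← Finset.mul_sum]
  simp only [smul_eq_mul] at hs
  rw [hs, mul_one]

/-- A bivariate polynomial without zeros on an open set `a(λ) b(μ) ≠ 0` is a product of a polynomial
in `λ` and a polynomial in `μ`: if it has positive degree in `μ`, then infinitely many of its
specialisations share a root, so that it has a factor `μ - t`. -/
theorem Polynomial.exists_eq_mul_of_ne_zero {k : Type*} [Field k] [IsAlgClosed k]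
    (a b : Polynomial k) (ha : a ≠ 0) (hb : b ≠ 0) (h : Polynomial (Polynomial k))
    (hne : ∀ s t, a.eval s ≠ 0 → b.eval t ≠ 0 → h.evalEval s t ≠ 0) :
    ∃ f₁ f₂ : Polynomial k, h = Polynomial.C f₁ * f₂.map Polynomial.C := by
  classical
  induction hn : h.natDegree generalizing h with
  | zero =>
    refine ⟨h.coeff 0, 1, ?_⟩
    rw [Polynomial.map_one, mul_one]
    exact Polynomial.eq_C_of_natDegree_eq_zero hn
  | succ n ih =>
    have hh0 : h ≠ 0 := by rintro rfl; simp at hn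
    have hlc : h.leadingCoeff ≠ 0 := Polynomial.leadingCoeff_ne_zero.2 hh0
    have hinf : {s : k | (a * h.leadingCoeff).eval s ≠ 0}.Infinite := by
      have := (Polynomial.finite_setOfPred_isRoot (mul_ne_zero ha hlc)).infinite_compl
      exact this
    have hroot : ∀ s : {s : k | (a * h.leadingCoeff).eval s ≠ 0}, ∃ t : {t // t ∈ b.roots.toFinset},
        h.evalEval s.1 t.1 = 0 := by
      rintro ⟨s, hs⟩
      rw [Set.mem_ofPred_eq, Polynomial.eval_mul] at hs
      have hdeg : (h.map (Polynomial.evalRingHom s)).natDegree = n + 1 := by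
        rw [← hn]
        exact Polynomial.natDegree_map_of_leadingCoeff_ne_zero _ (right_ne_zero_of_mul hs)
      obtain ⟨t, ht⟩ := IsAlgClosed.exists_root (h.map (Polynomial.evalRingHom s)) (fun h0 => by
        have := Polynomial.natDegree_eq_of_degree_eq_some (n := 0) (by simpa using h0)
        omega)
      have ht' : h.evalEval s t = 0 := by
        rw [← Polynomial.eval₂_evalRingHom, ← Polynomial.eval_map]; exact ht
      refine ⟨⟨t, ?_⟩, ht'⟩
      rw [Multiset.mem_toFinset, Polynomial.mem_roots hb, Polynomial.IsRoot]
      by_contra hbt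
      exact hne s t (left_ne_zero_of_mul hs) hbt ht'
    choose F hF using hroot
    have : Infinite {s : k | (a * h.leadingCoeff).eval s ≠ 0} := hinf.to_subtype
    obtain ⟨t, ht⟩ := Finite.exists_infinite_fiber F
    have h0 : h.eval (Polynomial.C t.1) = 0 := by
      refine Polynomial.eq_zero_of_infinite_isRoot _ ?_
      refine ((Set.infinite_coe_iff.1 ht).image Subtype.val_injective.injOn).mono ?_
      rintro _ ⟨s, hs, rfl⟩
      have := hF s
      rw [show F s = t from hs] at this
      exact this
    obtain ⟨h', rfl⟩ := Polynomial.dvd_iff_isRoot.2 h0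
    have hh' : h' ≠ 0 := right_ne_zero_of_mul hh0
    obtain ⟨f₁, f₂, e⟩ := ih h' (fun s t' hs ht' h0' => hne s t' hs ht' (by
        rw [Polynomial.evalEval_mul, h0', mul_zero])) (by
      rw [Polynomial.natDegree_mul (Polynomial.X_sub_C_ne_zero _) hh',
        Polynomial.natDegree_X_sub_C] at hn
      omega)
    refine ⟨f₁, (Polynomial.X - Polynomial.C t.1) * f₂, ?_⟩
    rw [e]
    simp only [Polynomial.map_mul, Polynomial.map_sub, Polynomial.map_X, Polynomial.map_C]
    ring

/-- Over the field `k(λ)` the kernel of a unimodular row is free; a basis with cleared denominators,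
together with the vector `s`, has a non-zero determinant without `μ`. -/
theorem Polynomial.exists_kernel_family {k : Type*} [Field k] {n : ℕ}
    (q s : Fin (n + 1) → Polynomial (Polynomial k)) (c : Polynomial k) (hc : c ≠ 0)
    (hs : ∑ w, s w * q w = Polynomial.C c) :
    ∃ (u : Fin n → Fin (n + 1) → Polynomial (Polynomial k)) (d : Polynomial k),
      (∀ j, ∑ w, u j w * q w = 0) ∧ d ≠ 0 ∧
      (Matrix.of (Fin.cons s u : Fin (n + 1) → Fin (n + 1) → _)).det = Polynomial.C d := by
  classical
  let K := FractionRing (Polynomial k)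
  let m := algebraMap (Polynomial k) K
  have hinj : Function.Injective m := IsFractionRing.injective _ _
  have hinj' : Function.Injective (Polynomial.map m) := Polynomial.map_injective _ hinj
  have hc' : m c ≠ 0 := fun h => hc (hinj (by rw [h, map_zero]))
  let q' : Fin (n + 1) → Polynomial K := fun w => (q w).map m
  let s' : Fin (n + 1) → Polynomial K := fun w => (s w).map m
  have hs' : ∑ w, s' w * q' w = Polynomial.C (m c) := by
    simp only [s', q', ← Polynomial.map_mul]
    rw [← Polynomial.map_sum, hs, Polynomial.map_C]
  let l : (Fin (n + 1) → Polynomial K) →ₗ[Polynomial K] Polynomial K :=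
    Fintype.linearCombination (Polynomial K) q'
  have hl : ∀ z, l z = ∑ w, z w * q' w := fun z => by
    simp [l, Fintype.linearCombination_apply]
  have hsurj : Function.Surjective l := fun z => by
    refine ⟨(z * Polynomial.C (m c)⁻¹) • s', ?_⟩
    rw [map_smul, hl, hs', smul_eq_mul, mul_assoc, ← Polynomial.C_mul, inv_mul_cancel₀ hc',
      Polynomial.C_1, mul_one]
  have hrank : Module.finrank (Polynomial K) (LinearMap.ker l) = n := by
    have := LinearMap.rank_range_add_rank_ker l
    rw [LinearMap.range_eq_top.2 hsurj, rank_top, Module.rank_self, rank_fun',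
      Fintype.card_fin] at this
    have h2 : Module.rank (Polynomial K) (LinearMap.ker l) = n := by
      rw [Nat.cast_add, Nat.cast_one, add_comm] at this
      exact Cardinal.eq_of_add_eq_add_right this Cardinal.one_lt_aleph0
    exact Module.finrank_eq_of_rank_eq h2
  have hfree : Module.Free (Polynomial K) (LinearMap.ker l) :=
    Module.Free.of_basis (Submodule.nonempty_basis_of_pid (Pi.basisFun _ _)
      (LinearMap.ker l)).choose_spec.some
  let v := (Module.finBasisOfFinrankEq (Polynomial K) (LinearMap.ker l) hrank)
  let M : Matrix (Fin (n + 1)) (Fin (n + 1)) (Polynomial K) :=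
    Matrix.of (Fin.cons s' fun j => (v j : Fin (n + 1) → Polynomial K))
  have hM : IsUnit M.det := by
    have hsur : Function.Surjective fun z => Matrix.vecMul z M := fun z => by
      let r₀ := l z * Polynomial.C (m c)⁻¹
      have hz : z - r₀ • s' ∈ LinearMap.ker l := by
        rw [LinearMap.mem_ker, map_sub, map_smul, hl s', hs', smul_eq_mul, mul_assoc,
          ← Polynomial.C_mul, inv_mul_cancel₀ hc', Polynomial.C_1, mul_one, sub_self]
      refine ⟨Fin.cons r₀ (v.repr ⟨_, hz⟩), ?_⟩
      have e := congrArg Subtype.val (v.sum_repr ⟨_, hz⟩)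
      simp only [AddSubmonoidClass.coe_finsetSum, SetLike.val_smul] at e
      funext i
      have ei := congrFun e i
      simp only [Finset.sum_apply, Pi.smul_apply, Pi.sub_apply, smul_eq_mul] at ei
      simp only [Matrix.vecMul, dotProduct, Fin.sum_univ_succ, M, Matrix.of_apply, Fin.cons_zero,
        Fin.cons_succ]
      rw [ei]; ring
    obtain ⟨N, hN⟩ := Matrix.vecMul_surjective_iff_exists_left_inverse.1 hsur
    exact Matrix.isUnit_det_of_left_inverse hN
  obtain ⟨r, hr, w, hw⟩ := Polynomial.exists_clear_denominators (R := Polynomial k) (K := K)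
    (fun x : Fin n × Fin (n + 1) => (v x.1 : Fin (n + 1) → Polynomial K) x.2)
  have hr' : m r ≠ 0 := fun h => hr (hinj (by rw [h, map_zero]))
  have hdet : (Matrix.of (Fin.cons s (fun j i => w (j, i)) :
      Fin (n + 1) → Fin (n + 1) → _)).det.map m =
      Polynomial.C (m r) ^ n * M.det := by
    have e : (Polynomial.mapRingHom m).mapMatrix (Matrix.of (Fin.cons s (fun j i => w (j, i)) :
      Fin (n + 1) → Fin (n + 1) → _)) =
        Matrix.diagonal (Fin.cons 1 fun _ : Fin n => Polynomial.C (m r)) * M := by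
      ext1 i j
      rw [Matrix.diagonal_mul]
      refine Fin.cases ?_ (fun i => ?_) i
      · simp [M, s']
      · simp only [RingHom.mapMatrix_apply, Matrix.map_apply, Matrix.of_apply, Fin.cons_succ, M]
        exact hw (i, j)
    have := congrArg Matrix.det e
    rw [← RingHom.map_det, Matrix.det_mul, Matrix.det_diagonal, Fin.prod_univ_succ] at this
    simpa using this
  have hu : IsUnit (Polynomial.C (m r) ^ n * M.det) :=
    ((Polynomial.isUnit_C.2 hr'.isUnit).pow n).mul hM
  rw [← hdet] at hu
  have hdeg := Polynomial.natDegree_eq_zero_of_isUnit hu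
  rw [Polynomial.natDegree_map_eq_of_injective hinj] at hdeg
  have hC := Polynomial.eq_C_of_natDegree_eq_zero hdeg
  refine ⟨fun j i => w (j, i), _, fun j => hinj' ?_, ?_, hC⟩
  · have hv := (v j).2
    rw [LinearMap.mem_ker, hl] at hv
    simp only [Polynomial.map_sum, Polynomial.map_mul, Polynomial.map_zero,
      show ∀ i, (w i).map m = _ from hw, mul_assoc]
    rw [← Finset.mul_sum]
    exact (congrArg _ hv).trans (mul_zero _)
  · intro h0
    rw [hC, h0] at hu
    simp at hu

/-- If the determinant of a kernel family vanishes at `λ = a`, but `c` does not, then the family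
can be improved: a relation between its members at `λ = a` may be taken to be part of a basis of
`k[μ]ⁿ`, which lifts to `k[λ][μ]`, and after the change of basis one member is divisible by
`λ - a`. -/
theorem Polynomial.exists_kernel_family_of_root {k : Type*} [Field k] {n : ℕ}
    (q s : Fin (n + 1) → Polynomial (Polynomial k)) (c : Polynomial k)
    (hs : ∑ w, s w * q w = Polynomial.C c)
    (u : Fin n → Fin (n + 1) → Polynomial (Polynomial k)) (d : Polynomial k)
    (hu : ∀ j, ∑ w, u j w * q w = 0) (hd0 : d ≠ 0)
    (hd : (Matrix.of (Fin.cons s u : Fin (n + 1) → Fin (n + 1) → _)).det = Polynomial.C d)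
    (a : k) (hca : c.eval a ≠ 0) (hda : d.eval a = 0) :
    ∃ (u' : Fin n → Fin (n + 1) → Polynomial (Polynomial k)) (d' : Polynomial k),
      (∀ j, ∑ w, u' j w * q w = 0) ∧ d' ≠ 0 ∧
      (Matrix.of (Fin.cons s u' : Fin (n + 1) → Fin (n + 1) → _)).det = Polynomial.C d' ∧
      d'.natDegree < d.natDegree := by
  classical
  let e : Polynomial (Polynomial k) →+* Polynomial k :=
    Polynomial.mapRingHom (Polynomial.evalRingHom a)
  let lift : Polynomial k →+* Polynomial (Polynomial k) := Polynomial.mapRingHom Polynomial.C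
  have he : ∀ f, e (lift f) = f := fun f => by
    simp only [e, lift, Polynomial.coe_mapRingHom, Polynomial.map_map]
    convert Polynomial.map_id
    ext; simp
  have heC : ∀ f, e (Polynomial.C f) = Polynomial.C (f.eval a) := fun f => by simp [e]
  have hdvd : ∀ f, e f = 0 → Polynomial.C (Polynomial.X - Polynomial.C a) ∣ f := fun f hf => by
    rw [Polynomial.C_dvd_iff_dvd_coeff]
    intro i
    rw [Polynomial.dvd_iff_isRoot]
    have := congrArg (fun p => Polynomial.coeff p i) hf
    simpa [e, Polynomial.coeff_map] using this
  set M : Matrix (Fin (n + 1)) (Fin (n + 1)) (Polynomial (Polynomial k)) :=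
    Matrix.of (Fin.cons s u) with hMdef
  have hdet0 : (e.mapMatrix M).det = 0 := by
    rw [← RingHom.map_det, hd, heC, hda, Polynomial.C_0]
  obtain ⟨r, hr0, hr⟩ := Matrix.exists_vecMul_eq_zero_iff.2 hdet0
  have hrw : ∀ w, r 0 * e (s w) + ∑ j : Fin n, r j.succ * e (u j w) = 0 := fun w => by
    have := congrFun hr w
    simpa [Matrix.vecMul, dotProduct, Fin.sum_univ_succ, hMdef] using this
  have hr00 : r 0 = 0 := by
    have h1 : ∑ w, (r 0 * e (s w) + ∑ j : Fin n, r j.succ * e (u j w)) * e (q w) = 0 :=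
      Finset.sum_eq_zero fun w _ => by rw [hrw, zero_mul]
    have h2 : ∑ w, (r 0 * e (s w) + ∑ j : Fin n, r j.succ * e (u j w)) * e (q w) =
        r 0 * e (∑ w, s w * q w) + ∑ j : Fin n, r j.succ * e (∑ w, u j w * q w) := by
      simp only [map_sum, map_mul, Finset.mul_sum, add_mul, Finset.sum_add_distrib,
        Finset.sum_mul, mul_assoc]
      rw [Finset.sum_comm (s := (Finset.univ : Finset (Fin n)))]
    rw [h2, hs, heC] at h1
    simp only [hu, map_zero, mul_zero, Finset.sum_const_zero, add_zero] at h1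
    exact (mul_eq_zero.1 h1).resolve_right (by simpa using hca)
  -- the module of relations between the members at `λ = a`
  let N : Submodule (Polynomial k) (Fin n → Polynomial k) :=
    LinearMap.ker (Fintype.linearCombination (Polynomial k) fun j => fun w => e (u j w))
  have hN : ∀ z, z ∈ N ↔ ∀ w, ∑ j, z j * e (u j w) = 0 := fun z => by
    rw [LinearMap.mem_ker, Fintype.linearCombination_apply, funext_iff]
    simp
  have hNne : N ≠ ⊥ := by
    intro h
    have hmem : (fun j : Fin n => r j.succ) ∈ N := (hN _).2 fun w => by
      have := hrw w
      rwa [hr00, zero_mul, zero_add] at this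
    rw [h, Submodule.mem_bot] at hmem
    refine hr0 ?_
    funext i
    exact Fin.cases (motive := fun i => r i = 0) hr00 (fun j => congrFun hmem j) i
  obtain ⟨nn, snf⟩ := N.smithNormalForm (Pi.basisFun (Polynomial k) (Fin n))
  have hnn : 0 < nn := by
    rcases Nat.eq_zero_or_pos nn with rfl | h
    · have := snf.bN.repr.toEquiv.subsingleton
      exact absurd (Submodule.eq_bot_of_subsingleton ) hNne
    · exact h
  let j₀ := snf.f ⟨0, hnn⟩
  have hj₀ : snf.bM j₀ ∈ N := by
    have h1 := snf.snf ⟨0, hnn⟩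
    have h2 : snf.a ⟨0, hnn⟩ ≠ 0 := fun h => by
      rw [h, zero_smul] at h1
      exact snf.bN.ne_zero ⟨0, hnn⟩ (Subtype.ext h1)
    have h3 : snf.a ⟨0, hnn⟩ • snf.bM j₀ ∈ N := h1 ▸ (snf.bN ⟨0, hnn⟩).2
    rw [hN] at h3 ⊢
    intro w
    have h4 := h3 w
    simp only [Pi.smul_apply, smul_eq_mul, mul_assoc] at h4
    rw [← Finset.mul_sum] at h4
    exact (mul_eq_zero.1 h4).resolve_left h2
  let B : Matrix (Fin n) (Fin n) (Polynomial k) := Matrix.of fun j i => snf.bM j i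
  have hB : IsUnit B.det := by
    have h1 := (Pi.basisFun (Polynomial k) (Fin n)).isUnit_det snf.bM
    have : Module.Basis.det (Pi.basisFun (Polynomial k) (Fin n)) snf.bM = B.det := by
      rw [Module.Basis.det_apply, ← Matrix.det_transpose]
      rfl
    rwa [this] at h1
  let u₁ : Fin n → Fin (n + 1) → Polynomial (Polynomial k) := fun j w => ∑ i, lift (B j i) * u i w
  have hu₁ : ∀ j, ∑ w, u₁ j w * q w = 0 := fun j => by
    simp only [u₁, Finset.sum_mul, mul_assoc]
    rw [Finset.sum_comm]
    simp only [← Finset.mul_sum, hu, mul_zero, Finset.sum_const_zero]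
  have hu₁0 : ∀ w, Polynomial.C (Polynomial.X - Polynomial.C a) ∣ u₁ j₀ w := fun w => by
    apply hdvd
    simp only [u₁, map_sum, map_mul, he]
    exact (hN _).1 hj₀ w
  choose t ht using hu₁0
  let u₂ := Function.update u₁ j₀ t
  have hX : (Polynomial.X - Polynomial.C a : Polynomial k) ≠ 0 := Polynomial.X_sub_C_ne_zero a
  have hX' : Polynomial.C (Polynomial.X - Polynomial.C a) ≠ 0 := Polynomial.C_ne_zero.2 hX
  have hu₂ : ∀ j, ∑ w, u₂ j w * q w = 0 := fun j => by
    by_cases hj : j = j₀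
    · subst hj
      have := hu₁ j₀
      simp only [ht, mul_assoc] at this
      rw [← Finset.mul_sum] at this
      simpa [u₂] using (mul_eq_zero.1 this).resolve_left hX'
    · simpa [u₂, hj] using hu₁ j
  let M₁ : Matrix (Fin (n + 1)) (Fin (n + 1)) (Polynomial (Polynomial k)) :=
    Matrix.of (Fin.cons s u₁)
  let M₂ : Matrix (Fin (n + 1)) (Fin (n + 1)) (Polynomial (Polynomial k)) :=
    Matrix.of (Fin.cons s u₂)
  have hM₁ : M₁.det = lift B.det * M.det := by
    let R : Matrix (Fin (n + 1)) (Fin (n + 1)) (Polynomial (Polynomial k)) :=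
      Matrix.of (Fin.cons (Fin.cons 1 0) fun j => Fin.cons 0 fun i => lift (B j i))
    have hR : R.det = lift B.det := by
      rw [Matrix.det_succ_row_zero, Fin.sum_univ_succ, Finset.sum_eq_zero, add_zero,
        RingHom.map_det]
      · simp only [Fin.val_zero, pow_zero, R, Matrix.of_apply, Fin.cons_zero, one_mul]
        congr 1
      · intro i _
        simp [R]
    have : M₁ = R * M := by
      ext1 i w
      rw [Matrix.mul_apply, Fin.sum_univ_succ]
      refine Fin.cases ?_ (fun j => ?_) i
      · simp [M₁, R, hMdef]
      · simp [M₁, R, hMdef, u₁]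
    rw [this, Matrix.det_mul, hR]
  have hM₂ : M₁.det = Polynomial.C (Polynomial.X - Polynomial.C a) * M₂.det := by
    have : M₁ = M₂.updateRow j₀.succ
        (Polynomial.C (Polynomial.X - Polynomial.C a) • (M₂ j₀.succ)) := by
      ext1 i w
      rw [Matrix.updateRow_apply]
      refine Fin.cases ?_ (fun j => ?_) i
      · simp [M₁, M₂, (Fin.succ_ne_zero _).symm]
      · by_cases hj : j = j₀
        · subst hj
          simpa [M₁, M₂, u₂] using ht w
        · simp [M₁, M₂, u₂, hj]
    rw [this, Matrix.det_updateRow_smul, Matrix.updateRow_eq_self]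
  obtain ⟨b, hb, hb'⟩ := Polynomial.isUnit_iff.1 hB
  obtain ⟨d', hd'⟩ := Polynomial.dvd_iff_isRoot.2 hda
  have hd'0 : d' ≠ 0 := right_ne_zero_of_mul (hd' ▸ hd0)
  refine ⟨u₂, Polynomial.C b * d', hu₂,
    mul_ne_zero (Polynomial.C_ne_zero.2 hb.ne_zero) hd'0, ?_, ?_⟩
  · apply mul_left_cancel₀ hX'
    refine hM₂.symm.trans ?_
    rw [hM₁, hd, ← hb', hd']
    simp only [lift, Polynomial.coe_mapRingHom, Polynomial.map_C, ← Polynomial.C_mul]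
    congr 1
    ring
  · rw [Polynomial.natDegree_C_mul hb.ne_zero, hd', Polynomial.natDegree_mul hX hd'0,
      Polynomial.natDegree_X_sub_C]
    omega

/-- The kernel of a row `q` of bivariate polynomials with `∑ s w * q w = c(λ)` is free after
localization at `c`. -/
theorem Polynomial.exists_kernel_frame {k : Type*} [Field k] {n : ℕ}
    (q s : Fin (n + 1) → Polynomial (Polynomial k)) (c : Polynomial k) (hc : c ≠ 0)
    (hs : ∑ w, s w * q w = Polynomial.C c) :
    ∃ u : Fin n → Fin (n + 1) → Polynomial (Polynomial k),
      (∀ j, ∑ w, u j w * q w = 0) ∧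
      ∀ a b, c.eval a ≠ 0 →
        LinearIndependent k fun j => fun w => (u j w).evalEval a b := by
  classical
  let Good : ℕ → Prop := fun N => ∃ (u : Fin n → Fin (n + 1) → Polynomial (Polynomial k))
    (d : Polynomial k), (∀ j, ∑ w, u j w * q w = 0) ∧ d ≠ 0 ∧
      (Matrix.of (Fin.cons s u : Fin (n + 1) → Fin (n + 1) → _)).det = Polynomial.C d ∧
      d.natDegree = N
  have hex : ∃ N, Good N := by
    obtain ⟨u, d, h1, h2, h3⟩ := Polynomial.exists_kernel_family q s c hc hs
    exact ⟨_, u, d, h1, h2, h3, rfl⟩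
  obtain ⟨u, d, h1, h2, h3, h4⟩ := Nat.find_spec hex
  refine ⟨u, h1, fun a b hca => ?_⟩
  have hda : d.eval a ≠ 0 := fun hda => by
    obtain ⟨u', d', h1', h2', h3', h4'⟩ :=
      Polynomial.exists_kernel_family_of_root q s c hs u d h1 h2 h3 a hca hda
    exact Nat.find_min hex (h4 ▸ h4') ⟨u', d', h1', h2', h3', rfl⟩
  have hdet : IsUnit ((Polynomial.evalEvalRingHom a b).mapMatrix
      (Matrix.of (Fin.cons s u : Fin (n + 1) → Fin (n + 1) → _))) := by
    rw [Matrix.isUnit_iff_isUnit_det, ← RingHom.map_det, h3, Polynomial.coe_evalEvalRingHom,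
      Polynomial.evalEval_C]
    exact hda.isUnit
  have hli := Matrix.linearIndependent_rows_iff_isUnit.2 hdet
  exact hli.comp Fin.succ (Fin.succ_injective n)

/-! ### Freely parameterized problems -/

namespace ParamProblem

variable {k : Type u} [Field k] {P : ParamProblem k}

theorem domOf_nonempty [Infinite k] {A : Type} (g : A → Polynomial k) (hg : ∀ a, g a ≠ 0) :
    (domOf g).Nonempty := by
  have : ∀ a, ∃ t, (g a).eval t ≠ 0 := fun a => by
    by_contra! h
    exact hg a (Polynomial.funext fun t => by rw [h t, Polynomial.eval_zero])
  choose x hx using this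
  exact ⟨x, hx⟩

/-- Polynomial identities in the left and right parameters may be checked on the domain. -/
theorem eq_zero_of_eval_domOf [Infinite k] {A : Type} (g : A → Polynomial k) (hg : ∀ a, g a ≠ 0)
    (f : MvPolynomial (A ⊕ A) k) (hf : ∀ x ∈ domOf g, ∀ y ∈ domOf g, eval (Sum.elim x y) f = 0) :
    f = 0 := by
  refine MvPolynomial.funext_set (fun a : A ⊕ A => {t : k | (g (Sum.elim id id a)).eval t ≠ 0})
    (fun a => ?_) fun x hx => ?_
  · exact (Polynomial.finite_setOfPred_isRoot (hg _)).infinite_compl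
  · rw [map_zero, ← Sum.elim_comp_inl_inr x]
    exact hf _ (fun a => hx (Sum.inl a) trivial) _ fun a => hx (Sum.inr a) trivial

theorem eval_congr_of_vars {A : Type*} {f : MvPolynomial A k} {x y : A → k}
    (h : ∀ a ∈ f.vars, x a = y a) : eval x f = eval y f :=
  MvPolynomial.eval₂Hom_congr' rfl (fun a ha _ => h a ha) rfl

theorem IsFreelyParameterized.dom_nonempty [Infinite k] (hP : P.IsFreelyParameterized) :
    P.dom.Nonempty := by
  obtain ⟨g, hg, h⟩ := hP.dom_eq
  rw [h]; exact domOf_nonempty g hg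

theorem IsFreelyParameterized.vars_H (hP : P.IsFreelyParameterized) {i j : P.T} {a : P.Par}
    (h : a ∈ (P.H i j).vars) : P.cls i = P.cls j ∧ P.Attached a (P.cls i) := by
  have hij : P.cls i = P.cls j := by
    by_contra hne
    rw [hP.H_supp i j hne, vars_0] at h
    simp at h
  exact ⟨hij, i, j, rfl, hij.symm, h⟩

theorem IsFreelyParameterized.Hat_supp (hP : P.IsFreelyParameterized) {i j : P.T} (x : P.Par → k)
    (h : P.cls i ≠ P.cls j) : P.Hat x i j = 0 := by
  rw [Hat, Matrix.map_apply, hP.H_supp i j h, map_zero]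

theorem IsFreelyParameterized.Hat_congr (hP : P.IsFreelyParameterized) {i j : P.T}
    {x y : P.Par → k} (h : ∀ a, P.Attached a (P.cls i) → x a = y a) :
    P.Hat x i j = P.Hat y i j :=
  eval_congr_of_vars fun a ha => h a (hP.vars_H ha).2

namespace Layer

variable (L : P.Layer)

/-- The basis element `ζ w` of the radical at the values `x` and `y` of the parameters. -/
noncomputable def zeta (w : L.ι) (x y : P.Par → k) : Matrix P.T P.T k :=
  (L.ζ w).map (MvPolynomial.eval (Sum.elim x y))

variable {L}

theorem zeta_supp {w : L.ι} {x y : P.Par → k} {i j : P.T} (h : L.zeta w x y i j ≠ 0) :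
    i < j ∧ P.cls i = L.src w ∧ P.cls j = L.tgt w :=
  L.supp w i j fun h0 => h (by rw [zeta, Matrix.map_apply, h0, map_zero])

theorem zeta_diag (w : L.ι) (x y : P.Par → k) (i : P.T) : L.zeta w x y i i = 0 := by
  by_contra h; exact lt_irrefl _ (zeta_supp h).1

theorem mem_iff' {x y : P.Par → k} (hx : x ∈ P.dom) (hy : y ∈ P.dom) {S : Matrix P.T P.T k} :
    S ∈ P.K x y ↔ ∃ (s : P.V → k) (c : L.ι → k),
      (∀ I a, P.Attached a I → s I ≠ 0 → x a = y a) ∧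
      S = Matrix.diagonal (fun i => s (P.cls i)) + ∑ w, c w • L.zeta w x y :=
  L.mem_iff x hx y hy S

theorem zeta_mem {x y : P.Par → k} (hx : x ∈ P.dom) (hy : y ∈ P.dom) (w : L.ι) :
    L.zeta w x y ∈ P.K x y := by
  classical
  refine (mem_iff' hx hy).2 ⟨0, Pi.single w 1, fun _ _ _ h => absurd rfl h, ?_⟩
  ext i j
  simp [Pi.single_apply]

theorem sum_zeta_diag (c : L.ι → k) (x y : P.Par → k) (i : P.T) :
    (∑ w, c w • L.zeta w x y) i i = 0 := by
  simp [Matrix.sum_apply, zeta_diag]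

theorem sum_zeta_lower (c : L.ι → k) (x y : P.Par → k) {i j : P.T} (h : ¬ i < j) :
    (∑ w, c w • L.zeta w x y) i j = 0 := by
  rw [Matrix.sum_apply]
  refine Finset.sum_eq_zero fun w _ => ?_
  rw [Matrix.smul_apply, smul_eq_mul, mul_eq_zero]
  exact Or.inr (by_contra fun h0 => h (zeta_supp h0).1)

/-- The coefficients of an element of the radical which vanishes on the component `(I, J)` vanish
at the dotted arrows from `I` to `J`. -/
theorem coeff_eq_zero {x y : P.Par → k} (hx : x ∈ P.dom) (hy : y ∈ P.dom) {c : L.ι → k}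
    {I J : P.V} (h : ∀ i j, P.cls i = I → P.cls j = J → (∑ w, c w • L.zeta w x y) i j = 0)
    {w : L.ι} (h₁ : L.src w = I) (h₂ : L.tgt w = J) : c w = 0 := by
  classical
  have hli := Fintype.linearIndependent_iff.1 (L.indep x hx y hy)
    (fun w => if L.src w = I ∧ L.tgt w = J then c w else 0) ?_ w
  · simpa [h₁, h₂] using hli
  ext i j
  by_cases hij : P.cls i = I ∧ P.cls j = J
  · rw [Matrix.zero_apply, ← h i j hij.1 hij.2, Matrix.sum_apply, Matrix.sum_apply]
    refine Finset.sum_congr rfl fun v _ => ?_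
    rw [Matrix.smul_apply, Matrix.smul_apply]
    by_cases hv : L.src v = I ∧ L.tgt v = J
    · rw [if_pos hv]; rfl
    · have : L.zeta v x y i j = 0 := by
        by_contra h0
        have := (zeta_supp h0).2
        exact hv ⟨this.1.symm.trans hij.1, this.2.symm.trans hij.2⟩
      rw [this]
      change _ • L.zeta v x y i j = _
      rw [this, smul_zero, smul_zero]
  · rw [Matrix.zero_apply, Matrix.sum_apply]
    refine Finset.sum_eq_zero fun v _ => ?_
    rw [Matrix.smul_apply]
    change _ • L.zeta v x y i j = _
    by_cases hv : L.src v = I ∧ L.tgt v = J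
    · have : L.zeta v x y i j = 0 := by
        by_contra h0
        have := (zeta_supp h0).2
        exact hij ⟨this.1.trans hv.1, this.2.trans hv.2⟩
      rw [this, smul_zero]
    · rw [if_neg hv, zero_smul]

theorem coeff_eq_zero_of_sum {x y : P.Par → k} (hx : x ∈ P.dom) (hy : y ∈ P.dom) {c : L.ι → k}
    (h : ∑ w, c w • L.zeta w x y = 0) (w : L.ι) : c w = 0 :=
  coeff_eq_zero hx hy (I := L.src w) (J := L.tgt w) (fun i j _ _ => by rw [h]; rfl) rfl rfl

end Layer

theorem K_lower (hP : P.IsFreelyParameterized) {x y : P.Par → k} (hx : x ∈ P.dom) (hy : y ∈ P.dom)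
    {S : Matrix P.T P.T k} (hS : S ∈ P.K x y) {i j : P.T} (h : j < i) : S i j = 0 := by
  obtain ⟨L⟩ := hP.layer
  obtain ⟨s, c, -, rfl⟩ := (L.mem_iff' hx hy).1 hS
  rw [Matrix.add_apply, L.sum_zeta_lower c x y (not_lt.2 h.le), Matrix.diagonal_apply_ne _ h.ne',
    add_zero]

/-- The idempotent of the class `I` belongs to `𝒦`. -/
theorem idem_mem (hP : P.IsFreelyParameterized) {x : P.Par → k} (hx : x ∈ P.dom) (s : P.V → k) :
    Matrix.diagonal (fun i => s (P.cls i)) ∈ P.K x x := by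
  obtain ⟨L⟩ := hP.layer
  exact (L.mem_iff' hx hx).2 ⟨s, 0, fun _ _ _ _ => rfl, by simp⟩

open Classical in
theorem component_mem [Infinite k] (hP : P.IsFreelyParameterized) {m : Matrix P.T P.T k}
    (hm : m ∈ P.M) (A B : P.V → Prop) :
    (fun i j => if A (P.cls i) ∧ B (P.cls j) then m i j else 0 : Matrix P.T P.T k) ∈ P.M := by
  obtain ⟨x, hx⟩ := hP.dom_nonempty
  have h1 := hP.K_M x hx x hx _ (idem_mem hP hx fun V => if A V then 1 else 0) m hm
  have h2 := hP.M_K x hx x hx _ (idem_mem hP hx fun V => if B V then 1 else 0) _ h1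
  refine (congrArg (· ∈ P.M) ?_).mpr h2
  ext i j
  rw [Matrix.mul_diagonal, Matrix.diagonal_mul]
  by_cases h : A (P.cls i) <;> by_cases h' : B (P.cls j) <;> simp [h, h']

theorem prec_iff {i j i' j' : P.T} : P.Prec i j i' j' ↔
    toLex (OrderDual.toDual i, j) < toLex (OrderDual.toDual i', j') := by
  rw [Prod.Lex.toLex_lt_toLex, Prec]
  simp

/-- All elements of `ℳ` vanish before the first free position. -/
theorem IsFirst.eq_zero_of_prec [Infinite k] (hP : P.IsFreelyParameterized) {p q : P.T}
    {ρ : Matrix P.T P.T k} (hρ : P.IsFirst p q ρ) {m : Matrix P.T P.T k} (hm : m ∈ P.M) {i j : P.T}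
    (h : P.Prec i j p q) : m i j = 0 := by
  classical
  by_contra hne
  obtain ⟨⟨i₀, j₀⟩, h₀, hmin⟩ := Finset.exists_min_image
    (Finset.univ.filter fun z : P.T × P.T => m z.1 z.2 ≠ 0)
    (fun z => toLex (OrderDual.toDual z.1, z.2)) ⟨(i, j), by simpa using hne⟩
  simp only [Finset.mem_filter, Finset.mem_univ, true_and] at h₀ hmin
  have hz : ∀ i' j', P.Prec i' j' i₀ j₀ → m i' j' = 0 := fun i' j' h' => by
    by_contra h''
    exact absurd (hmin (i', j') h'') (not_le.2 (prec_iff.1 h'))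
  have hfree : P.FreePos i₀ j₀ := by
    refine ⟨_, ⟨component_mem hP hm (· = P.cls i₀) (· = P.cls j₀), fun i j hij => ?_⟩, ?_, ?_⟩
    · by_contra h'
      exact hij (if_neg h')
    · simpa using h₀
    · intro i' j' h'
      change (if _ then _ else _) = _
      rw [hz i' j' h', ite_self]
  have h1 := hmin (i, j) hne
  rw [prec_iff] at h
  rcases hρ.first _ _ hfree with ⟨rfl, rfl⟩ | h2
  · exact absurd h1 (not_le.2 h)
  · exact absurd h1 (not_le.2 (h.trans (prec_iff.1 h2)))

/-- As the entries of `ℳ` before the first free position vanish, a triangular matrix acts on the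
entry at `(p, q)` through its diagonal entry alone. -/
theorem IsFirst.mul_apply [Infinite k] (hP : P.IsFreelyParameterized) {p q : P.T}
    {ρ : Matrix P.T P.T k} (hρ : P.IsFirst p q ρ) {m : Matrix P.T P.T k} (hm : m ∈ P.M)
    {x y : P.Par → k} (hx : x ∈ P.dom) (hy : y ∈ P.dom) {S : Matrix P.T P.T k}
    (hS : S ∈ P.K x y) : (S * m) p q = S p p * m p q := by
  rw [Matrix.mul_apply, Finset.sum_eq_single p]
  · intro i _ hi
    rcases lt_or_gt_of_ne hi with h | h
    · rw [K_lower hP hx hy hS h, zero_mul]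
    · rw [hρ.eq_zero_of_prec hP hm (Or.inl h), mul_zero]
  · simp

theorem IsFirst.apply_mul [Infinite k] (hP : P.IsFreelyParameterized) {p q : P.T}
    {ρ : Matrix P.T P.T k} (hρ : P.IsFirst p q ρ) {m : Matrix P.T P.T k} (hm : m ∈ P.M)
    {x y : P.Par → k} (hx : x ∈ P.dom) (hy : y ∈ P.dom) {S : Matrix P.T P.T k}
    (hS : S ∈ P.K x y) : (m * S) p q = m p q * S q q := by
  rw [Matrix.mul_apply, Finset.sum_eq_single q]
  · intro j _ hj
    rcases lt_or_gt_of_ne hj with h | h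
    · rw [hρ.eq_zero_of_prec hP hm (Or.inr ⟨rfl, h⟩), zero_mul]
    · rw [K_lower hP hx hy hS h, mul_zero]
  · simp

/-! ### The differential of the first arrow -/

theorem dif_diagonal (hP : P.IsFreelyParameterized) {x y : P.Par → k} {s : P.V → k}
    (hs : ∀ I a, P.Attached a I → s I ≠ 0 → x a = y a) :
    P.dif x y (Matrix.diagonal fun i => s (P.cls i)) = 0 := by
  ext i j
  rw [dif, Matrix.sub_apply, Matrix.diagonal_mul, Matrix.mul_diagonal, Matrix.zero_apply]
  by_cases h : P.cls i = P.cls j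
  · by_cases hz : s (P.cls i) = 0
    · rw [← h, hz]; ring
    · rw [hP.Hat_congr fun a ha => hs _ a ha hz, h]; ring
  · rw [hP.Hat_supp _ h, hP.Hat_supp _ h]; ring

theorem dif_sum_smul (x y : P.Par → k) {ι : Type*} [Fintype ι] (c : ι → k)
    (Z : ι → Matrix P.T P.T k) :
    P.dif x y (∑ w, c w • Z w) = ∑ w, c w • P.dif x y (Z w) := by
  simp only [dif, Matrix.sum_mul, Matrix.mul_sum, Matrix.smul_mul, Matrix.mul_smul, smul_sub,
    Finset.sum_sub_distrib]

theorem dif_add (x y : P.Par → k) (A B : Matrix P.T P.T k) :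
    P.dif x y (A + B) = P.dif x y A + P.dif x y B := by
  simp only [dif, add_mul, mul_add]
  abel

theorem eval_delta (L : P.Layer) (p q : P.T) (w : L.ι) (x y : P.Par → k) :
    eval (Sum.elim x y) (P.delta L p q w) = P.dif x y (L.zeta w x y) p q := by
  simp only [delta, dif, Matrix.sub_apply, Matrix.mul_apply, map_sub, map_sum, map_mul,
    eval_rename, Sum.elim_comp_inl, Sum.elim_comp_inr]
  rfl

/-- A diagonal matrix of `𝒦` commutes with `H`, hence the `(p, q)`-entry of `S H - H S` depends on
the radical part of `S` only, and it is given by `δ(a₁)`. -/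
theorem dif_apply (hP : P.IsFreelyParameterized) (L : P.Layer) (p q : P.T) {x y : P.Par → k}
    {s : P.V → k} (c : L.ι → k) (hs : ∀ I a, P.Attached a I → s I ≠ 0 → x a = y a) :
    P.dif x y (Matrix.diagonal (fun i => s (P.cls i)) + ∑ w, c w • L.zeta w x y) p q =
      ∑ w, c w * eval (Sum.elim x y) (P.delta L p q w) := by
  rw [dif_add, dif_diagonal hP hs, zero_add, dif_sum_smul, Matrix.sum_apply]
  simp only [Matrix.smul_apply, smul_eq_mul, eval_delta]

theorem implies_iff (hP : P.IsFreelyParameterized) (L : P.Layer) (p q : P.T) {x y : P.Par → k}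
    (hx : x ∈ P.dom) (hy : y ∈ P.dom) :
    P.Implies p q x y ↔ ∀ w, eval (Sum.elim x y) (P.delta L p q w) = 0 := by
  constructor
  · intro h w
    rw [eval_delta]
    exact h _ (L.zeta_mem hx hy w) (L.zeta_diag w x y)
  · intro h S hS hd
    obtain ⟨s, c, hs, rfl⟩ := (L.mem_iff' hx hy).1 hS
    rw [dif_apply hP L p q c hs]
    exact Finset.sum_eq_zero fun w _ => by rw [h w, mul_zero]

theorem delta_eq_zero (hP : P.IsFreelyParameterized) (L : P.Layer) (p q : P.T) {w : L.ι}
    (h : ¬ (L.src w = P.cls p ∧ L.tgt w = P.cls q)) : P.delta L p q w = 0 := by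
  rw [delta, Finset.sum_eq_zero, Finset.sum_eq_zero, sub_zero]
  · intro l _
    by_cases h1 : L.ζ w l q = 0
    · rw [h1, mul_zero]
    by_cases h2 : P.cls p = P.cls l
    · have := (L.supp w l q h1).2
      exact absurd ⟨this.1.symm.trans h2.symm, this.2.symm⟩ h
    · rw [hP.H_supp _ _ h2, map_zero, zero_mul]
  · intro l _
    by_cases h1 : L.ζ w p l = 0
    · rw [h1, zero_mul]
    by_cases h2 : P.cls l = P.cls q
    · have := (L.supp w p l h1).2
      exact absurd ⟨this.1.symm, this.2.symm.trans h2⟩ h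
    · rw [hP.H_supp _ _ h2, map_zero, mul_zero]

/-- The coefficients of `δ(a₁)` are polynomials in the left parameter of the class of `p` and the
right parameter of the class of `q`. -/
theorem vars_delta (hP : P.IsFreelyParameterized) (L : P.Layer) (p q : P.T) (w : L.ι)
    {b : P.Par ⊕ P.Par} (hb : b ∈ (P.delta L p q w).vars) :
    Sum.elim (fun a => P.Attached a (P.cls p)) (fun a => P.Attached a (P.cls q)) b := by
  classical
  have hw : L.src w = P.cls p ∧ L.tgt w = P.cls q := by
    by_contra h
    rw [delta_eq_zero hP L p q h, vars_0] at hb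
    simp at hb
  have hζ : ∀ i j, b ∈ (L.ζ w i j).vars →
      Sum.elim (fun a => P.Attached a (P.cls p)) (fun a => P.Attached a (P.cls q)) b := by
    intro i j h
    rcases b with a | a
    · exact hw.1 ▸ L.vars_left w i j a h
    · exact hw.2 ▸ L.vars_right w i j a h
  rw [delta] at hb
  rcases Finset.mem_union.1 (vars_sub_subset _ hb) with h | h
  · obtain ⟨l, -, hl⟩ := Finset.mem_biUnion.1 (vars_sum_subset _ _ h)
    rcases Finset.mem_union.1 (vars_mul _ _ hl) with h | h
    · exact hζ _ _ h
    · obtain ⟨a, ha, rfl⟩ := mem_vars_rename _ _ h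
      have := hP.vars_H ha
      exact this.1 ▸ this.2
  · obtain ⟨l, -, hl⟩ := Finset.mem_biUnion.1 (vars_sum_subset _ _ h)
    rcases Finset.mem_union.1 (vars_mul _ _ hl) with h | h
    · obtain ⟨a, ha, rfl⟩ := mem_vars_rename _ _ h
      exact (hP.vars_H ha).2
    · exact hζ _ _ h

end ParamProblem

/-! ### Partitioned matrices and the induced problem -/

namespace ParamProblem

variable {k : Type u} [Field k] {P : ParamProblem k} {s : Reduction.Splitting k P.V P.Par}

/-- The new index with label `a` over the index `i`. -/
def NewT.mk' (i : P.T) (a : s.Lab) (h : s.allowed (P.cls i) a) : P.NewT s := ⟨toLex (i, a), h⟩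

open Classical in
noncomputable instance : Fintype (P.NewT s) := inferInstance

@[simp] theorem NewT.mk'_idx {i : P.T} {a : s.Lab} (h : s.allowed (P.cls i) a) :
    (NewT.mk' i a h).idx = i := rfl

@[simp] theorem NewT.mk'_lab {i : P.T} {a : s.Lab} (h : s.allowed (P.cls i) a) :
    (NewT.mk' i a h).lab = a := rfl

theorem NewT.allowed (x : P.NewT s) : s.allowed (P.cls x.idx) x.lab := x.2

theorem NewT.ext {x y : P.NewT s} (h₁ : x.idx = y.idx) (h₂ : x.lab = y.lab) : x = y :=
  Subtype.ext (Prod.ext h₁ h₂)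

theorem NewT.lt_iff {x y : P.NewT s} : x < y ↔ x.idx < y.idx ∨ x.idx = y.idx ∧ x.lab < y.lab :=
  Prod.Lex.lt_iff

theorem part_apply {a b : s.Lab} {i j : P.T} (ha : s.allowed (P.cls i) a)
    (hb : s.allowed (P.cls j) b) (S : Matrix (P.NewT s) (P.NewT s) k) :
    part a b S i j = S (NewT.mk' i a ha) (NewT.mk' j b hb) := dif_pos ⟨ha, hb⟩

theorem part_idx_lab (x y : P.NewT s) (S : Matrix (P.NewT s) (P.NewT s) k) :
    part x.lab y.lab S x.idx y.idx = S x y := part_apply x.allowed y.allowed S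

theorem part_left {a b : s.Lab} {i j : P.T} (ha : ¬ s.allowed (P.cls i) a)
    (S : Matrix (P.NewT s) (P.NewT s) k) : part a b S i j = 0 := dif_neg fun h => ha h.1

theorem part_right {a b : s.Lab} {i j : P.T} (hb : ¬ s.allowed (P.cls j) b)
    (S : Matrix (P.NewT s) (P.NewT s) k) : part a b S i j = 0 := dif_neg fun h => hb h.2

theorem ext_part {S S' : Matrix (P.NewT s) (P.NewT s) k} (h : ∀ a b, part a b S = part a b S') :
    S = S' := by
  ext x y
  rw [← part_idx_lab x y S, h, part_idx_lab]

theorem part_sub (a b : s.Lab) (S S' : Matrix (P.NewT s) (P.NewT s) k) :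
    part a b (S - S') = part a b S - part a b S' := by
  ext i j; by_cases h : s.allowed (P.cls i) a ∧ s.allowed (P.cls j) b <;> simp [part, h]

open Classical in
theorem sum_newT {M : Type*} [AddCommMonoid M] (f : P.NewT s → M) :
    ∑ z, f z = ∑ c : s.Lab, ∑ l : P.T,
      if h : s.allowed (P.cls l) c then f (NewT.mk' l c h) else 0 := by
  let F : P.T ×ₗ s.Lab → M := fun x =>
    if h : s.allowed (P.cls (ofLex x).1) (ofLex x).2 then f ⟨x, h⟩ else 0
  have h1 : ∑ z, f z = ∑ z : P.NewT s, F z.1 :=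
    Finset.sum_congr rfl fun z _ => by
      simp only [F]; rw [dif_pos z.2]
  have h2 : ∑ z : P.NewT s, F z.1 =
      ∑ x with s.allowed (P.cls (ofLex x).1) (ofLex x).2, F x :=
    (Finset.sum_subtype _ (fun x => by simp) F).symm
  rw [h1, h2, Finset.sum_filter_of_ne, ← (toLex (α := P.T × s.Lab)).sum_comp,
    Fintype.sum_prod_type_right]
  · rfl
  · intro x _ hx
    by_contra h
    exact hx (dif_neg h)

/-- Partitioned matrices are multiplied like block matrices. -/
theorem part_mul (a b : s.Lab) (S S' : Matrix (P.NewT s) (P.NewT s) k) :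
    part a b (S * S') = ∑ c, part a c S * part c b S' := by
  classical
  ext i j
  rw [Matrix.sum_apply]
  by_cases ha : s.allowed (P.cls i) a
  swap
  · rw [part_left ha]
    refine (Finset.sum_eq_zero fun c _ => ?_).symm
    rw [Matrix.mul_apply]
    exact Finset.sum_eq_zero fun l _ => by rw [part_left ha, zero_mul]
  by_cases hb : s.allowed (P.cls j) b
  swap
  · rw [part_right hb]
    refine (Finset.sum_eq_zero fun c _ => ?_).symm
    rw [Matrix.mul_apply]
    exact Finset.sum_eq_zero fun l _ => by rw [part_right hb, mul_zero]
  rw [part_apply ha hb, Matrix.mul_apply, sum_newT]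
  refine Finset.sum_congr rfl fun c _ => ?_
  rw [Matrix.mul_apply]
  refine Finset.sum_congr rfl fun l _ => ?_
  by_cases hc : s.allowed (P.cls l) c
  · rw [dif_pos hc, part_apply ha hc, part_apply hc hb]
  · rw [dif_neg hc, part_right hc, zero_mul]

/-- The matrix `H'` at the values `x` of the old and new parameters. -/
noncomputable def newHat (s : Reduction.Splitting k P.V P.Par) (ρ : Matrix P.T P.T k)
    (x : P.Par ⊕ Fin s.β → k) : Matrix (P.NewT s) (P.NewT s) k :=
  (newH s ρ).map (MvPolynomial.eval x)

open Classical in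
theorem newHat_apply (ρ : Matrix P.T P.T k) (x : P.Par ⊕ Fin s.β → k) (z z' : P.NewT s) :
    newHat s ρ x z z' = (if z.lab = z'.lab then P.Hat (x ∘ Sum.inl) z.idx z'.idx else 0) +
      ρ z.idx z'.idx * eval x (s.U z.lab z'.lab) := by
  rw [newHat, Matrix.map_apply, newH, map_add, map_mul, eval_C]
  congr 1
  split_ifs
  · rw [eval_rename]; rfl
  · rw [map_zero]

open Classical in
theorem part_mul_newHat (hP : P.IsFreelyParameterized) {I J : P.V}
    {ρ : Matrix P.T P.T k} (hρ : ∀ i j, ρ i j ≠ 0 → P.cls i = I ∧ P.cls j = J)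
    (y : P.Par ⊕ Fin s.β → k) (S : Matrix (P.NewT s) (P.NewT s) k) (a b : s.Lab) :
    part a b (S * newHat s ρ y) = part a b S * P.Hat (y ∘ Sum.inl) +
      ∑ c, (if s.allowed J b then eval y (s.U c b) else 0) • (part a c S * ρ) := by
  have key : ∀ i j, (∑ c, part a c S * part c b (newHat s ρ y)) i j =
      ∑ c, ∑ l, part a c S i l * part c b (newHat s ρ y) l j := fun i j => by
    rw [Matrix.sum_apply]; rfl
  rw [part_mul]
  ext i j
  rw [key, Matrix.add_apply, Matrix.sum_apply]
  have e2 : ∀ c, ((if s.allowed J b then eval y (s.U c b) else 0) • (part a c S * ρ)) i j =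
      ∑ l, part a c S i l * ((if s.allowed J b then eval y (s.U c b) else 0) * ρ l j) := fun c => by
    rw [Matrix.smul_apply, Matrix.mul_apply, smul_eq_mul, Finset.mul_sum]
    exact Finset.sum_congr rfl fun l _ => by ring
  have e1 : (part a b S * P.Hat (y ∘ Sum.inl)) i j =
      ∑ c, ∑ l, part a c S i l * (if c = b then P.Hat (y ∘ Sum.inl) l j else 0) := by
    rw [Finset.sum_eq_single b]
    · rw [Matrix.mul_apply]; simp
    · intro c _ hc; simp [hc]
    · simp
  rw [e1, Finset.sum_congr rfl fun c _ => e2 c, ← Finset.sum_add_distrib]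
  refine Finset.sum_congr rfl fun c _ => ?_
  rw [← Finset.sum_add_distrib]
  refine Finset.sum_congr rfl fun l _ => ?_
  rw [← mul_add]
  by_cases hc : s.allowed (P.cls l) c
  swap
  · rw [part_right hc, zero_mul, zero_mul]
  congr 1
  by_cases hb : s.allowed (P.cls j) b
  · rw [part_apply hc hb, newHat_apply]
    congr 1
    by_cases h : ρ l j = 0
    · simp [h]
    · rw [NewT.mk'_idx, NewT.mk'_idx, if_pos ((hρ l j h).2 ▸ hb), mul_comm]
      rfl
  · rw [part_right hb]
    have h1 : (if c = b then P.Hat (y ∘ Sum.inl) l j else 0) = 0 := by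
      split_ifs with h
      · subst h
        exact hP.Hat_supp _ fun h => hb (h ▸ hc)
      · rfl
    have h2 : (if s.allowed J b then eval y (s.U c b) else 0) * ρ l j = 0 := by
      by_cases h : ρ l j = 0
      · simp [h]
      · rw [if_neg ((hρ l j h).2 ▸ hb), zero_mul]
    rw [h1, h2, add_zero]

open Classical in
theorem part_newHat_mul (hP : P.IsFreelyParameterized) {I J : P.V}
    {ρ : Matrix P.T P.T k} (hρ : ∀ i j, ρ i j ≠ 0 → P.cls i = I ∧ P.cls j = J)
    (x : P.Par ⊕ Fin s.β → k) (S : Matrix (P.NewT s) (P.NewT s) k) (a b : s.Lab) :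
    part a b (newHat s ρ x * S) = P.Hat (x ∘ Sum.inl) * part a b S +
      ∑ c, (if s.allowed I a then eval x (s.U a c) else 0) • (ρ * part c b S) := by
  have key : ∀ i j, (∑ c, part a c (newHat s ρ x) * part c b S) i j =
      ∑ c, ∑ l, part a c (newHat s ρ x) i l * part c b S l j := fun i j => by
    rw [Matrix.sum_apply]; rfl
  rw [part_mul]
  ext i j
  rw [key, Matrix.add_apply, Matrix.sum_apply]
  have e2 : ∀ c, ((if s.allowed I a then eval x (s.U a c) else 0) • (ρ * part c b S)) i j =
      ∑ l, ((if s.allowed I a then eval x (s.U a c) else 0) * ρ i l) * part c b S l j := fun c => by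
    rw [Matrix.smul_apply, Matrix.mul_apply, smul_eq_mul, Finset.mul_sum]
    exact Finset.sum_congr rfl fun l _ => by ring
  have e1 : (P.Hat (x ∘ Sum.inl) * part a b S) i j =
      ∑ c, ∑ l, (if a = c then P.Hat (x ∘ Sum.inl) i l else 0) * part c b S l j := by
    rw [Finset.sum_eq_single a]
    · rw [Matrix.mul_apply]; simp
    · intro c _ hc; simp [hc.symm]
    · simp
  rw [e1, Finset.sum_congr rfl fun c _ => e2 c, ← Finset.sum_add_distrib]
  refine Finset.sum_congr rfl fun c _ => ?_
  rw [← Finset.sum_add_distrib]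
  refine Finset.sum_congr rfl fun l _ => ?_
  rw [← add_mul]
  by_cases hc : s.allowed (P.cls l) c
  swap
  · rw [part_left hc, mul_zero, mul_zero]
  congr 1
  by_cases ha : s.allowed (P.cls i) a
  · rw [part_apply ha hc, newHat_apply]
    congr 1
    by_cases h : ρ i l = 0
    · simp [h]
    · rw [NewT.mk'_idx, NewT.mk'_idx, if_pos ((hρ i l h).1 ▸ ha), mul_comm]
      rfl
  · rw [part_left ha]
    have h1 : (if a = c then P.Hat (x ∘ Sum.inl) i l else 0) = 0 := by
      split_ifs with h
      · subst h
        exact hP.Hat_supp _ fun h => ha (h ▸ hc)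
      · rfl
    have h2 : (if s.allowed I a then eval x (s.U a c) else 0) * ρ i l = 0 := by
      by_cases h : ρ i l = 0
      · simp [h]
      · rw [if_neg ((hρ i l h).1 ▸ ha), zero_mul]
    rw [h1, h2, add_zero]

/-- The derivation of the induced problem. -/
noncomputable def newDif (ρ : Matrix P.T P.T k)
    (x y : P.Par ⊕ Fin s.β → k) (S : Matrix (P.NewT s) (P.NewT s) k) :
    Matrix (P.NewT s) (P.NewT s) k :=
  S * newHat s ρ y - newHat s ρ x * S

theorem newDif_mul (ρ : Matrix P.T P.T k)
    (x y z : P.Par ⊕ Fin s.β → k) (S S' : Matrix (P.NewT s) (P.NewT s) k) :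
    newDif ρ x z (S * S') = S * newDif ρ y z S' + newDif ρ x y S * S' := by
  simp only [newDif, mul_sub, sub_mul, mul_assoc]
  abel

open Classical in
theorem part_newDif (hP : P.IsFreelyParameterized) {I J : P.V}
    {ρ : Matrix P.T P.T k} (hρ : ∀ i j, ρ i j ≠ 0 → P.cls i = I ∧ P.cls j = J)
    (x y : P.Par ⊕ Fin s.β → k) (S : Matrix (P.NewT s) (P.NewT s) k) (a b : s.Lab) :
    part a b (newDif ρ x y S) = P.dif (x ∘ Sum.inl) (y ∘ Sum.inl) (part a b S) +
      (∑ c, (if s.allowed J b then eval y (s.U c b) else 0) • (part a c S * ρ) -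
        ∑ c, (if s.allowed I a then eval x (s.U a c) else 0) • (ρ * part c b S)) := by
  rw [newDif, part_sub, part_mul_newHat hP hρ, part_newHat_mul hP hρ, dif]
  abel

theorem block_iff {p q : P.T} {m : Matrix (P.NewT s) (P.NewT s) k} :
    (∀ x y : P.NewT s, x.idx = p → y.idx = q → m x y = 0) ↔ ∀ a b, part a b m p q = 0 := by
  constructor
  · intro h a b
    by_cases hab : s.allowed (P.cls p) a ∧ s.allowed (P.cls q) b
    · rw [part_apply hab.1 hab.2]; exact h _ _ rfl rfl
    · exact dif_neg hab
  · rintro h x y rfl rfl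
    rw [← part_idx_lab x y m]; exact h _ _

theorem mem_induced_M {p q : P.T} {ρ : Matrix P.T P.T k} {D : Set (P.Par ⊕ Fin s.β → k)}
    {m : Matrix (P.NewT s) (P.NewT s) k} :
    m ∈ (induced s p q ρ D).M ↔ (∀ a b, part a b m ∈ P.M) ∧ ∀ a b, part a b m p q = 0 :=
  and_congr Iff.rfl block_iff

theorem mem_induced_K {p q : P.T} {ρ : Matrix P.T P.T k} {D : Set (P.Par ⊕ Fin s.β → k)}
    {x y : P.Par ⊕ Fin s.β → k} {S : Matrix (P.NewT s) (P.NewT s) k} :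
    S ∈ (induced s p q ρ D).K x y ↔ (∀ a b, part a b S ∈ P.K (x ∘ Sum.inl) (y ∘ Sum.inl)) ∧
      ∀ a b, part a b (newDif ρ x y S) p q = 0 :=
  and_congr Iff.rfl block_iff

section Induced

variable {p q : P.T} {ρ : Matrix P.T P.T k} {D : Set (P.Par ⊕ Fin s.β → k)}

theorem induced_K_M [Infinite k] (hP : P.IsFreelyParameterized) (hρ : P.IsFirst p q ρ)
    {x y : P.Par ⊕ Fin s.β → k} (hx : x ∘ Sum.inl ∈ P.dom) (hy : y ∘ Sum.inl ∈ P.dom)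
    {S m : Matrix (induced s p q ρ D).T (induced s p q ρ D).T k}
    (hS : S ∈ (induced s p q ρ D).K x y)
    (hm : m ∈ (induced s p q ρ D).M) : S * m ∈ (induced s p q ρ D).M := by
  replace hm := mem_induced_M.1 hm
  replace hS := mem_induced_K.1 hS
  refine mem_induced_M.2 ⟨?_, ?_⟩
  · intro a b
    refine (part_mul a b S m).symm ▸ Submodule.sum_mem _ fun c _ => ?_
    exact hP.K_M _ hx _ hy _ (hS.1 a c) _ (hm.1 c b)
  · intro a b
    refine (congrFun (congrFun (part_mul a b S m) p) q).trans ?_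
    rw [Matrix.sum_apply]
    refine Finset.sum_eq_zero fun c _ => ?_
    rw [hρ.mul_apply hP (hm.1 c b) hx hy (hS.1 a c), hm.2, mul_zero]

theorem induced_M_K [Infinite k] (hP : P.IsFreelyParameterized) (hρ : P.IsFirst p q ρ)
    {x y : P.Par ⊕ Fin s.β → k} (hx : x ∘ Sum.inl ∈ P.dom) (hy : y ∘ Sum.inl ∈ P.dom)
    {S m : Matrix (induced s p q ρ D).T (induced s p q ρ D).T k}
    (hS : S ∈ (induced s p q ρ D).K x y)
    (hm : m ∈ (induced s p q ρ D).M) : m * S ∈ (induced s p q ρ D).M := by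
  replace hm := mem_induced_M.1 hm
  replace hS := mem_induced_K.1 hS
  refine mem_induced_M.2 ⟨?_, ?_⟩
  · intro a b
    refine (part_mul a b m S).symm ▸ Submodule.sum_mem _ fun c _ => ?_
    exact hP.M_K _ hx _ hy _ (hS.1 c b) _ (hm.1 a c)
  · intro a b
    refine (congrFun (congrFun (part_mul a b m S) p) q).trans ?_
    rw [Matrix.sum_apply]
    refine Finset.sum_eq_zero fun c _ => ?_
    rw [hρ.apply_mul hP (hm.1 a c) hx hy (hS.1 c b), hm.2, zero_mul]

theorem induced_dif_mem (hP : P.IsFreelyParameterized) (hρ : P.IsFirst p q ρ)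
    {x y : P.Par ⊕ Fin s.β → k} (hx : x ∘ Sum.inl ∈ P.dom) (hy : y ∘ Sum.inl ∈ P.dom)
    {S : Matrix (induced s p q ρ D).T (induced s p q ρ D).T k}
    (hS : S ∈ (induced s p q ρ D).K x y) :
    (induced s p q ρ D).dif x y S ∈ (induced s p q ρ D).M := by
  replace hS := mem_induced_K.1 hS
  refine mem_induced_M.2 ⟨fun a b => ?_, hS.2⟩
  refine (part_newDif hP hρ.comp.2 x y S a b).symm ▸ ?_
  refine Submodule.add_mem _ (hP.dif_mem _ hx _ hy _ (hS.1 a b)) (Submodule.sub_mem _ ?_ ?_)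
  · exact Submodule.sum_mem _ fun c _ => Submodule.smul_mem _ _
      (hP.K_M _ hx _ hy _ (hS.1 a c) _ hρ.comp.1)
  · exact Submodule.sum_mem _ fun c _ => Submodule.smul_mem _ _
      (hP.M_K _ hx _ hy _ (hS.1 c b) _ hρ.comp.1)

theorem induced_K_mul [Infinite k] (hP : P.IsFreelyParameterized) (hρ : P.IsFirst p q ρ)
    {x y z : P.Par ⊕ Fin s.β → k} (hx : x ∘ Sum.inl ∈ P.dom) (hy : y ∘ Sum.inl ∈ P.dom)
    (hz : z ∘ Sum.inl ∈ P.dom)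
    {S S' : Matrix (induced s p q ρ D).T (induced s p q ρ D).T k}
    (hS : S ∈ (induced s p q ρ D).K x y)
    (hS' : S' ∈ (induced s p q ρ D).K y z) : S * S' ∈ (induced s p q ρ D).K x z := by
  have h1 := induced_K_M hP hρ hx hy hS (induced_dif_mem hP hρ hy hz hS')
  have h2 := induced_M_K hP hρ hy hz hS' (induced_dif_mem hP hρ hx hy hS)
  have h3 := (mem_induced_M.1 (Submodule.add_mem _ h1 h2)).2
  replace hS := mem_induced_K.1 hS
  replace hS' := mem_induced_K.1 hS'
  refine mem_induced_K.2 ⟨?_, ?_⟩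
  · intro a b
    refine (part_mul a b S S').symm ▸ Submodule.sum_mem _ fun c _ => ?_
    exact hP.K_mul _ hx _ hy _ hz _ (hS.1 a c) _ (hS'.1 c b)
  · intro a b
    exact (congrArg (fun m => part a b m p q) (newDif_mul ρ x y z S S')).trans (h3 a b)

open Classical in
/-- The equation defining `𝒦'`, for the parts of a partitioned matrix. -/
theorem part_newDif_apply [Infinite k] (hP : P.IsFreelyParameterized)
    (hρ : P.IsFirst p q ρ) {x y : P.Par ⊕ Fin s.β → k} (hx : x ∘ Sum.inl ∈ P.dom)
    (hy : y ∘ Sum.inl ∈ P.dom) {S : Matrix (P.NewT s) (P.NewT s) k}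
    (hS : ∀ a b, part a b S ∈ P.K (x ∘ Sum.inl) (y ∘ Sum.inl)) (a b : s.Lab) :
    part a b (newDif ρ x y S) p q = P.dif (x ∘ Sum.inl) (y ∘ Sum.inl) (part a b S) p q +
      (∑ c, (if s.allowed (P.cls q) b then eval y (s.U c b) else 0) * part a c S p p -
        ∑ c, (if s.allowed (P.cls p) a then eval x (s.U a c) else 0) * part c b S q q) := by
  rw [part_newDif hP hρ.comp.2, Matrix.add_apply, Matrix.sub_apply, Matrix.sum_apply,
    Matrix.sum_apply]
  congr 2
  · refine Finset.sum_congr rfl fun c _ => ?_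
    rw [Matrix.smul_apply, hρ.mul_apply hP hρ.comp.1 hx hy (hS a c), hρ.lead, mul_one, smul_eq_mul]
  · refine Finset.sum_congr rfl fun c _ => ?_
    rw [Matrix.smul_apply, hρ.apply_mul hP hρ.comp.1 hx hy (hS c b), hρ.lead, one_mul, smul_eq_mul]

end Induced

end ParamProblem

/-! ### Parameters of the induced problem -/

namespace ParamProblem

variable {k : Type u} [Field k] {P : ParamProblem k} {s : Reduction.Splitting k P.V P.Par}
  {p q : P.T} {ρ : Matrix P.T P.T k} {D : Set (P.Par ⊕ Fin s.β → k)}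

open Classical in
theorem mem_vars_newH {z z' : P.NewT s} {c : P.Par ⊕ Fin s.β} (h : c ∈ (newH s ρ z z').vars) :
    (z.lab = z'.lab ∧ ∃ a, c = Sum.inl a ∧ a ∈ (P.H z.idx z'.idx).vars) ∨
      (ρ z.idx z'.idx ≠ 0 ∧ c ∈ (s.U z.lab z'.lab).vars) := by
  rw [newH] at h
  rcases Finset.mem_union.1 (vars_add_subset _ _ h) with h | h
  · left
    split_ifs at h with hl
    · obtain ⟨a, ha, rfl⟩ := mem_vars_rename _ _ h
      exact ⟨hl, a, rfl, ha⟩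
    · simp at h
  · right
    refine ⟨fun h0 => ?_, ?_⟩
    · rw [h0] at h; simp at h
    · rcases Finset.mem_union.1 (vars_mul _ _ h) with h | h
      · simp at h
      · exact h

/-- The old parameters are attached to all parts of their class, as long as the reduced block does
not involve them. -/
theorem attached_inl_iff (hP : P.IsFreelyParameterized)
    (hU : ∀ a b c, Sum.inl c ∉ (s.U a b).vars) {a : P.Par}
    {c : (induced s p q ρ D).V} :
    (induced s p q ρ D).Attached (Sum.inl a) c ↔
      ∃ z : P.NewT s, z.code = c.1 ∧ P.Attached a (P.cls z.idx) := by
  classical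
  constructor
  · rintro ⟨i, j, hi, hj, h⟩
    refine ⟨i, congrArg Subtype.val hi, ?_⟩
    rcases mem_vars_newH h with ⟨hl, a', h1, h2⟩ | ⟨-, h⟩
    · obtain rfl := Sum.inl_injective h1
      exact (hP.vars_H h2).2
    · exact absurd h (hU _ _ _)
  · rintro ⟨z, hz, i, j, hi, hj, h⟩
    have ha := z.allowed
    refine ⟨NewT.mk' i z.lab (hi ▸ ha), NewT.mk' j z.lab (hj ▸ ha), Subtype.ext ?_,
      Subtype.ext ?_, ?_⟩
    · rw [← hz]; exact congrArg (fun I => s.code I z.lab) hi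
    · rw [← hz]; exact congrArg (fun I => s.code I z.lab) hj
    · have e : newH s ρ (NewT.mk' i z.lab (hi ▸ ha)) (NewT.mk' j z.lab (hj ▸ ha)) =
        rename Sum.inl (P.H i j) + C (ρ i j) * s.U z.lab z.lab := by simp [newH]
      change _ ∈ (newH s ρ _ _).vars
      have h1 : Sum.inl a ∈ (rename (Sum.inl : P.Par → P.Par ⊕ Fin s.β) (P.H i j)).vars := by
        rw [mem_vars_iff_degreeOf_ne_zero] at h ⊢
        rwa [degreeOf_rename_of_injective Sum.inl_injective]
      rw [e]
      rw [eq_sub_of_add_eq (rfl : rename Sum.inl (P.H i j) + C (ρ i j) * s.U z.lab z.lab = _)] at h1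
      rcases Finset.mem_union.1 (vars_sub_subset _ h1) with h | h
      · exact h
      · rcases Finset.mem_union.1 (vars_mul _ _ h) with h | h
        · simp at h
        · exact absurd h (hU _ _ _)

theorem newH_supp (hP : P.IsFreelyParameterized) (hρ : P.IsFirst p q ρ)
    (hU : ∀ a b, s.allowed (P.cls p) a → s.allowed (P.cls q) b → s.U a b ≠ 0 →
      s.code (P.cls p) a = s.code (P.cls q) b) {z z' : P.NewT s} (h : z.code ≠ z'.code) :
    newH s ρ z z' = 0 := by
  classical
  rw [newH]
  have h1 : (if z.lab = z'.lab then rename Sum.inl (P.H z.idx z'.idx) else 0 :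
      MvPolynomial (P.Par ⊕ Fin s.β) k) = 0 := by
    split_ifs with hl
    · rw [hP.H_supp, map_zero]
      intro hc
      exact h (by rw [NewT.code, NewT.code, hc, hl])
    · rfl
  rw [h1, zero_add]
  by_cases hr : ρ z.idx z'.idx = 0
  · rw [hr, map_zero, zero_mul]
  · obtain ⟨e1, e2⟩ := hρ.comp.2 _ _ hr
    by_cases hu : s.U z.lab z'.lab = 0
    · rw [hu, mul_zero]
    · refine absurd ?_ h
      rw [NewT.code, NewT.code, e1, e2]
      exact hU _ _ (e1 ▸ z.allowed) (e2 ▸ z'.allowed) hu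

/-- The induced problem is freely parameterized as soon as its radical is freely generated and
its parameters are attached to one class each. -/
theorem induced_free [Infinite k] (hP : P.IsFreelyParameterized) (hρ : P.IsFirst p q ρ)
    (hD : ∀ x ∈ D, x ∘ Sum.inl ∈ P.dom)
    (hU : ∀ a b, s.allowed (P.cls p) a → s.allowed (P.cls q) b → s.U a b ≠ 0 →
      s.code (P.cls p) a = s.code (P.cls q) b)
    (hL : Nonempty (induced s p q ρ D).Layer)
    (h₁ : ∀ a, ∃! I, (induced s p q ρ D).Attached a I)
    (h₂ : ∀ I a b, (induced s p q ρ D).Attached a I → (induced s p q ρ D).Attached b I → a = b)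
    (hdom : ∃ g : P.Par ⊕ Fin s.β → Polynomial k, (∀ a, g a ≠ 0) ∧ D = domOf g) :
    (induced s p q ρ D).IsFreelyParameterized where
  cls_surj := by
    rintro ⟨c, z, hz⟩
    exact ⟨z, Subtype.ext hz⟩
  H_supp i j hij := newH_supp hP hρ hU fun h => hij (Subtype.ext h)
  layer := hL
  K_mul x hx y hy z hz _ hS _ hS' := induced_K_mul hP hρ (hD x hx) (hD y hy) (hD z hz) hS hS'
  K_M x hx y hy _ hS _ hm := induced_K_M hP hρ (hD x hx) (hD y hy) hS hm
  M_K x hx y hy _ hS _ hm := induced_M_K hP hρ (hD x hx) (hD y hy) hS hm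
  dif_mem x hx y hy _ hS := induced_dif_mem hP hρ (hD x hx) (hD y hy) hS
  att_unique := h₁
  att_subsingleton := h₂
  dom_eq := hdom

theorem vars_newZeta {A B : Type} {f : A → B} {φ : MvPolynomial (A ⊕ A) k} {b : B ⊕ B}
    (h : b ∈ (rename (Sum.map f f) φ).vars) :
    (∃ a, b = Sum.inl (f a) ∧ Sum.inl a ∈ φ.vars) ∨
      ∃ a, b = Sum.inr (f a) ∧ Sum.inr a ∈ φ.vars := by
  obtain ⟨a | a, ha, rfl⟩ := mem_vars_rename _ _ h
  · exact Or.inl ⟨a, rfl, ha⟩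
  · exact Or.inr ⟨a, rfl, ha⟩

theorem exists_mem_vars_of_sum_mul {A ι : Type*} [Fintype ι] (f g : ι → MvPolynomial A k) {a : A}
    (h : a ∈ (∑ w, f w * g w).vars) : ∃ w, f w ≠ 0 ∧ (a ∈ (f w).vars ∨ a ∈ (g w).vars) := by
  classical
  obtain ⟨w, -, hw⟩ := Finset.mem_biUnion.1 (vars_sum_subset _ _ h)
  refine ⟨w, fun h0 => ?_, Finset.mem_union.1 (vars_mul _ _ hw)⟩
  rw [h0, zero_mul, vars_0] at hw
  exact absurd hw (Finset.notMem_empty _)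

theorem eval_rename_inl {B : Type} (φ : MvPolynomial (P.Par ⊕ P.Par) k) (x y : P.Par ⊕ B → k) :
    eval (Sum.elim x y) (rename (Sum.map Sum.inl Sum.inl) φ) =
      eval (Sum.elim (x ∘ Sum.inl) (y ∘ Sum.inl)) φ := by
  rw [eval_rename]
  congr 2
  funext a
  rcases a with a | a <;> rfl


/-! ### The radical of the induced problem -/

/-- The partitioned matrix over `𝒦` whose part with labels `(a, b)` has the diagonal values `t I a
b` and the coefficients `c a b w` at the radical. -/
noncomputable def comb (L : P.Layer) (x y : P.Par → k) (t : P.V → s.Lab → s.Lab → k)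
    (c : s.Lab → s.Lab → L.ι → k) : Matrix (P.NewT s) (P.NewT s) k := fun z z' =>
  (if z.idx = z'.idx then t (P.cls z.idx) z.lab z'.lab else 0) +
    ∑ w, c z.lab z'.lab w * L.zeta w x y z.idx z'.idx

theorem part_comb {L : P.Layer} {x y : P.Par → k} {t : P.V → s.Lab → s.Lab → k}
    {c : s.Lab → s.Lab → L.ι → k}
    (ht : ∀ I a b, t I a b ≠ 0 → s.allowed I a ∧ s.allowed I b)
    (hc : ∀ a b w, c a b w ≠ 0 → s.allowed (L.src w) a ∧ s.allowed (L.tgt w) b) (a b : s.Lab) :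
    part a b (comb L x y t c) = Matrix.diagonal (fun i => t (P.cls i) a b) +
      ∑ w, c a b w • L.zeta w x y := by
  ext i j
  rw [Matrix.add_apply, Matrix.sum_apply, Matrix.diagonal_apply]
  simp only [Matrix.smul_apply, smul_eq_mul]
  by_cases hab : s.allowed (P.cls i) a ∧ s.allowed (P.cls j) b
  · rw [part_apply hab.1 hab.2]
    rfl
  · rw [part, dif_neg hab]
    have h1 : (if i = j then t (P.cls i) a b else 0) = 0 := by
      split_ifs with h
      · by_contra h0
        subst h
        exact hab (ht _ _ _ h0)
      · rfl
    rw [h1, zero_add, Finset.sum_eq_zero]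
    intro w _
    by_contra h0
    have h2 := hc a b w (left_ne_zero_of_mul h0)
    have h3 := (L.zeta_supp (right_ne_zero_of_mul h0)).2
    exact hab ⟨h3.1 ▸ h2.1, h3.2 ▸ h2.2⟩

/-- The equations defining `𝒦'` inside the partitioned matrices over `𝒦`. -/
theorem mem_K_iff_comb [Infinite k] (hP : P.IsFreelyParameterized) (hρ : P.IsFirst p q ρ)
    (L : P.Layer) {x y : P.Par ⊕ Fin s.β → k} (hx : x ∘ Sum.inl ∈ P.dom)
    (hy : y ∘ Sum.inl ∈ P.dom) (S : Matrix (P.NewT s) (P.NewT s) k) :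
    S ∈ (induced s p q ρ D).K x y ↔
      ∃ (t : P.V → s.Lab → s.Lab → k) (c : s.Lab → s.Lab → L.ι → k),
        (∀ I a b, t I a b ≠ 0 → s.allowed I a ∧ s.allowed I b) ∧
        (∀ I a b r, P.Attached r I → t I a b ≠ 0 → x (Sum.inl r) = y (Sum.inl r)) ∧
        (∀ a b w, c a b w ≠ 0 → s.allowed (L.src w) a ∧ s.allowed (L.tgt w) b) ∧
        (∀ a b, s.allowed (P.cls p) a → s.allowed (P.cls q) b →
          ∑ w, c a b w * eval (Sum.elim (x ∘ Sum.inl) (y ∘ Sum.inl)) (P.delta L p q w) +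
            (∑ e, eval y (s.U e b) * t (P.cls p) a e -
              ∑ e, eval x (s.U a e) * t (P.cls q) e b) = 0) ∧
        S = comb L (x ∘ Sum.inl) (y ∘ Sum.inl) t c := by
  classical
  -- the block equation for a matrix with given parts
  have key : ∀ (t : P.V → s.Lab → s.Lab → k) (c : s.Lab → s.Lab → L.ι → k)
      (_ : ∀ I a b r, P.Attached r I → t I a b ≠ 0 → x (Sum.inl r) = y (Sum.inl r))
      (_ : ∀ a b, part a b S = Matrix.diagonal (fun i => t (P.cls i) a b) +
        ∑ w, c a b w • L.zeta w (x ∘ Sum.inl) (y ∘ Sum.inl)) (a b : s.Lab)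
      (_ : s.allowed (P.cls p) a) (_ : s.allowed (P.cls q) b),
      part a b (newDif ρ x y S) p q =
        ∑ w, c a b w * eval (Sum.elim (x ∘ Sum.inl) (y ∘ Sum.inl)) (P.delta L p q w) +
            (∑ e, eval y (s.U e b) * t (P.cls p) a e -
              ∑ e, eval x (s.U a e) * t (P.cls q) e b) := by
    intro t c ht e a b ha hb
    have hdiag : ∀ a b i, part a b S i i = t (P.cls i) a b := fun a b i => by
      rw [e, Matrix.add_apply, L.sum_zeta_diag, add_zero, Matrix.diagonal_apply_eq]
    rw [part_newDif_apply hP hρ hx hy fun a b => (L.mem_iff' hx hy).2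
      ⟨fun I => t I a b, c a b, fun I r => ht I a b r, e a b⟩, e a b,
      dif_apply hP L p q (x := x ∘ Sum.inl) (y := y ∘ Sum.inl) (s := fun I => t I a b) (c a b)
        fun I r => ht I a b r]
    simp only [hdiag, if_pos ha, if_pos hb]
  refine mem_induced_K.trans ⟨?_, ?_⟩
  · rintro ⟨h1, h2⟩
    choose t c ht e using fun a b => (L.mem_iff' hx hy).1 (h1 a b)
    have hta : ∀ I a b, t a b I ≠ 0 → s.allowed I a ∧ s.allowed I b := fun I a b h => by
      obtain ⟨i, rfl⟩ := hP.cls_surj I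
      by_contra hab
      have : part a b S i i = t a b (P.cls i) := by
        rw [e, Matrix.add_apply, L.sum_zeta_diag, add_zero, Matrix.diagonal_apply_eq]
      rw [part, dif_neg hab] at this
      exact h this.symm
    have hca : ∀ a b w, c a b w ≠ 0 → s.allowed (L.src w) a ∧ s.allowed (L.tgt w) b := by
      intro a b w h
      by_contra hab
      refine h (L.coeff_eq_zero hx hy (c := c a b) (fun i j hi hj => ?_) rfl rfl)
      by_cases hij : i = j
      · subst hij; rw [L.sum_zeta_diag]
      · have := congrFun (congrFun (e a b) i) j
        rw [part, dif_neg (by rw [hi, hj]; exact hab), Matrix.add_apply,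
          Matrix.diagonal_apply_ne _ hij, zero_add] at this
        exact this.symm
    refine ⟨fun I a b => t a b I, c, hta, fun I a b r => ht a b I r, hca, fun a b ha hb => ?_,
      ext_part fun a b => ?_⟩
    · exact (key (fun I a b => t a b I) c (fun I a b r => ht a b I r) e a b ha hb).symm.trans
        (h2 a b)
    · rw [e, part_comb hta hca]
  · rintro ⟨t, c, hta, htr, hca, heq, rfl⟩
    refine ⟨fun a b => ?_, fun a b => ?_⟩
    · rw [part_comb hta hca]
      exact (L.mem_iff' hx hy).2 ⟨fun I => t I a b, c a b, fun I r => htr I a b r, rfl⟩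
    · by_cases hab : s.allowed (P.cls p) a ∧ s.allowed (P.cls q) b
      · rw [key t c htr (part_comb hta hca) a b hab.1 hab.2]
        exact heq a b hab.1 hab.2
      · exact dif_neg hab

/-- A homogeneous family of polynomial vectors `u v` which, at all values in `D₀` of the left
and right parameters, is a basis of the space of the coefficient vectors `c` with
`∑ c w * f w = 0`, where `δ(a₁) = ∑ f w • v w`. -/
structure KernelFrame (L : P.Layer) (p q : P.T) (D₀ : Set (P.Par → k)) where
  κ : Type
  [finκ : Fintype κ]
  src : κ → P.V
  tgt : κ → P.V
  u : κ → L.ι → MvPolynomial (P.Par ⊕ P.Par) k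
  hom : ∀ v w, u v w ≠ 0 → L.src w = src v ∧ L.tgt w = tgt v
  vars_left : ∀ v w a, Sum.inl a ∈ (u v w).vars → P.Attached a (src v)
  vars_right : ∀ v w a, Sum.inr a ∈ (u v w).vars → P.Attached a (tgt v)
  indep : ∀ x ∈ D₀, ∀ y ∈ D₀, ∀ d : κ → k,
    (∀ w, ∑ v, d v * eval (Sum.elim x y) (u v w) = 0) → ∀ v, d v = 0
  span : ∀ x ∈ D₀, ∀ y ∈ D₀, ∀ c : L.ι → k,
    ∑ w, c w * eval (Sum.elim x y) (P.delta L p q w) = 0 ↔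
      ∃ d : κ → k, ∀ w, c w = ∑ v, d v * eval (Sum.elim x y) (u v w)

attribute [instance] KernelFrame.finκ

/-- A basis of the strictly upper triangular solutions of the equation `t_p U = U t_q` for the
diagonal parts `t I a b` of the matrices in `𝒦'`: the constant matrices `Z v`, homogeneous for the
new classes, such that every solution is a combination of them and of a matrix which is scalar on
the new classes and compatible with the parameters.  The entry of `Z v` at the pivot
`(pI v, pa v, pb v)` is `1`, and those of the others are `0`. -/
structure SplitFrame (s : Reduction.Splitting k P.V P.Par) (p q : P.T) (ρ : Matrix P.T P.T k)
    (D : Set (P.Par ⊕ Fin s.β → k)) where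
  κ : Type
  [finκ : Fintype κ]
  pI : κ → P.V
  pa : κ → s.Lab
  pb : κ → s.Lab
  Z : κ → P.V → s.Lab → s.Lab → k
  supp : ∀ v I a b, Z v I a b ≠ 0 → a < b ∧ s.allowed I a ∧ s.allowed I b ∧
    s.code I a = s.code (pI v) (pa v) ∧ s.code I b = s.code (pI v) (pb v)
  pivot : ∀ v, Z v (pI v) (pa v) (pb v) = 1
  pivot_ne : ∀ v v', v ≠ v' → Z v' (pI v) (pa v) (pb v) = 0
  spec : ∀ x ∈ D, ∀ y ∈ D, ∀ t : P.V → s.Lab → s.Lab → k,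
    ((∀ I a b, t I a b ≠ 0 → s.allowed I a ∧ s.allowed I b) ∧
      (∀ I a b r, P.Attached r I → t I a b ≠ 0 → x (Sum.inl r) = y (Sum.inl r)) ∧
      (∀ a b, s.allowed (P.cls p) a → s.allowed (P.cls q) b →
        ∑ e, eval y (s.U e b) * t (P.cls p) a e = ∑ e, eval x (s.U a e) * t (P.cls q) e b)) ↔
    ∃ (σ : (induced s p q ρ D).V → k) (z : κ → k),
      (∀ c r, (induced s p q ρ D).Attached r c → σ c ≠ 0 → x r = y r) ∧
      (∀ I a b, ¬ (s.allowed I a ∧ s.allowed I b) → t I a b = 0) ∧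
      ∀ i j : P.NewT s, i.idx = j.idx → t (P.cls i.idx) i.lab j.lab =
        (if i = j then σ ((induced s p q ρ D).cls i) else 0) +
          ∑ v, z v * Z v (P.cls i.idx) i.lab j.lab

attribute [instance] SplitFrame.finκ

namespace SplitFrame

variable {L : P.Layer} {D₀ : Set (P.Par → k)}

theorem V_mem (hP : P.IsFreelyParameterized) {I : P.V} {a : s.Lab} (h : s.allowed I a) :
    ∃ z : P.NewT s, z.code = s.code I a := by
  obtain ⟨i, rfl⟩ := hP.cls_surj I
  exact ⟨NewT.mk' i a h, rfl⟩

/-- The part of the index set of the new radical coming from the old radical. -/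
abbrev OldIdx (F : KernelFrame L p q D₀) (s : Reduction.Splitting k P.V P.Par) : Type :=
  {v : F.κ × s.Lab × s.Lab // s.allowed (F.src v.1) v.2.1 ∧ s.allowed (F.tgt v.1) v.2.2}

open Classical in
/-- Extension by zero of a family indexed by `OldIdx`. -/
noncomputable def ext0 {F : KernelFrame L p q D₀} (d : OldIdx F s → k) (a b : s.Lab) (v : F.κ) :
    k :=
  if h : s.allowed (F.src v) a ∧ s.allowed (F.tgt v) b then d ⟨(v, a, b), h⟩ else 0

theorem ext0_supp {F : KernelFrame L p q D₀} {d : OldIdx F s → k} {a b : s.Lab} {v : F.κ}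
    (h : ext0 d a b v ≠ 0) : s.allowed (F.src v) a ∧ s.allowed (F.tgt v) b := by
  by_contra h0
  exact h (dif_neg h0)

open Classical in
noncomputable instance (F : KernelFrame L p q D₀) : Fintype (OldIdx F s) := inferInstance

open Classical in
theorem sum_oldIdx {F : KernelFrame L p q D₀} (d : OldIdx F s → k) (a b : s.Lab) (f : F.κ → k) :
    ∑ v : OldIdx F s, d v * (if a = v.1.2.1 ∧ b = v.1.2.2 then f v.1.1 else 0) =
      ∑ v, ext0 d a b v * f v := by
  have h1 : ∀ v : OldIdx F s, d v * (if a = v.1.2.1 ∧ b = v.1.2.2 then f v.1.1 else 0) =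
      (fun v : F.κ × s.Lab × s.Lab => ext0 d v.2.1 v.2.2 v.1 *
        (if a = v.2.1 ∧ b = v.2.2 then f v.1 else 0)) v.1 := fun v => by
    simp only [ext0]
    rw [dif_pos v.2]
  rw [Finset.sum_congr rfl fun v _ => h1 v, ← Finset.sum_subtype
    (Finset.univ.filter fun v : F.κ × s.Lab × s.Lab =>
      s.allowed (F.src v.1) v.2.1 ∧ s.allowed (F.tgt v.1) v.2.2) (fun v => by simp)
    (fun v : F.κ × s.Lab × s.Lab => ext0 d v.2.1 v.2.2 v.1 *
        (if a = v.2.1 ∧ b = v.2.2 then f v.1 else 0)), Finset.sum_filter_of_ne,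
    Fintype.sum_prod_type]
  · refine Finset.sum_congr rfl fun v _ => ?_
    rw [Finset.sum_eq_single (a, b)]
    · simp
    · rintro ⟨a', b'⟩ _ hab
      rw [if_neg, mul_zero]
      rintro ⟨rfl, rfl⟩
      exact hab rfl
    · simp
  · intro v _ hv
    exact ext0_supp (left_ne_zero_of_mul hv)

open Classical in
/-- The generators of the radical of the induced problem. -/
noncomputable def newZeta (F : KernelFrame L p q D₀) (G : SplitFrame s p q ρ D) :
    OldIdx F s ⊕ G.κ → Matrix (P.NewT s) (P.NewT s)
      (MvPolynomial ((P.Par ⊕ Fin s.β) ⊕ (P.Par ⊕ Fin s.β)) k)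
  | Sum.inl v => Matrix.of fun z z' => if z.lab = v.1.2.1 ∧ z'.lab = v.1.2.2 then
      rename (Sum.map Sum.inl Sum.inl) (∑ w, F.u v.1.1 w * L.ζ w z.idx z'.idx) else 0
  | Sum.inr v => Matrix.of fun z z' =>
      if z.idx = z'.idx then C (G.Z v (P.cls z.idx) z.lab z'.lab) else 0

open Classical in
theorem newZeta_inl (F : KernelFrame L p q D₀) (G : SplitFrame s p q ρ D) (v : OldIdx F s)
    (z z' : P.NewT s) : newZeta F G (Sum.inl v) z z' =
      if z.lab = v.1.2.1 ∧ z'.lab = v.1.2.2 then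
        rename (Sum.map Sum.inl Sum.inl) (∑ w, F.u v.1.1 w * L.ζ w z.idx z'.idx) else 0 := rfl

open Classical in
theorem newZeta_inr (F : KernelFrame L p q D₀) (G : SplitFrame s p q ρ D) (v : G.κ)
    (z z' : P.NewT s) : newZeta F G (Sum.inr v) z z' =
      if z.idx = z'.idx then C (G.Z v (P.cls z.idx) z.lab z'.lab) else 0 := rfl

theorem sum_newZeta (F : KernelFrame L p q D₀) (G : SplitFrame s p q ρ D)
    (d : OldIdx F s ⊕ G.κ → k) (x y : P.Par ⊕ Fin s.β → k) (z z' : P.NewT s) :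
    (∑ v, d v • (newZeta F G v).map (eval (Sum.elim x y))) z z' =
      (if z.idx = z'.idx then
        ∑ v, d (Sum.inr v) * G.Z v (P.cls z.idx) z.lab z'.lab else 0) +
      ∑ w, (∑ v, ext0 (d ∘ Sum.inl) z.lab z'.lab v *
        eval (Sum.elim (x ∘ Sum.inl) (y ∘ Sum.inl)) (F.u v w)) *
          L.zeta w (x ∘ Sum.inl) (y ∘ Sum.inl) z.idx z'.idx := by
  classical
  rw [Fintype.sum_sum_type, Matrix.add_apply, Matrix.sum_apply, Matrix.sum_apply, add_comm]
  congr 1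
  · simp only [Matrix.smul_apply, Matrix.map_apply, newZeta_inr, smul_eq_mul]
    split_ifs
    · simp only [eval_C]
    · simp only [map_zero, mul_zero, Finset.sum_const_zero]
  · have h1 : ∀ v : OldIdx F s,
        (d (Sum.inl v) • (newZeta F G (Sum.inl v)).map (eval (Sum.elim x y))) z z' =
        (d ∘ Sum.inl) v * (if z.lab = v.1.2.1 ∧ z'.lab = v.1.2.2 then
          (fun v => ∑ w, eval (Sum.elim (x ∘ Sum.inl) (y ∘ Sum.inl)) (F.u v w) *
          L.zeta w (x ∘ Sum.inl) (y ∘ Sum.inl) z.idx z'.idx) v.1.1 else 0) := fun v => by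
      rw [Matrix.smul_apply, smul_eq_mul, Matrix.map_apply, newZeta_inl]
      congr 1
      split_ifs
      · rw [eval_rename_inl, map_sum]
        refine Finset.sum_congr rfl fun w _ => ?_
        rw [map_mul]; rfl
      · rw [map_zero]
    rw [Finset.sum_congr rfl fun v _ => h1 v]
    refine (sum_oldIdx (d ∘ Sum.inl) z.lab z'.lab fun v =>
      ∑ w, eval (Sum.elim (x ∘ Sum.inl) (y ∘ Sum.inl)) (F.u v w) *
          L.zeta w (x ∘ Sum.inl) (y ∘ Sum.inl) z.idx z'.idx).trans ?_
    simp only [Finset.mul_sum, Finset.sum_mul, mul_assoc]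
    rw [Finset.sum_comm]

theorem newZeta_supp (F : KernelFrame L p q D₀) (G : SplitFrame s p q ρ D)
    (v : OldIdx F s ⊕ G.κ) {z z' : P.NewT s} (h : newZeta F G v z z' ≠ 0) :
    z < z' ∧ z.code = Sum.elim (fun v => s.code (F.src v.1.1) v.1.2.1)
        (fun v => s.code (G.pI v) (G.pa v)) v ∧
      z'.code = Sum.elim (fun v => s.code (F.tgt v.1.1) v.1.2.2)
        (fun v => s.code (G.pI v) (G.pb v)) v := by
  rcases v with v | v
  · rw [newZeta_inl] at h
    split_ifs at h with hl
    · have : ∃ w, F.u v.1.1 w * L.ζ w z.idx z'.idx ≠ 0 := by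
        by_contra! h0
        rw [Finset.sum_eq_zero fun w _ => h0 w, map_zero] at h
        exact h rfl
      obtain ⟨w, hw⟩ := this
      have h1 := F.hom _ w (left_ne_zero_of_mul hw)
      have h2 := L.supp w _ _ (right_ne_zero_of_mul hw)
      refine ⟨NewT.lt_iff.2 (Or.inl h2.1), ?_, ?_⟩
      · rw [NewT.code, hl.1, h2.2.1, h1.1]; rfl
      · rw [NewT.code, hl.2, h2.2.2, h1.2]; rfl
    · exact absurd rfl h
  · rw [newZeta_inr] at h
    split_ifs at h with hl
    · have h1 := G.supp v (P.cls z.idx) z.lab z'.lab fun h0 => h (by rw [h0, map_zero])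
      refine ⟨NewT.lt_iff.2 (Or.inr ⟨hl, h1.1⟩), h1.2.2.2.1, ?_⟩
      rw [NewT.code, ← hl]
      exact h1.2.2.2.2
    · exact absurd rfl h

theorem newZeta_vars (F : KernelFrame L p q D₀) (G : SplitFrame s p q ρ D)
    (v : OldIdx F s ⊕ G.κ) {z z' : P.NewT s} {b : (P.Par ⊕ Fin s.β) ⊕ (P.Par ⊕ Fin s.β)}
    (h : b ∈ (newZeta F G v z z').vars) :
    ∃ v' : OldIdx F s, v = Sum.inl v' ∧
      ((∃ a, b = Sum.inl (Sum.inl a) ∧ P.Attached a (F.src v'.1.1)) ∨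
        ∃ a, b = Sum.inr (Sum.inl a) ∧ P.Attached a (F.tgt v'.1.1)) := by
  classical
  rcases v with v | v
  · refine ⟨v, rfl, ?_⟩
    rw [newZeta_inl] at h
    split_ifs at h with hl
    · rcases vars_newZeta h with ⟨a, rfl, h'⟩ | ⟨a, rfl, h'⟩
      · refine Or.inl ⟨a, rfl, ?_⟩
        obtain ⟨w, h0, h | h⟩ := exists_mem_vars_of_sum_mul (F.u v.1.1)
          (fun w => L.ζ w z.idx z'.idx) h'
        · exact F.vars_left _ w a h
        · exact (F.hom _ w h0).1 ▸ L.vars_left w _ _ a h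
      · refine Or.inr ⟨a, rfl, ?_⟩
        obtain ⟨w, h0, h | h⟩ := exists_mem_vars_of_sum_mul (F.u v.1.1)
          (fun w => L.ζ w z.idx z'.idx) h'
        · exact F.vars_right _ w a h
        · exact (F.hom _ w h0).2 ▸ L.vars_right w _ _ a h
    · simp at h
  · rw [newZeta_inr] at h
    split_ifs at h <;> simp at h

theorem newZeta_indep (hP : P.IsFreelyParameterized) (F : KernelFrame L p q D₀)
    (G : SplitFrame s p q ρ D) {x y : P.Par ⊕ Fin s.β → k}
    (hx : x ∘ Sum.inl ∈ P.dom) (hy : y ∘ Sum.inl ∈ P.dom)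
    (hx₀ : x ∘ Sum.inl ∈ D₀) (hy₀ : y ∘ Sum.inl ∈ D₀) :
    LinearIndependent k fun v => (newZeta F G v).map (eval (Sum.elim x y)) := by
  classical
  rw [Fintype.linearIndependent_iff]
  intro d hd
  have hz : ∀ z z' : P.NewT s, _ = (0 : k) := fun z z' =>
    (sum_newZeta F G d x y z z').symm.trans (congrFun (congrFun hd z) z')
  rintro (⟨⟨v, a, b⟩, hv⟩ | v)
  · have h1 : ∀ w, ∑ v, ext0 (d ∘ Sum.inl) a b v *
        eval (Sum.elim (x ∘ Sum.inl) (y ∘ Sum.inl)) (F.u v w) = 0 := by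
      refine L.coeff_eq_zero_of_sum hx hy ?_
      ext i j
      rw [Matrix.sum_apply, Matrix.zero_apply]
      simp only [Matrix.smul_apply, smul_eq_mul]
      by_cases hab : s.allowed (P.cls i) a ∧ s.allowed (P.cls j) b
      · by_cases hij : i = j
        · subst hij
          simp [L.zeta_diag]
        · have := hz (NewT.mk' i a hab.1) (NewT.mk' j b hab.2)
          simpa [hij] using this
      · refine Finset.sum_eq_zero fun w _ => ?_
        by_cases hw : L.zeta w (x ∘ Sum.inl) (y ∘ Sum.inl) i j = 0
        · rw [hw, mul_zero]
        rw [Finset.sum_eq_zero, zero_mul]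
        intro v _
        by_contra h0
        have h1 := ext0_supp (left_ne_zero_of_mul h0)
        have h2 := F.hom v w fun h => h0 (by rw [h, map_zero, mul_zero])
        have h3 := (L.zeta_supp hw).2
        rw [← h2.1, ← h2.2, ← h3.1, ← h3.2] at h1
        exact hab h1
    have h2 := F.indep _ hx₀ _ hy₀ _ h1 v
    rw [ext0, dif_pos hv] at h2
    exact h2
  · obtain ⟨i, hi⟩ := hP.cls_surj (G.pI v)
    have h0 := G.supp v _ _ _ (by rw [G.pivot]; exact one_ne_zero)
    have h1 := hz (NewT.mk' i (G.pa v) (hi ▸ h0.2.1)) (NewT.mk' i (G.pb v) (hi ▸ h0.2.2.1))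
    simp only [NewT.mk'_idx, NewT.mk'_lab, if_true, L.zeta_diag, mul_zero,
      Finset.sum_const_zero, add_zero, hi] at h1
    rw [Finset.sum_eq_single v] at h1
    · rwa [G.pivot, mul_one] at h1
    · intro v' _ hv
      rw [G.pivot_ne v v' hv.symm, mul_zero]
    · simp

/-- The space `𝒦'` consists of the combinations of the new basis elements `newZeta` and of a matrix
which is scalar on the new classes.  By `hsep` the block equation splits: either the coefficients
of the radical or the diagonal parts do not enter it. -/
theorem mem_K_iff [Infinite k] (hP : P.IsFreelyParameterized) (hρ : P.IsFirst p q ρ)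
    (F : KernelFrame L p q D₀) (G : SplitFrame s p q ρ D)
    (hsep : (∀ w, P.delta L p q w = 0) ∨ ∀ a b, s.U a b = 0)
    {x y : P.Par ⊕ Fin s.β → k} (hxD : x ∈ D) (hyD : y ∈ D)
    (hx : x ∘ Sum.inl ∈ P.dom) (hy : y ∘ Sum.inl ∈ P.dom)
    (hx₀ : x ∘ Sum.inl ∈ D₀) (hy₀ : y ∘ Sum.inl ∈ D₀) (S : Matrix (P.NewT s) (P.NewT s) k) :
    S ∈ (induced s p q ρ D).K x y ↔
      ∃ (σ : (induced s p q ρ D).V → k) (d : OldIdx F s ⊕ G.κ → k),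
        (∀ c r, (induced s p q ρ D).Attached r c → σ c ≠ 0 → x r = y r) ∧
        S = Matrix.diagonal (fun z : P.NewT s => σ ((induced s p q ρ D).cls z)) +
          ∑ v, d v • (newZeta F G v).map (eval (Sum.elim x y)) := by
  classical
  rw [mem_K_iff_comb hP hρ L hx hy]
  constructor
  · rintro ⟨t, c, hta, htr, hca, heq, rfl⟩
    have hsplit : (∀ a b, s.allowed (P.cls p) a → s.allowed (P.cls q) b →
        ∑ e, eval y (s.U e b) * t (P.cls p) a e = ∑ e, eval x (s.U a e) * t (P.cls q) e b) := by
      intro a b ha hb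
      have h := heq a b ha hb
      rcases hsep with h0 | h0
      · simpa [h0, sub_eq_zero] using h
      · simp [h0]
    have hker : ∀ a b, ∑ w, c a b w *
        eval (Sum.elim (x ∘ Sum.inl) (y ∘ Sum.inl)) (P.delta L p q w) = 0 := by
      intro a b
      by_cases hab : s.allowed (P.cls p) a ∧ s.allowed (P.cls q) b
      · have h := heq a b hab.1 hab.2
        rcases hsep with h0 | h0
        · simp [h0]
        · simpa [h0] using h
      · refine Finset.sum_eq_zero fun w _ => ?_
        by_contra h0
        have h1 := hca a b w (left_ne_zero_of_mul h0)
        have h2 : L.src w = P.cls p ∧ L.tgt w = P.cls q := by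
          by_contra h2
          exact right_ne_zero_of_mul h0 (by rw [delta_eq_zero hP L p q h2, map_zero])
        exact hab (by rwa [h2.1, h2.2] at h1)
    obtain ⟨σ, z, hσ, ht0, ht⟩ := (G.spec x hxD y hyD t).1 ⟨hta, htr, hsplit⟩
    choose d hd using fun a b => (F.span _ hx₀ _ hy₀ (c a b)).1 (hker a b)
    refine ⟨σ, Sum.elim (fun v => d v.1.2.1 v.1.2.2 v.1.1) z, hσ, ?_⟩
    ext i j
    rw [Matrix.add_apply, sum_newZeta, comb, Matrix.diagonal_apply, ← add_assoc]
    congr 1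
    · by_cases hij : i.idx = j.idx
      · rw [if_pos hij, if_pos hij, ht i j hij]
        rfl
      · rw [if_neg hij, if_neg hij, if_neg (fun h => hij (congrArg NewT.idx h)), add_zero]
    · refine Finset.sum_congr rfl fun w _ => ?_
      by_cases hw : L.zeta w (x ∘ Sum.inl) (y ∘ Sum.inl) i.idx j.idx = 0
      · rw [hw, mul_zero, mul_zero]
      congr 1
      rw [hd]
      refine Finset.sum_congr rfl fun v _ => ?_
      by_cases hu : F.u v w = 0
      · rw [hu, map_zero, mul_zero, mul_zero]
      congr 1
      have h1 := F.hom v w hu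
      have h2 := (L.zeta_supp hw).2
      have h3 : s.allowed (F.src v) i.lab ∧ s.allowed (F.tgt v) j.lab := by
        rw [← h1.1, ← h1.2, ← h2.1, ← h2.2]
        exact ⟨i.allowed, j.allowed⟩
      rw [ext0, dif_pos h3]
      rfl
  · rintro ⟨σ, d, hσ, rfl⟩
    let t : P.V → s.Lab → s.Lab → k := fun I a b =>
      (if h : a = b ∧ s.allowed I a then σ ⟨s.code I a, V_mem hP h.2⟩ else 0) +
        ∑ v, d (Sum.inr v) * G.Z v I a b
    have ht0 : ∀ I a b, ¬ (s.allowed I a ∧ s.allowed I b) → t I a b = 0 := by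
      intro I a b hab
      simp only [t]
      rw [dif_neg, zero_add, Finset.sum_eq_zero]
      · intro v _
        by_contra h0
        have := G.supp v I a b (right_ne_zero_of_mul h0)
        exact hab ⟨this.2.1, this.2.2.1⟩
      · rintro ⟨rfl, h⟩
        exact hab ⟨h, h⟩
    have ht : ∀ i j : P.NewT s, i.idx = j.idx → t (P.cls i.idx) i.lab j.lab =
        (if i = j then σ ((induced s p q ρ D).cls i) else 0) +
          ∑ v, d (Sum.inr v) * G.Z v (P.cls i.idx) i.lab j.lab := by
      intro i j hij
      simp only [t]
      congr 1
      by_cases h : i = j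
      · subst h
        rw [dif_pos ⟨rfl, i.allowed⟩, if_pos rfl]
        rfl
      · rw [if_neg h, dif_neg fun h' => h (NewT.ext hij h'.1)]
    obtain ⟨hta, htr, hsplit⟩ := (G.spec x hxD y hyD t).2 ⟨σ, d ∘ Sum.inr, hσ, ht0, ht⟩
    let c : s.Lab → s.Lab → L.ι → k := fun a b w => ∑ v, ext0 (d ∘ Sum.inl) a b v *
        eval (Sum.elim (x ∘ Sum.inl) (y ∘ Sum.inl)) (F.u v w)
    refine ⟨t, c, hta, htr, ?_, ?_, ?_⟩
    · intro a b w h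
      obtain ⟨v, -, h⟩ := Finset.exists_ne_zero_of_sum_ne_zero h
      have h1 := ext0_supp (left_ne_zero_of_mul h)
      have h2 := F.hom v w fun h0 => h (by rw [h0, map_zero, mul_zero])
      rwa [← h2.1, ← h2.2] at h1
    · intro a b ha hb
      rw [(F.span _ hx₀ _ hy₀ (c a b)).2 ⟨_, fun w => rfl⟩, hsplit a b ha hb, sub_self, add_zero]
    · ext i j
      rw [Matrix.add_apply, sum_newZeta, comb, Matrix.diagonal_apply, ← add_assoc]
      congr 1
      by_cases hij : i.idx = j.idx
      · rw [if_pos hij, if_pos hij, ht i j hij]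
      · rw [if_neg hij, if_neg hij, if_neg (fun h => hij (congrArg NewT.idx h)), add_zero]

/-- Bases for the two halves of the block equation make the radical of the induced problem freely
generated. -/
theorem nonempty_layer [Infinite k] (hP : P.IsFreelyParameterized) (hρ : P.IsFirst p q ρ)
    (F : KernelFrame L p q D₀) (G : SplitFrame s p q ρ D)
    (hU : ∀ a b c, Sum.inl c ∉ (s.U a b).vars)
    (hsep : (∀ w, P.delta L p q w = 0) ∨ ∀ a b, s.U a b = 0)
    (hD : ∀ x ∈ D, x ∘ Sum.inl ∈ P.dom) (hD₀ : ∀ x ∈ D, x ∘ Sum.inl ∈ D₀) :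
    Nonempty (induced s p q ρ D).Layer := by
  have hG : ∀ v, s.allowed (G.pI v) (G.pa v) ∧ s.allowed (G.pI v) (G.pb v) := fun v => by
    have := G.supp v _ _ _ (by rw [G.pivot]; exact one_ne_zero)
    exact ⟨this.2.1, this.2.2.1⟩
  have hatt : ∀ {a : P.Par} {I : P.V} {b : s.Lab} (h : s.allowed I b), P.Attached a I →
      (induced s p q ρ D).Attached (Sum.inl a) ⟨s.code I b, V_mem hP h⟩ := by
    intro a I b h ha
    obtain ⟨i, rfl⟩ := hP.cls_surj I
    exact (attached_inl_iff hP hU).2 ⟨NewT.mk' i b h, rfl, ha⟩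
  exact ⟨{
    ι := OldIdx F s ⊕ G.κ
    src := Sum.elim (fun v => ⟨_, V_mem hP v.2.1⟩) (fun v => ⟨_, V_mem hP (hG v).1⟩)
    tgt := Sum.elim (fun v => ⟨_, V_mem hP v.2.2⟩) (fun v => ⟨_, V_mem hP (hG v).2⟩)
    ζ := newZeta F G
    supp := fun v z z' h => by
      have := newZeta_supp F G v h
      rcases v with v | v
      · exact ⟨this.1, Subtype.ext this.2.1, Subtype.ext this.2.2⟩
      · exact ⟨this.1, Subtype.ext this.2.1, Subtype.ext this.2.2⟩
    vars_left := fun v z z' a h => by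
      obtain ⟨v, rfl, ⟨a, h1, h2⟩ | ⟨a, h1, h2⟩⟩ := newZeta_vars F G v h
      · obtain rfl := Sum.inl_injective h1
        exact hatt v.2.1 h2
      · cases h1
    vars_right := fun v z z' a h => by
      obtain ⟨v, rfl, ⟨a, h1, h2⟩ | ⟨a, h1, h2⟩⟩ := newZeta_vars F G v h
      · cases h1
      · obtain rfl := Sum.inr_injective h1
        exact hatt v.2.2 h2
    indep := fun x hx y hy =>
      newZeta_indep hP F G (hD x hx) (hD y hy) (hD₀ x hx) (hD₀ y hy)
    mem_iff := fun x hx y hy S =>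
      mem_K_iff hP hρ F G hsep hx hy (hD x hx) (hD y hy) (hD₀ x hx) (hD₀ y hy) S }⟩

end SplitFrame

end ParamProblem

/-! ### Kernel frames -/

/-- Linearly independent solutions, one less than there are unknowns, span the solutions of a
non-zero linear equation. -/
theorem exists_combination_of_kernel {k : Type*} [Field k] {n : ℕ} (q : Fin (n + 1) → k)
    (hq : q ≠ 0) (u : Fin n → Fin (n + 1) → k) (hu : LinearIndependent k u)
    (hker : ∀ j, ∑ i, u j i * q i = 0) (z : Fin (n + 1) → k) (hz : ∑ i, z i * q i = 0) :
    ∃ d : Fin n → k, ∀ i, z i = ∑ j, d j * u j i := by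
  let l : (Fin (n + 1) → k) →ₗ[k] k := Fintype.linearCombination k q
  have hl : ∀ z, l z = ∑ i, z i * q i := fun z => by simp [l, Fintype.linearCombination_apply]
  have hle : Submodule.span k (Set.range u) ≤ LinearMap.ker l := by
    rw [Submodule.span_le]
    rintro _ ⟨j, rfl⟩
    exact (hl _).trans (hker j)
  have hl0 : l ≠ 0 := by
    intro h
    classical
    refine hq (funext fun i => ?_)
    have := hl (Pi.single i 1)
    rw [h] at this
    simpa [Pi.single_apply] using this.symm
  have h1 : Module.finrank k (LinearMap.ker l) = n := by
    have h := LinearMap.finrank_range_add_finrank_ker l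
    rw [LinearMap.range_eq_top.2 (LinearMap.surjective hl0), finrank_top, Module.finrank_self,
      Module.finrank_fin_fun] at h
    omega
  have h2 : Module.finrank k (Submodule.span k (Set.range u)) = n := by
    rw [finrank_span_eq_card hu, Fintype.card_fin]
  have heq := Submodule.eq_of_le_of_finrank_eq hle (h2.trans h1.symm)
  have hmem : z ∈ Submodule.span k (Set.range u) := by
    rw [heq]; exact (hl z).trans hz
  obtain ⟨d, hd⟩ := (Submodule.mem_span_range_iff_exists_fun k).1 hmem
  exact ⟨d, fun i => by rw [← hd]; simp⟩

namespace ParamProblem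

variable {k : Type u} [Field k] {P : ParamProblem k}

open Classical in
/-- The value of the parameter of the class `I`, and `0` if `I` is trivial. -/
noncomputable def parVal (P : ParamProblem k) (I : P.V) (x : P.Par → k) : k :=
  if h : ∃ a, P.Attached a I then x h.choose else 0

theorem parVal_eq (hP : P.IsFreelyParameterized) {I : P.V} {a : P.Par} (h : P.Attached a I)
    (x : P.Par → k) : P.parVal I x = x a := by
  have h' : ∃ a, P.Attached a I := ⟨a, h⟩
  rw [parVal, dif_pos h']
  exact congrArg x (hP.att_subsingleton I _ _ h'.choose_spec h)

open Classical in
/-- The parameter of the class `I`, acting from the side `f`, and `0` if `I` is trivial. -/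
noncomputable def parVar (P : ParamProblem k) (I : P.V) (f : P.Par → P.Par ⊕ P.Par) :
    MvPolynomial (P.Par ⊕ P.Par) k :=
  if h : ∃ a, P.Attached a I then X (f h.choose) else 0

theorem parVar_eq (hP : P.IsFreelyParameterized) {I : P.V} {a : P.Par} (h : P.Attached a I)
    (f : P.Par → P.Par ⊕ P.Par) : P.parVar I f = X (f a) := by
  have h' : ∃ a, P.Attached a I := ⟨a, h⟩
  rw [parVar, dif_pos h', hP.att_subsingleton I _ _ h'.choose_spec h]

/-- The variables of the polynomials in the left parameter of `I` and the right parameter of `J`. -/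
def sideVars (P : ParamProblem k) (I J : P.V) : Set (P.Par ⊕ P.Par) :=
  {b | Sum.elim (fun a => P.Attached a I) (fun a => P.Attached a J) b}

open Classical in
/-- The specialization of a polynomial in the left and right parameters to a bivariate polynomial
in the left parameter of `I` (the inner variable) and the right parameter of `J` (the outer
variable). -/
noncomputable def toBi (P : ParamProblem k) (I J : P.V) :
    MvPolynomial (P.Par ⊕ P.Par) k →+* Polynomial (Polynomial k) :=
  eval₂Hom (Polynomial.C.comp Polynomial.C)
    (Sum.elim (fun a => if P.Attached a I then Polynomial.C Polynomial.X else 0)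
      (fun a => if P.Attached a J then Polynomial.X else 0))

/-- A bivariate polynomial as a polynomial in the left parameter of `I` and the right parameter
of `J`.  Where `I` or `J` is trivial, its variable is replaced by `0`. -/
noncomputable def ofBi (P : ParamProblem k) (I J : P.V) :
    Polynomial (Polynomial k) →+* MvPolynomial (P.Par ⊕ P.Par) k :=
  Polynomial.eval₂RingHom (Polynomial.eval₂RingHom C (P.parVar I Sum.inl)) (P.parVar J Sum.inr)

theorem ofBi_CC (I J : P.V) (r : k) : P.ofBi I J (Polynomial.C (Polynomial.C r)) = C r := by
  simp [ofBi]

theorem ofBi_CX (I J : P.V) :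
    P.ofBi I J (Polynomial.C Polynomial.X) = P.parVar I Sum.inl := by
  simp [ofBi]

theorem ofBi_X (I J : P.V) : P.ofBi I J Polynomial.X = P.parVar J Sum.inr := by
  simp [ofBi]

theorem ofBi_C_eq (hP : P.IsFreelyParameterized) {I J : P.V} {a : P.Par} (h : P.Attached a I)
    (f : Polynomial k) : P.ofBi I J (Polynomial.C f) = leftPoly a f := by
  simp only [ofBi, Polynomial.coe_eval₂RingHom, Polynomial.eval₂_C, parVar_eq hP h, leftPoly]
  rfl

theorem ofBi_map_C_eq (hP : P.IsFreelyParameterized) {I J : P.V} {a : P.Par} (h : P.Attached a J)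
    (f : Polynomial k) : P.ofBi I J (f.map Polynomial.C) = rightPoly a f := by
  simp only [ofBi, Polynomial.coe_eval₂RingHom, Polynomial.eval₂_map, parVar_eq hP h, rightPoly]
  rw [Polynomial.aeval_def]
  congr 1
  ext r
  simp

theorem toBi_leftPoly {I J : P.V} {a : P.Par} (h : P.Attached a I) (f : Polynomial k) :
    P.toBi I J (leftPoly a f) = Polynomial.C f := by
  rw [leftPoly, Polynomial.aeval_def, Polynomial.hom_eval₂]
  have h1 : P.toBi I J (X (Sum.inl a)) = Polynomial.C Polynomial.X := by simp [toBi, h]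
  have h2 : (P.toBi I J).comp (algebraMap k (MvPolynomial (P.Par ⊕ P.Par) k)) =
      Polynomial.C.comp Polynomial.C := by
    ext r; simp [toBi, algebraMap_eq]
  rw [h1, h2, ← Polynomial.hom_eval₂, Polynomial.eval₂_C_X]

theorem toBi_rightPoly {I J : P.V} {a : P.Par} (h : P.Attached a J) (f : Polynomial k) :
    P.toBi I J (rightPoly a f) = f.map Polynomial.C := by
  rw [rightPoly, Polynomial.aeval_def, Polynomial.hom_eval₂]
  have h1 : P.toBi I J (X (Sum.inr a)) = Polynomial.X := by simp [toBi, h]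
  have h2 : (P.toBi I J).comp (algebraMap k (MvPolynomial (P.Par ⊕ P.Par) k)) =
      Polynomial.C.comp Polynomial.C := by
    ext r; simp [toBi, algebraMap_eq]
  rw [h1, h2]
  exact (Polynomial.eval₂_map (p := f) (f := Polynomial.C) (g := Polynomial.C)
    (x := Polynomial.X)).symm.trans Polynomial.eval₂_C_X

theorem ofBi_toBi (hP : P.IsFreelyParameterized) {I J : P.V} {f : MvPolynomial (P.Par ⊕ P.Par) k}
    (hf : ∀ b ∈ f.vars, b ∈ P.sideVars I J) : P.ofBi I J (P.toBi I J f) = f := by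
  have := hom_congr_vars (f₁ := (P.ofBi I J).comp (P.toBi I J)) (f₂ := RingHom.id _)
    (p₁ := f) (p₂ := f) ?_ ?_ rfl
  · exact this
  · ext1 r
    simp [toBi, ofBi_CC]
  · rintro (a | a) ha _
    · have h := hf _ ha
      have h' : P.Attached a I := h
      simp [toBi, h', ofBi_CX, parVar_eq hP h']
    · have h := hf _ ha
      have h' : P.Attached a J := h
      simp [toBi, h', ofBi_X, parVar_eq hP h']

theorem vars_ofBi (I J : P.V) (f : Polynomial (Polynomial k)) :
    ∀ b ∈ (P.ofBi I J f).vars, b ∈ P.sideVars I J := by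
  have hl : P.parVar I Sum.inl ∈ supported k (P.sideVars I J) := by
    rw [parVar]
    split_ifs with h
    · exact X_mem_supported.2 h.choose_spec
    · exact Subalgebra.zero_mem _
  have hr : P.parVar J Sum.inr ∈ supported k (P.sideVars I J) := by
    rw [parVar]
    split_ifs with h
    · exact X_mem_supported.2 h.choose_spec
    · exact Subalgebra.zero_mem _
  have : P.ofBi I J f ∈ supported k (P.sideVars I J) := by
    rw [ofBi, Polynomial.coe_eval₂RingHom, Polynomial.eval₂_eq_sum_range]
    refine Subalgebra.sum_mem _ fun i _ => Subalgebra.mul_mem _ ?_ (Subalgebra.pow_mem _ hr _)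
    rw [Polynomial.coe_eval₂RingHom, Polynomial.eval₂_eq_sum_range]
    exact Subalgebra.sum_mem _ fun j _ => Subalgebra.mul_mem _ (Subalgebra.algebraMap_mem _ _)
      (Subalgebra.pow_mem _ hl _)
  rw [mem_supported] at this
  exact fun b hb => this hb

theorem eval_ofBi (I J : P.V) (f : Polynomial (Polynomial k)) (x y : P.Par → k) :
    eval (Sum.elim x y) (P.ofBi I J f) = f.evalEval (P.parVal I x) (P.parVal J y) := by
  have h : ((eval (Sum.elim x y)).comp (P.ofBi I J)) =
      Polynomial.evalEvalRingHom (P.parVal I x) (P.parVal J y) := by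
    have hl : eval (Sum.elim x y) (P.parVar I Sum.inl) = P.parVal I x := by
      rw [parVar, parVal]; split_ifs <;> simp
    have hr : eval (Sum.elim x y) (P.parVar J Sum.inr) = P.parVal J y := by
      rw [parVar, parVal]; split_ifs <;> simp
    ext
    · simp [ofBi_CC]
    · simp [ofBi_CX, hl]
    · simp [ofBi_X, hr]
  exact RingHom.congr_fun h f

theorem vars_delta_sideVars (hP : P.IsFreelyParameterized) (L : P.Layer) (p q : P.T) (w : L.ι) :
    ∀ b ∈ (P.delta L p q w).vars, b ∈ P.sideVars (P.cls p) (P.cls q) :=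
  fun _ hb => vars_delta hP L p q w hb

theorem eval_delta_bi (hP : P.IsFreelyParameterized) (L : P.Layer) (p q : P.T) (w : L.ι)
    (x y : P.Par → k) : eval (Sum.elim x y) (P.delta L p q w) =
      (P.toBi (P.cls p) (P.cls q) (P.delta L p q w)).evalEval
        (P.parVal (P.cls p) x) (P.parVal (P.cls q) y) := by
  rw [← eval_ofBi, ofBi_toBi hP (vars_delta_sideVars hP L p q w)]

open Classical in
/-- If the differential of the first arrow vanishes, there is no condition on the coefficients. -/
noncomputable def KernelFrame.ofZero {L : P.Layer} {p q : P.T}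
    (h : ∀ w, P.delta L p q w = 0) : KernelFrame L p q Set.univ where
  κ := L.ι
  src := L.src
  tgt := L.tgt
  u v w := if v = w then 1 else 0
  hom v w hvw := by
    split_ifs at hvw with e
    · rw [e]; exact ⟨rfl, rfl⟩
    · exact absurd rfl hvw
  vars_left v w a ha := by split_ifs at ha <;> simp at ha
  vars_right v w a ha := by split_ifs at ha <;> simp at ha
  indep x _ y _ d hd v := by simpa [apply_ite (eval (Sum.elim x y))] using hd v
  span x _ y _ c := by
    constructor
    · exact fun _ => ⟨c, fun w => by simp [apply_ite (eval (Sum.elim x y))]⟩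
    · exact fun _ => by simp [h]

/-- The kernel of the differential is free where the quotients `q w` of its coefficients by a
common factor `f` are unimodular. -/
theorem nonempty_kernelFrame (hP : P.IsFreelyParameterized) (L : P.Layer) (p q : P.T)
    (f : Polynomial (Polynomial k)) (Q s : L.ι → Polynomial (Polynomial k)) (c : Polynomial k)
    (hf : ∀ w, P.toBi (P.cls p) (P.cls q) (P.delta L p q w) = f * Q w)
    (hs : ∑ w, s w * Q w = Polynomial.C c) (D₀ : Set (P.Par → k)) (hne : D₀.Nonempty)
    (hD₀ : ∀ x ∈ D₀, ∀ y ∈ D₀,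
      f.evalEval (P.parVal (P.cls p) x) (P.parVal (P.cls q) y) ≠ 0 ∧
        c.eval (P.parVal (P.cls p) x) ≠ 0) :
    Nonempty (KernelFrame L p q D₀) := by
  classical
  obtain ⟨x₀, hx₀⟩ := hne
  have hf0 : f ≠ 0 := fun h => (hD₀ x₀ hx₀ x₀ hx₀).1 (by rw [h]; simp)
  have hc0 : c ≠ 0 := fun h => (hD₀ x₀ hx₀ x₀ hx₀).2 (by rw [h]; simp)
  let W := {w : L.ι // L.src w = P.cls p ∧ L.tgt w = P.cls q}
  have hQ : ∀ w, ¬ (L.src w = P.cls p ∧ L.tgt w = P.cls q) → Q w = 0 := fun w hw => by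
    have := hf w
    rw [delta_eq_zero hP L p q hw, map_zero] at this
    exact (mul_eq_zero.1 this.symm).resolve_left hf0
  have hsumW : ∀ {M : Type u} [AddCommMonoid M] (F : L.ι → M),
      (∀ w, ¬ (L.src w = P.cls p ∧ L.tgt w = P.cls q) → F w = 0) → ∑ w, F w = ∑ w : W, F w.1 := by
    intro M _ F hF
    rw [← Finset.sum_subtype (Finset.univ.filter fun w : L.ι =>
      L.src w = P.cls p ∧ L.tgt w = P.cls q) (fun w => by simp) F, Finset.sum_filter_of_ne]
    intro w _ hw
    by_contra h
    exact hw (hF w h)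
  have hWne : Nonempty W := by
    by_contra hW
    rw [not_nonempty_iff] at hW
    rw [hsumW _ fun w hw => by rw [hQ w hw, mul_zero], Finset.univ_eq_empty,
      Finset.sum_empty] at hs
    exact hc0 (Polynomial.C_eq_zero.1 hs.symm)
  obtain ⟨n, hn⟩ : ∃ n, Fintype.card W = n + 1 := ⟨_, (Nat.succ_pred Fintype.card_ne_zero).symm⟩
  let e : W ≃ Fin (n + 1) := Fintype.equivFinOfCardEq hn
  have hsumF : ∀ {M : Type u} [AddCommMonoid M] (F : L.ι → M),
      (∀ w, ¬ (L.src w = P.cls p ∧ L.tgt w = P.cls q) → F w = 0) →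
      ∑ w, F w = ∑ i, F (e.symm i).1 := fun F hF => by
    rw [hsumW F hF, ← e.symm.sum_comp]
  obtain ⟨u, hu, hli⟩ := Polynomial.exists_kernel_frame (fun i => Q (e.symm i).1)
    (fun i => s (e.symm i).1) c hc0
    ((hsumF _ fun w hw => by rw [hQ w hw, mul_zero]).symm.trans hs)
  let U : {w : L.ι // ¬ (L.src w = P.cls p ∧ L.tgt w = P.cls q)} ⊕ Fin n → L.ι →
      MvPolynomial (P.Par ⊕ P.Par) k :=
    Sum.elim (fun v w => if v.1 = w then 1 else 0) fun j w =>
      if h : L.src w = P.cls p ∧ L.tgt w = P.cls q then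
        P.ofBi (P.cls p) (P.cls q) (u j (e ⟨w, h⟩)) else 0
  have hUinr : ∀ j i, U (Sum.inr j) (e.symm i).1 = P.ofBi (P.cls p) (P.cls q) (u j i) := by
    intro j i
    simp only [U, Sum.elim_inr]
    rw [dif_pos (e.symm i).2]
    simp
  -- the values of the combinations of the `U v` inside and outside the component of `a₁`
  have hval₁ : ∀ (d : _ → k) (x y : P.Par → k) i,
      ∑ v, d v * eval (Sum.elim x y) (U v (e.symm i).1) =
        ∑ j, d (Sum.inr j) * (u j i).evalEval (P.parVal (P.cls p) x) (P.parVal (P.cls q) y) := by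
    intro d x y i
    rw [Fintype.sum_sum_type, Finset.sum_eq_zero, zero_add]
    · simp only [hUinr, eval_ofBi]
    · intro v _
      simp only [U, Sum.elim_inl]
      rw [if_neg, map_zero, mul_zero]
      intro h
      exact v.2 (h ▸ (e.symm i).2)
  have hval₂ : ∀ (d : _ → k) (x y : P.Par → k)
      (w : {w : L.ι // ¬ (L.src w = P.cls p ∧ L.tgt w = P.cls q)}),
      ∑ v, d v * eval (Sum.elim x y) (U v w.1) = d (Sum.inl w) := by
    intro d x y w
    rw [Fintype.sum_sum_type, Finset.sum_eq_single w, Finset.sum_eq_zero]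
    · simp [U]
    · intro j _
      simp [U, dif_neg w.2]
    · intro v _ hv
      have : v.1 ≠ w.1 := fun h => hv (Subtype.ext h)
      simp [U, this]
    · simp
  refine ⟨{
    κ := {w : L.ι // ¬ (L.src w = P.cls p ∧ L.tgt w = P.cls q)} ⊕ Fin n
    src := Sum.elim (fun v => L.src v.1) fun _ => P.cls p
    tgt := Sum.elim (fun v => L.tgt v.1) fun _ => P.cls q
    u := U
    hom := ?_
    vars_left := ?_
    vars_right := ?_
    indep := ?_
    span := ?_ }⟩
  · rintro (v | j) w hvw
    · simp only [U, Sum.elim_inl] at hvw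
      split_ifs at hvw with h
      · subst h; exact ⟨rfl, rfl⟩
      · exact absurd rfl hvw
    · simp only [U, Sum.elim_inr] at hvw
      split_ifs at hvw with h
      · exact h
      · exact absurd rfl hvw
  · rintro (v | j) w a ha
    · simp only [U, Sum.elim_inl] at ha
      split_ifs at ha <;> simp at ha
    · simp only [U, Sum.elim_inr] at ha
      split_ifs at ha with h
      · exact vars_ofBi _ _ _ _ ha
      · simp at ha
  · rintro (v | j) w a ha
    · simp only [U, Sum.elim_inl] at ha
      split_ifs at ha <;> simp at ha
    · simp only [U, Sum.elim_inr] at ha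
      split_ifs at ha with h
      · exact vars_ofBi _ _ _ _ ha
      · simp at ha
  · intro x hx y hy d hd
    rintro (w | j)
    · rw [← hval₂ d x y w]; exact hd w.1
    · refine Fintype.linearIndependent_iff.1 (hli _ (P.parVal (P.cls q) y) (hD₀ x hx y hy).2)
        (fun j => d (Sum.inr j)) ?_ j
      ext i
      rw [Finset.sum_apply, Pi.zero_apply, ← hd (e.symm i).1, hval₁]
      rfl
  · intro x hx y hy z
    let a := P.parVal (P.cls p) x
    let b := P.parVal (P.cls q) y
    have h1 : ∑ w, z w * eval (Sum.elim x y) (P.delta L p q w) =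
        f.evalEval a b * ∑ i, z (e.symm i).1 * (Q (e.symm i).1).evalEval a b := by
      rw [hsumF]
      · rw [Finset.mul_sum]
        refine Finset.sum_congr rfl fun i _ => ?_
        rw [eval_delta_bi hP, hf, Polynomial.evalEval_mul]
        ring
      · intro w hw
        rw [delta_eq_zero hP L p q hw, map_zero, mul_zero]
    rw [h1, mul_eq_zero, or_iff_right (hD₀ x hx y hy).1]
    have hker : ∀ j, ∑ i, (u j i).evalEval a b * (Q (e.symm i).1).evalEval a b = 0 := fun j => by
      have := congrArg (Polynomial.evalEval a b) (hu j)
      simpa [Polynomial.evalEval_finsetSum, Polynomial.evalEval_mul] using this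
    constructor
    · intro hz
      have hq0 : (fun i => (Q (e.symm i).1).evalEval a b) ≠ 0 := by
        intro h0
        have h2 := (hsumF _ fun w hw => by rw [hQ w hw, mul_zero]).symm.trans hs
        have h3 := congrArg (Polynomial.evalEval a b) h2
        rw [Polynomial.evalEval_finsetSum, Polynomial.evalEval_C, Finset.sum_eq_zero] at h3
        · exact (hD₀ x hx y hy).2 h3.symm
        · intro i _
          rw [Polynomial.evalEval_mul, show (Q (e.symm i).1).evalEval a b = 0 from congrFun h0 i,
            mul_zero]
      obtain ⟨d, hd⟩ := exists_combination_of_kernel _ hq0 _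
        (hli a b (hD₀ x hx y hy).2) hker _ hz
      refine ⟨Sum.elim (fun w => z w.1) d, fun w => ?_⟩
      by_cases hw : L.src w = P.cls p ∧ L.tgt w = P.cls q
      · obtain ⟨i, hi⟩ := e.symm.surjective ⟨w, hw⟩
        have : w = (e.symm i).1 := by rw [hi]
        rw [this, hval₁]
        exact hd i
      · exact (hval₂ (Sum.elim (fun w => z w.1) d) x y ⟨w, hw⟩).symm
    · rintro ⟨d, hd⟩
      have h2 : ∀ i, z (e.symm i).1 = ∑ j, d (Sum.inr j) * (u j i).evalEval a b := fun i => by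
        rw [hd, hval₁]
      simp only [h2, Finset.sum_mul, mul_assoc]
      rw [Finset.sum_comm]
      refine Finset.sum_eq_zero fun j _ => ?_
      rw [← Finset.mul_sum, hker, mul_zero]

end ParamProblem

namespace ParamProblem

variable {k : Type u} [Field k] {P : ParamProblem k} {s : Reduction.Splitting k P.V P.Par}
  {p q : P.T} {ρ : Matrix P.T P.T k} {D : Set (P.Par ⊕ Fin s.β → k)}

/-! ### Frames for the diagonal parts -/

theorem existsUnique_attached_inl (hP : P.IsFreelyParameterized)
    (hU : ∀ a b c, Sum.inl c ∉ (s.U a b).vars)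
    (hall : ∀ I, ∃ a, s.allowed I a)
    (hsingle : ∀ r I a b, P.Attached r I → s.allowed I a → s.allowed I b → a = b) (r : P.Par) :
    ∃! c, (induced s p q ρ D).Attached (Sum.inl r) c := by
  obtain ⟨I, hI, huniq⟩ := hP.att_unique r
  obtain ⟨i, rfl⟩ := hP.cls_surj I
  obtain ⟨a, ha⟩ := hall (P.cls i)
  refine ⟨⟨_, NewT.mk' i a ha, rfl⟩, (attached_inl_iff hP hU).2 ⟨NewT.mk' i a ha, rfl, hI⟩, ?_⟩
  intro c hc
  obtain ⟨z, hz, h⟩ := (attached_inl_iff hP hU).1 hc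
  have h1 : P.cls z.idx = P.cls i := huniq _ h
  refine Subtype.ext (hz.symm.trans ?_)
  change s.code (P.cls z.idx) z.lab = s.code (P.cls i) a
  rw [h1, hsingle r (P.cls i) z.lab a hI (h1 ▸ z.allowed) ha]

theorem eq_of_attached_inl (hP : P.IsFreelyParameterized)
    (hU : ∀ a b c, Sum.inl c ∉ (s.U a b).vars)
    (hcode : ∀ r r' I J a b, P.Attached r I → P.Attached r' J → s.allowed I a → s.allowed J b →
      s.code I a = s.code J b → I = J) {r r' : P.Par} {c : (induced s p q ρ D).V}
    (h : (induced s p q ρ D).Attached (Sum.inl r) c)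
    (h' : (induced s p q ρ D).Attached (Sum.inl r') c) : r = r' := by
  obtain ⟨z, hz, h⟩ := (attached_inl_iff hP hU).1 h
  obtain ⟨z', hz', h'⟩ := (attached_inl_iff hP hU).1 h'
  have := hcode r r' _ _ _ _ h h' z.allowed z'.allowed (hz.trans hz'.symm)
  exact hP.att_subsingleton _ _ _ h (this ▸ h')

/-- Frames in terms of the functions `t` alone.  It is used that a class with a parameter is not
split. -/
noncomputable def SplitFrame.mk' (hP : P.IsFreelyParameterized)
    (hU : ∀ a b c, Sum.inl c ∉ (s.U a b).vars)
    (hsingle : ∀ r I a b, P.Attached r I → s.allowed I a → s.allowed I b → a = b)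
    (κ : Type) [Fintype κ] (pI : κ → P.V) (pa pb : κ → s.Lab)
    (Z : κ → P.V → s.Lab → s.Lab → k)
    (supp : ∀ v I a b, Z v I a b ≠ 0 → a < b ∧ s.allowed I a ∧ s.allowed I b ∧
      s.code I a = s.code (pI v) (pa v) ∧ s.code I b = s.code (pI v) (pb v))
    (pivot : ∀ v, Z v (pI v) (pa v) (pb v) = 1)
    (pivot_ne : ∀ v v', v ≠ v' → Z v' (pI v) (pa v) (pb v) = 0)
    (hsol : ∀ x ∈ D, ∀ y ∈ D, ∀ t : P.V → s.Lab → s.Lab → k,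
      (∀ I a b, t I a b ≠ 0 → s.allowed I a ∧ s.allowed I b) →
      (∀ a b, s.allowed (P.cls p) a → s.allowed (P.cls q) b →
        ∑ e, eval y (s.U e b) * t (P.cls p) a e = ∑ e, eval x (s.U a e) * t (P.cls q) e b) →
      (∀ I J a b, s.allowed I a → s.allowed J b → s.code I a = s.code J b → t I a a = t J b b) ∧
      (∀ I a b, s.allowed I a → s.allowed I b → a ≠ b →
        t I a b = ∑ v, t (pI v) (pa v) (pb v) * Z v I a b) ∧
      (∀ (z : P.NewT s) β, (induced s p q ρ D).Attached (Sum.inr β) ((induced s p q ρ D).cls z) →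
        t (P.cls z.idx) z.lab z.lab ≠ 0 → x (Sum.inr β) = y (Sum.inr β)))
    (hsol' : ∀ x ∈ D, ∀ y ∈ D, ∀ (t : P.V → s.Lab → s.Lab → k) (ξ : κ → k),
      (∀ I a b, t I a b ≠ 0 → s.allowed I a ∧ s.allowed I b) →
      (∀ I J a b, s.allowed I a → s.allowed J b → s.code I a = s.code J b → t I a a = t J b b) →
      (∀ I a b, s.allowed I a → s.allowed I b → a ≠ b → t I a b = ∑ v, ξ v * Z v I a b) →
      (∀ (z : P.NewT s) β, (induced s p q ρ D).Attached (Sum.inr β) ((induced s p q ρ D).cls z) →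
        t (P.cls z.idx) z.lab z.lab ≠ 0 → x (Sum.inr β) = y (Sum.inr β)) →
      ∀ a b, s.allowed (P.cls p) a → s.allowed (P.cls q) b →
        ∑ e, eval y (s.U e b) * t (P.cls p) a e = ∑ e, eval x (s.U a e) * t (P.cls q) e b) :
    SplitFrame s p q ρ D where
  κ := κ
  pI := pI
  pa := pa
  pb := pb
  Z := Z
  supp := supp
  pivot := pivot
  pivot_ne := pivot_ne
  spec := by
    classical
    have hdiag : ∀ v I a, Z v I a a = 0 := fun v I a => by
      by_contra h
      exact lt_irrefl _ (supp v I a a h).1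
    intro x hx y hy t
    constructor
    · rintro ⟨h1, h2, h3⟩
      obtain ⟨hc, hne, hnew⟩ := hsol x hx y hy t h1 h3
      refine ⟨fun c => t (P.cls c.2.choose.idx) c.2.choose.lab c.2.choose.lab,
        fun v => t (pI v) (pa v) (pb v), ?_, ?_, ?_⟩
      · intro c r hr hσ
        rcases r with r | r
        · obtain ⟨z, hz, h⟩ := (attached_inl_iff hP hU).1 hr
          have := hc (P.cls c.2.choose.idx) (P.cls z.idx) _ _ c.2.choose.allowed z.allowed
            (c.2.choose_spec.trans hz.symm)
          exact h2 _ z.lab z.lab r h (this ▸ hσ)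
        · refine hnew c.2.choose r ?_ hσ
          have : (induced s p q ρ D).cls c.2.choose = c := Subtype.ext c.2.choose_spec
          exact this.symm ▸ hr
      · intro I a b hab
        by_contra h
        exact hab (h1 I a b h)
      · intro i j hij
        by_cases h : i = j
        · subst h
          rw [if_pos rfl, Finset.sum_eq_zero fun v _ => by rw [hdiag, mul_zero], add_zero]
          exact hc _ _ _ _ i.allowed (NewT.allowed _)
            ((induced s p q ρ D).cls i).2.choose_spec.symm
        · rw [if_neg h, zero_add]
          exact hne _ _ _ i.allowed (hij ▸ j.allowed) fun hl => h (NewT.ext hij hl)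
    · rintro ⟨σ, ξ, hσ, ht0, ht⟩
      have hta : ∀ I a b, t I a b ≠ 0 → s.allowed I a ∧ s.allowed I b := fun I a b h => by
        by_contra hab
        exact h (ht0 I a b hab)
      have htd : ∀ z : P.NewT s, t (P.cls z.idx) z.lab z.lab = σ ((induced s p q ρ D).cls z) := by
        intro z
        rw [ht z z rfl, if_pos rfl, Finset.sum_eq_zero fun v _ => by rw [hdiag, mul_zero],
          add_zero]
      have hne : ∀ I a b, s.allowed I a → s.allowed I b → a ≠ b →
          t I a b = ∑ v, ξ v * Z v I a b := by
        intro I a b ha hb hab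
        obtain ⟨i, rfl⟩ := hP.cls_surj I
        have := ht (NewT.mk' i a ha) (NewT.mk' i b hb) rfl
        have hlab : NewT.mk' i a ha ≠ NewT.mk' i b hb := fun h =>
          hab (congrArg (fun z : P.NewT s => z.lab) h)
        rw [if_neg hlab, zero_add] at this
        exact this
      refine ⟨hta, ?_, hsol' x hx y hy t ξ hta ?_ hne ?_⟩
      · intro I a b r hr h
        obtain ⟨ha, hb⟩ := hta I a b h
        obtain rfl := hsingle r I a b hr ha hb
        obtain ⟨i, rfl⟩ := hP.cls_surj I
        refine hσ ((induced s p q ρ D).cls (NewT.mk' i a ha)) (Sum.inl r)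
          ((attached_inl_iff hP hU).2 ⟨NewT.mk' i a ha, rfl, hr⟩) ?_
        rw [← htd (NewT.mk' i a ha)]
        exact h
      · intro I J a b ha hb hab
        obtain ⟨i, rfl⟩ := hP.cls_surj I
        obtain ⟨j, rfl⟩ := hP.cls_surj J
        refine (htd (NewT.mk' i a ha)).trans (Eq.trans ?_ (htd (NewT.mk' j b hb)).symm)
        exact congrArg σ (Subtype.ext hab)
      · intro z β hβ h
        rw [htd] at h
        exact hσ _ _ hβ h

/-- Regularization does not split indices. -/
noncomputable def SplitFrame.ofRegular (hP : P.IsFreelyParameterized)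
    (hlab : ∀ a b : s.Lab, a = b)
    (hcode : ∀ I J a b, s.code I a = s.code J b → I = J) (hU : ∀ a b, s.U a b = 0)
    (hβ : IsEmpty (Fin s.β)) : SplitFrame s p q ρ D :=
  SplitFrame.mk' hP (fun a b c => by rw [hU, vars_0]; exact Finset.notMem_empty _)
    (fun _ _ a b _ _ _ => hlab a b) Empty Empty.elim Empty.elim Empty.elim (fun v => v.elim)
    (fun v => v.elim) (fun v => v.elim) (fun v => v.elim)
    (fun x _ y _ t _ _ => ⟨fun I J a b _ _ h => by rw [hcode I J a b h, hlab a b],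
      fun I a b _ _ h => absurd (hlab a b) h, fun _ β => (hβ.false β).elim⟩)
    (fun x _ y _ t _ _ _ _ _ a b _ _ => by simp [hU])

/-- Criterion for the induced problem to be freely parameterized, in terms of the combinatorics of
the splitting. -/
theorem induced_free_of_frame [Infinite k] (hP : P.IsFreelyParameterized) (hρ : P.IsFirst p q ρ)
    {L : P.Layer} {D₀ : Set (P.Par → k)} (F : KernelFrame L p q D₀) (G : SplitFrame s p q ρ D)
    (hU : ∀ a b c, Sum.inl c ∉ (s.U a b).vars)
    (hUc : ∀ a b, s.allowed (P.cls p) a → s.allowed (P.cls q) b → s.U a b ≠ 0 →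
      s.code (P.cls p) a = s.code (P.cls q) b)
    (hsep : (∀ w, P.delta L p q w = 0) ∨ ∀ a b, s.U a b = 0)
    (hD : ∀ x ∈ D, x ∘ Sum.inl ∈ P.dom) (hD₀ : ∀ x ∈ D, x ∘ Sum.inl ∈ D₀)
    (hdom : ∃ g : P.Par ⊕ Fin s.β → Polynomial k, (∀ a, g a ≠ 0) ∧ D = domOf g)
    (hall : ∀ I, ∃ a, s.allowed I a)
    (hsingle : ∀ r I a b, P.Attached r I → s.allowed I a → s.allowed I b → a = b)
    (hcode : ∀ r r' I J a b, P.Attached r I → P.Attached r' J → s.allowed I a → s.allowed J b →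
      s.code I a = s.code J b → I = J)
    (hnew : ∀ β : Fin s.β, ∃! c, (induced s p q ρ D).Attached (Sum.inr β) c)
    (hnew' : ∀ c (β : Fin s.β) r, (induced s p q ρ D).Attached (Sum.inr β) c →
      (induced s p q ρ D).Attached r c → r = Sum.inr β) :
    (induced s p q ρ D).IsFreelyParameterized := by
  refine induced_free hP hρ hD hUc (G.nonempty_layer hP hρ F hU hsep hD hD₀) ?_ ?_ hdom
  · rintro (r | β)
    · exact existsUnique_attached_inl hP hU hall hsingle r
    · exact hnew β
  · rintro c (r | β) (r' | β') h h'
    · exact congrArg Sum.inl (eq_of_attached_inl hP hU hcode h h')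
    · exact hnew' c β' _ h' h
    · exact (hnew' c β _ h h').symm
    · exact (hnew' c β _ h h').symm

end ParamProblem

namespace ParamProblem

variable {k : Type u} [Field k] {P : ParamProblem k} {s : Reduction.Splitting k P.V P.Par}
  {p q : P.T} {ρ : Matrix P.T P.T k} {D : Set (P.Par ⊕ Fin s.β → k)}

/-! ### Edge reduction -/

/-- The splitting of the indices by an edge reduction from `I₀` to `J₀`: the part `a₀` of `I₀` and
the part `a₁` of `J₀` form a new class. -/
structure EdgeSplitting (s : Reduction.Splitting k P.V P.Par) (I₀ J₀ : P.V) where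
  a₀ : s.Lab
  a₁ : s.Lab
  lt : a₀ < a₁
  lab : ∀ a, a = a₀ ∨ a = a₁
  U_one : s.U a₀ a₁ = 1
  U_zero : ∀ a b, ¬ (a = a₀ ∧ b = a₁) → s.U a b = 0
  allowed_iff : s.allowed I₀ a₀ ↔ s.allowed J₀ a₁
  allowed_ne : ∀ I, I ≠ I₀ → I ≠ J₀ → ¬ s.allowed I a₁
  code_eq : s.code I₀ a₀ = s.code J₀ a₁
  code_inj : ∀ I J a b, s.allowed I a → s.allowed J b → s.code I a = s.code J b →
    (I = J ∧ a = b) ∨ (I = I₀ ∧ a = a₀ ∧ J = J₀ ∧ b = a₁) ∨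
      (I = J₀ ∧ a = a₁ ∧ J = I₀ ∧ b = a₀)
  isEmpty : IsEmpty (Fin s.β)

namespace EdgeSplitting

theorem vars_U {I₀ J₀ : P.V} (E : EdgeSplitting s I₀ J₀) (a b : s.Lab) (c : P.Par) :
    Sum.inl c ∉ (s.U a b).vars := by
  by_cases h : a = E.a₀ ∧ b = E.a₁
  · rw [h.1, h.2, E.U_one, vars_one]; exact Finset.notMem_empty _
  · rw [E.U_zero a b h, vars_0]; exact Finset.notMem_empty _

theorem code_of_U_ne_zero {I₀ J₀ : P.V} (E : EdgeSplitting s I₀ J₀) {a b : s.Lab}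
    (h : s.U a b ≠ 0) : s.code I₀ a = s.code J₀ b := by
  by_cases hab : a = E.a₀ ∧ b = E.a₁
  · rw [hab.1, hab.2, E.code_eq]
  · exact absurd (E.U_zero a b hab) h

open Classical in
/-- The diagonal parts for an edge reduction: besides the scalars on the new classes there are the
entries from the first to the second part of each class that is really split. -/
noncomputable def splitFrame (hP : P.IsFreelyParameterized)
    (E : EdgeSplitting s (P.cls p) (P.cls q))
    (hsingle : ∀ r I a b, P.Attached r I → s.allowed I a → s.allowed I b → a = b) :
    SplitFrame s p q ρ D := by
  have hne : E.a₀ ≠ E.a₁ := E.lt.ne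
  -- both sides of the equation for the diagonal parts
  have hl : ∀ (y : P.Par ⊕ Fin s.β → k) (t : P.V → s.Lab → s.Lab → k) a b,
      ∑ e, eval y (s.U e b) * t (P.cls p) a e = if b = E.a₁ then t (P.cls p) a E.a₀ else 0 := by
    intro y t a b
    rw [Finset.sum_eq_single E.a₀]
    · split_ifs with h
      · rw [h, E.U_one, map_one, one_mul]
      · rw [E.U_zero _ _ fun h' => h h'.2, map_zero, zero_mul]
    · intro e _ he
      rw [E.U_zero _ _ fun h' => he h'.1, map_zero, zero_mul]
    · simp
  have hr : ∀ (x : P.Par ⊕ Fin s.β → k) (t : P.V → s.Lab → s.Lab → k) a b,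
      ∑ e, eval x (s.U a e) * t (P.cls q) e b = if a = E.a₀ then t (P.cls q) E.a₁ b else 0 := by
    intro x t a b
    rw [Finset.sum_eq_single E.a₁]
    · split_ifs with h
      · rw [h, E.U_one, map_one, one_mul]
      · rw [E.U_zero _ _ fun h' => h h'.1, map_zero, zero_mul]
    · intro e _ he
      rw [E.U_zero _ _ fun h' => he h'.2, map_zero, zero_mul]
    · simp
  let κ := {I : P.V // (I = P.cls p ∨ I = P.cls q) ∧ s.allowed I E.a₀ ∧ s.allowed I E.a₁}
  have hfin : Finite κ := Set.Finite.subset (Set.toFinite {P.cls p, P.cls q}) fun I h => h.1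
  let _ : Fintype κ := Fintype.ofFinite κ
  refine SplitFrame.mk' hP E.vars_U hsingle κ (fun v => v.1) (fun _ => E.a₀) (fun _ => E.a₁)
    (fun v I a b => if I = v.1 ∧ a = E.a₀ ∧ b = E.a₁ then 1 else 0) ?_ ?_ ?_ ?_ ?_
  · intro v I a b h
    obtain ⟨rfl, rfl, rfl⟩ : I = v.1 ∧ a = E.a₀ ∧ b = E.a₁ := by
      by_contra h0; exact h (if_neg h0)
    exact ⟨E.lt, v.2.2.1, v.2.2.2, rfl, rfl⟩
  · intro v
    exact if_pos ⟨rfl, rfl, rfl⟩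
  · intro v v' hv
    exact if_neg fun h => hv (Subtype.ext h.1)
  · intro x hx y hy t ht heq
    simp only [hl, hr] at heq
    refine ⟨?_, ?_, fun _ β => (E.isEmpty.false β).elim⟩
    · intro I J a b ha hb hab
      rcases E.code_inj I J a b ha hb hab with
        ⟨rfl, rfl⟩ | ⟨rfl, rfl, rfl, rfl⟩ | ⟨rfl, rfl, rfl, rfl⟩
      · rfl
      · simpa using heq _ _ ha hb
      · simpa using (heq _ _ hb ha).symm
    · intro I a b ha hb hab
      rcases E.lab a with rfl | rfl <;> rcases E.lab b with rfl | rfl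
      · exact absurd rfl hab
      · have hI : I = P.cls p ∨ I = P.cls q := by
          by_contra h
          rw [not_or] at h
          exact E.allowed_ne I h.1 h.2 hb
        rw [Finset.sum_eq_single (⟨I, hI, ha, hb⟩ : κ)]
        · simp
        · intro v _ hv
          rw [if_neg fun h => hv (Subtype.ext h.1.symm), mul_zero]
        · simp
      · rw [Finset.sum_eq_zero fun v _ => by rw [if_neg fun h => hne h.2.1.symm, mul_zero]]
        by_cases h1 : I = P.cls p
        · subst h1
          have := heq E.a₁ E.a₁ ha (E.allowed_iff.1 hb)
          rwa [if_pos rfl, if_neg hne.symm] at this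
        · by_cases h2 : I = P.cls q
          · subst h2
            have := heq E.a₀ E.a₀ (E.allowed_iff.2 ha) hb
            rw [if_pos rfl, if_neg hne] at this
            exact this.symm
          · exact absurd ha (E.allowed_ne I h1 h2)
      · exact absurd rfl hab
  · intro x hx y hy t ξ ht hcode hne' _ a b ha hb
    rw [hl, hr]
    rcases E.lab a with rfl | rfl <;> rcases E.lab b with rfl | rfl
    · rw [if_neg hne, if_pos rfl, hne' _ _ _ (E.allowed_iff.1 ha) hb hne.symm]
      exact (Finset.sum_eq_zero fun v _ => by rw [if_neg fun h => hne h.2.1.symm, mul_zero]).symm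
    · rw [if_pos rfl, if_pos rfl]
      exact hcode _ _ _ _ ha hb E.code_eq
    · rw [if_neg hne, if_neg hne.symm]
    · rw [if_pos rfl, if_neg hne.symm, hne' _ _ _ ha (E.allowed_iff.2 hb) hne.symm]
      exact Finset.sum_eq_zero fun v _ => by rw [if_neg fun h => hne h.2.1.symm, mul_zero]

end EdgeSplitting

open Classical in
/-- An edge reduction splits the indices as the name says. -/
noncomputable def edgeSplitting (n : P.V → ℕ) {I₀ J₀ : P.V} (h : I₀ ≠ J₀) (r : ℕ) :
    EdgeSplitting (Reduction.splitEdge n I₀ J₀ r : Reduction.Splitting k P.V P.Par) I₀ J₀ where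
  a₀ := (0 : Fin 2)
  a₁ := (1 : Fin 2)
  lt := show (0 : Fin 2) < 1 by decide
  lab := fun (a : Fin 2) => show a = 0 ∨ a = 1 by omega
  U_one := (if_pos ⟨rfl, rfl⟩ : (if (0 : Fin 2) = 0 ∧ (1 : Fin 2) = 1 then
    (1 : MvPolynomial (P.Par ⊕ Fin 0) k) else 0) = 1)
  U_zero a b hab := if_neg hab
  allowed_iff := by
    simp [Reduction.splitEdge, h.symm]
  allowed_ne I h₁ h₂ := by
    simp [Reduction.splitEdge, h₁, h₂]
  code_eq := by
    simp [Reduction.splitEdge]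
  code_inj I J (a : Fin 2) (b : Fin 2) ha hb hab := by
    simp only [Reduction.splitEdge] at ha hb hab
    split_ifs at hab with h1 h2 h2
    · rcases h1 with ⟨rfl, rfl⟩ | ⟨rfl, rfl⟩ <;> rcases h2 with ⟨rfl, rfl⟩ | ⟨rfl, rfl⟩
      · exact Or.inl ⟨rfl, rfl⟩
      · exact Or.inr (Or.inl ⟨rfl, rfl, rfl, rfl⟩)
      · exact Or.inr (Or.inr ⟨rfl, rfl, rfl, rfl⟩)
      · exact Or.inl ⟨rfl, rfl⟩
    · obtain rfl := Sum.inl_injective hab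
      refine Or.inl ⟨rfl, ?_⟩
      rw [not_or] at h1 h2
      by_cases hI : I = I₀
      · subst hI
        have h3 : a ≠ 0 := fun h => h1.1 ⟨rfl, h⟩
        have h4 : b ≠ 0 := fun h => h2.1 ⟨rfl, h⟩
        exact show a = b by omega
      · by_cases hJ : I = J₀
        · subst hJ
          have h3 : a ≠ 1 := fun h => h1.2 ⟨rfl, h⟩
          have h4 : b ≠ 1 := fun h => h2.2 ⟨rfl, h⟩
          exact show a = b by omega
        · rw [if_neg hI, if_neg hJ] at ha hb
          exact ha.trans hb.symm
  isEmpty := inferInstanceAs (IsEmpty (Fin 0))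

theorem splitEdge_exists_allowed {n : P.V → ℕ} (hn : ∀ I, 0 < n I) {I₀ J₀ : P.V} (h : I₀ ≠ J₀)
    {r : ℕ} (h₁ : r ≤ n I₀) (h₂ : r ≤ n J₀) (I : P.V) :
    ∃ a, (Reduction.splitEdge n I₀ J₀ r : Reduction.Splitting k P.V P.Par).allowed I a := by
  classical
  by_cases hI : I = I₀
  · subst hI
    rcases Nat.eq_zero_or_pos r with hr | hr
    · exact ⟨(1 : Fin 2), by simp [Reduction.splitEdge, hr, hn]⟩
    · exact ⟨(0 : Fin 2), by simp [Reduction.splitEdge, hr]⟩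
  · by_cases hJ : I = J₀
    · subst hJ
      rcases Nat.eq_zero_or_pos r with hr | hr
      · exact ⟨(0 : Fin 2), by simp [Reduction.splitEdge, hr, hn, hI]⟩
      · exact ⟨(1 : Fin 2), by simp [Reduction.splitEdge, hr, hI]⟩
    · exact ⟨(0 : Fin 2), by simp [Reduction.splitEdge, hI, hJ]⟩

/-- A class of size `1` is not split by an edge reduction. -/
theorem splitEdge_allowed_unique {n : P.V → ℕ} {I₀ J₀ : P.V}
    {r : ℕ} {I : P.V} (hI : n I = 1)
    {a b : Fin 2}
    (ha : (Reduction.splitEdge n I₀ J₀ r : Reduction.Splitting k P.V P.Par).allowed I a)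
    (hb : (Reduction.splitEdge n I₀ J₀ r : Reduction.Splitting k P.V P.Par).allowed I b) :
    a = b := by
  simp only [Reduction.splitEdge] at ha hb
  split_ifs at ha hb with h1 h2
  · subst h1; omega
  · subst h2; omega
  · omega

theorem splitEdge_size_pos {n : P.V → ℕ} (hn : ∀ I, 0 < n I) {I₀ J₀ : P.V}
    (h : I₀ ≠ J₀) {r : ℕ} {I : P.V} {a : Fin 2}
    (ha : (Reduction.splitEdge n I₀ J₀ r : Reduction.Splitting k P.V P.Par).allowed I a) :
    0 < (Reduction.splitEdge n I₀ J₀ r : Reduction.Splitting k P.V P.Par).size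
      ((Reduction.splitEdge n I₀ J₀ r : Reduction.Splitting k P.V P.Par).code I a) := by
  have := hn I
  simp only [Reduction.splitEdge] at ha ⊢
  split_ifs at ha ⊢ with h1 h2 h3 <;> simp_all

theorem splitEdge_size_one {n : P.V → ℕ} {I₀ J₀ : P.V} (h : I₀ ≠ J₀) {r : ℕ}
    (h₁ : r ≤ n I₀) (h₂ : r ≤ n J₀)
    {I : P.V} (hI : n I = 1) {a : Fin 2}
    (ha : (Reduction.splitEdge n I₀ J₀ r : Reduction.Splitting k P.V P.Par).allowed I a) :
    (Reduction.splitEdge n I₀ J₀ r : Reduction.Splitting k P.V P.Par).size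
      ((Reduction.splitEdge n I₀ J₀ r : Reduction.Splitting k P.V P.Par).code I a) = 1 := by
  simp only [Reduction.splitEdge] at ha ⊢
  by_cases h1 : I = I₀
  · subst h1
    rw [if_pos rfl] at ha
    rcases ha with ⟨rfl, ha⟩ | ⟨rfl, ha⟩
    · simp; omega
    · simp [h]; omega
  · by_cases h2 : I = J₀
    · subst h2
      rw [if_neg h1, if_pos rfl] at ha
      rcases ha with ⟨rfl, ha⟩ | ⟨rfl, ha⟩
      · simp; omega
      · simp [h1]; omega
    · simp [h1, h2, hI]

end ParamProblem

/-! ### Matrices commuting with Jordan blocks -/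

section Toeplitz

variable {R : Type*} [CommRing R] {r r' : ℕ} {μ μ' : R} {τ : ℕ → ℕ → R}

/-- The equation `τ J' = J τ` for the entry `(g, g')`, where `J` and `J'` are Jordan blocks of sizes
`r + 1` and `r' + 1` with eigenvalues `μ` and `μ'`. -/
def JordanEq (r : ℕ) (μ μ' : R) (τ : ℕ → ℕ → R) (g g' : ℕ) : Prop :=
  μ' * τ g g' + (if 0 < g' then τ g (g' - 1) else 0) =
    μ * τ g g' + (if g < r then τ (g + 1) g' else 0)

/-- Jordan blocks with different eigenvalues have no non-zero intertwiners. -/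
theorem eq_zero_of_jordanEq [IsDomain R]
    (h : ∀ g ≤ r, ∀ g' ≤ r', JordanEq r μ μ' τ g g') (hμ : μ ≠ μ') :
    ∀ g ≤ r, ∀ g' ≤ r', τ g g' = 0 := by
  have key : ∀ m g g', g ≤ r → g' ≤ r' → (r - g) + g' = m → τ g g' = 0 := by
    intro m
    induction m with
    | zero =>
      intro g g' hg hg' hm
      have := h g hg g' hg'
      rw [JordanEq, if_neg (by omega), if_neg (by omega), add_zero, add_zero] at this
      have h2 : (μ' - μ) * τ g g' = 0 := by rw [sub_mul, this, sub_self]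
      exact (mul_eq_zero.1 h2).resolve_left (sub_ne_zero.2 hμ.symm)
    | succ m ih =>
      intro g g' hg hg' hm
      have := h g hg g' hg'
      have e1 : (if 0 < g' then τ g (g' - 1) else 0) = 0 := by
        split_ifs
        · exact ih _ _ hg (by omega) (by omega)
        · rfl
      have e2 : (if g < r then τ (g + 1) g' else 0) = 0 := by
        split_ifs
        · exact ih _ _ (by omega) hg' (by omega)
        · rfl
      rw [JordanEq, e1, e2, add_zero, add_zero] at this
      have h2 : (μ' - μ) * τ g g' = 0 := by rw [sub_mul, this, sub_self]
      exact (mul_eq_zero.1 h2).resolve_left (sub_ne_zero.2 hμ.symm)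
  exact fun g hg g' hg' => key _ g g' hg hg' rfl


/-- The matrices intertwining two Jordan blocks with the same eigenvalue are the Toeplitz
matrices with zeros outside a triangle. -/
theorem toeplitz_of_jordanEq (h : ∀ g ≤ r, ∀ g' ≤ r', JordanEq r μ μ τ g g') {g g' : ℕ}
    (hg : g ≤ r) (hg' : g' ≤ r') :
    τ g g' = if g ≤ g' ∧ r' + g ≤ r + g' then τ 0 (g' - g) else 0 := by
  have h0 : ∀ g ≤ r, ∀ g' ≤ r', (if 0 < g' then τ g (g' - 1) else 0) =
      (if g < r then τ (g + 1) g' else 0) := fun g hg g' hg' => add_left_cancel (h g hg g' hg')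
  have hd : ∀ m g g', g + m ≤ r → g' + m ≤ r' → τ g g' = τ (g + m) (g' + m) := by
    intro m
    induction m with
    | zero => intros; rfl
    | succ m ih =>
      intro g g' hg hg'
      have := h0 (g + m) (by omega) (g' + m + 1) (by omega)
      rw [if_pos (by omega), if_pos (by omega)] at this
      rw [ih g g' (by omega) (by omega)]
      exact this
  by_cases h1 : g ≤ g'
  · by_cases h2 : r' + g ≤ r + g'
    · rw [if_pos ⟨h1, h2⟩, hd g 0 (g' - g) (by omega) (by omega), zero_add,
        Nat.sub_add_cancel h1]
    · rw [if_neg fun h => h2 h.2, hd (r - g) g g' (by omega) (by omega)]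
      have := h0 r le_rfl (g' + (r - g) + 1) (by omega)
      rw [if_pos (by omega), if_neg (by omega)] at this
      rw [show g + (r - g) = r by omega]
      exact this
  · rw [if_neg fun h => h1 h.1]
    have := hd g' (g - g') 0 (by omega) (by omega)
    rw [zero_add, show g - g' + g' = g by omega] at this
    rw [← this]
    have := h0 (g - g' - 1) (by omega) 0 (by omega)
    rw [if_neg (by omega), if_pos (by omega), show g - g' - 1 + 1 = g - g' by omega] at this
    exact this.symm


theorem jordanEq_of_toeplitz (h : ∀ g ≤ r, ∀ g' ≤ r',
    τ g g' = if g ≤ g' ∧ r' + g ≤ r + g' then τ 0 (g' - g) else 0) {g g' : ℕ}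
    (hg : g ≤ r) (hg' : g' ≤ r') : JordanEq r μ μ τ g g' := by
  rw [JordanEq]
  congr 1
  by_cases h1 : 0 < g'
  · rw [if_pos h1, h _ hg (g' - 1) (by omega)]
    by_cases h2 : g < r
    · rw [if_pos h2, h (g + 1) (by omega) _ hg', show g' - (g + 1) = g' - 1 - g by omega]
      by_cases h3 : g ≤ g' - 1 ∧ r' + g ≤ r + (g' - 1)
      · rw [if_pos h3, if_pos (by omega)]
      · rw [if_neg h3, if_neg (by omega)]
    · rw [if_neg h2, if_neg (by omega)]
  · rw [if_neg h1]
    by_cases h2 : g < r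
    · rw [if_pos h2, h (g + 1) (by omega) _ hg', if_neg (by omega)]
    · rw [if_neg h2]

end Toeplitz

namespace WeyrData

variable {k : Type u}

/-- The label at the position `g` in the Jordan blocks of size `r + 1` with eigenvalue `l`;
positions beyond the end of the block are replaced by the last one. -/
def lb (W : WeyrData k) (l : Fin W.α ⊕ Fin W.β) (r : Fin W.d) (g : ℕ) : W.Label :=
  toLex (toLex l, toLex (⟨min g r, lt_of_le_of_lt (min_le_right _ _) r.2⟩, OrderDual.toDual r))

variable {W : WeyrData k}

@[simp] theorem ev_lb (l : Fin W.α ⊕ Fin W.β) (r : Fin W.d) (g : ℕ) : (W.lb l r g).ev = l := rfl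

@[simp] theorem len_lb (l : Fin W.α ⊕ Fin W.β) (r : Fin W.d) (g : ℕ) : (W.lb l r g).len = r := rfl

theorem pos_lb {l : Fin W.α ⊕ Fin W.β} {r : Fin W.d} {g : ℕ} (h : g ≤ r) :
    ((W.lb l r g).pos : ℕ) = g := min_eq_left h

theorem valid_lb {l : Fin W.α ⊕ Fin W.β} {r : Fin W.d} (h : W.e l r ≠ 0) (g : ℕ) :
    (W.lb l r g).Valid := ⟨min_le_right g r, h⟩

theorem Label.ext {X Y : W.Label} (h₁ : X.ev = Y.ev) (h₂ : X.len = Y.len)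
    (h₃ : (X.pos : ℕ) = Y.pos) : X = Y :=
  Prod.ext h₁ (Prod.ext (Fin.ext h₃) h₂)

theorem lb_self {X : W.Label} (h : X.Valid) : W.lb X.ev X.len X.pos = X :=
  Label.ext rfl rfl (pos_lb h.1)

theorem Label.lt_of {X Y : W.Label} (h : X.ev = Y.ev)
    (h' : (X.pos : ℕ) < Y.pos ∨ (X.pos : ℕ) = Y.pos ∧ (Y.len : ℕ) < X.len) : X < Y := by
  refine Prod.Lex.lt_iff.2 (Or.inr ⟨h, Prod.Lex.lt_iff.2 ?_⟩)
  rcases h' with h' | h'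
  · exact Or.inl h'
  · exact Or.inr ⟨Fin.ext h'.1, h'.2⟩

/-- The indices of the Toeplitz matrices: their non-zero entries lie in the rows `(l, _, r)` and the
columns `(l, _, r')`, on the diagonal which begins at the column `(l, t, r')`. -/
def Shift (W : WeyrData k) : Type :=
  {v : (Fin W.α ⊕ Fin W.β) × Fin W.d × Fin W.d × Fin W.d // W.e v.1 v.2.1 ≠ 0 ∧
    W.e v.1 v.2.2.1 ≠ 0 ∧ (v.2.2.2 : ℕ) ≤ v.2.2.1 ∧ (v.2.2.1 : ℕ) ≤ v.2.1 + v.2.2.2 ∧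
    ¬ ((v.2.2.2 : ℕ) = 0 ∧ v.2.1 = v.2.2.1)}

noncomputable instance (W : WeyrData k) : Fintype (Shift W) := by
  classical exact inferInstanceAs
    (Fintype {v : (Fin W.α ⊕ Fin W.β) × Fin W.d × Fin W.d × Fin W.d // _})

/-- The position `(X, Y)` lies on the diagonal `v`. -/
def Shift.On (v : Shift W) (X Y : W.Label) : Prop :=
  X.Valid ∧ Y.Valid ∧ X.ev = v.1.1 ∧ Y.ev = v.1.1 ∧ X.len = v.1.2.1 ∧ Y.len = v.1.2.2.1 ∧
    (Y.pos : ℕ) = X.pos + v.1.2.2.2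

theorem Shift.on_pivot (v : Shift W) :
    v.On (W.lb v.1.1 v.1.2.1 0) (W.lb v.1.1 v.1.2.2.1 v.1.2.2.2) :=
  ⟨valid_lb v.2.1 _, valid_lb v.2.2.1 _, rfl, rfl, rfl, rfl, by
    rw [pos_lb (Nat.zero_le _), pos_lb v.2.2.2.1, zero_add]⟩

theorem Shift.eq_of_on {v v' : Shift W} {X Y : W.Label} (h : v.On X Y) (h' : v'.On X Y) :
    v = v' := by
  obtain ⟨-, -, h1, -, h2, h3, h4⟩ := h
  obtain ⟨-, -, h1', -, h2', h3', h4'⟩ := h'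
  refine Subtype.ext (Prod.ext (h1.symm.trans h1') (Prod.ext (h2.symm.trans h2')
    (Prod.ext (h3.symm.trans h3') (Fin.ext ?_))))
  omega

/-- The diagonal through `(X, Y)`. -/
def Shift.mk' {X Y : W.Label} (hX : X.Valid) (hY : Y.Valid) (hev : X.ev = Y.ev) (hne : X ≠ Y)
    (h : (X.pos : ℕ) ≤ Y.pos ∧ (Y.len : ℕ) + X.pos ≤ X.len + Y.pos) : Shift W :=
  ⟨(X.ev, X.len, Y.len, ⟨Y.pos - X.pos, lt_of_le_of_lt (Nat.sub_le _ _) Y.pos.2⟩), hX.2,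
    hev ▸ hY.2, le_trans (Nat.sub_le _ _) hY.1, by dsimp only; omega, fun h' => hne
      (Label.ext hev h'.2 (by have := h'.1; dsimp only at this; omega))⟩

theorem Shift.on_mk' {X Y : W.Label} (hX : X.Valid) (hY : Y.Valid) (hev : X.ev = Y.ev)
    (hne : X ≠ Y) (h : (X.pos : ℕ) ≤ Y.pos ∧ (Y.len : ℕ) + X.pos ≤ X.len + Y.pos) :
    (Shift.mk' hX hY hev hne h).On X Y :=
  ⟨hX, hY, rfl, hev.symm, rfl, rfl, by simp only [Shift.mk']; omega⟩

theorem Shift.On.le {v : Shift W} {X Y : W.Label} (h : v.On X Y) :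
    (X.pos : ℕ) ≤ Y.pos ∧ (Y.len : ℕ) + X.pos ≤ X.len + Y.pos := by
  obtain ⟨-, -, -, -, h2, h3, h4⟩ := h
  have := v.2.2.2.2.1
  rw [h2, h3]
  omega

theorem Shift.On.ne {v : Shift W} {X Y : W.Label} (h : v.On X Y) : X ≠ Y := by
  rintro rfl
  obtain ⟨-, -, -, -, h2, h3, h4⟩ := h
  exact v.2.2.2.2.2 ⟨by omega, h2.symm.trans h3⟩

theorem Shift.On.lt {v : Shift W} {X Y : W.Label} (h : v.On X Y) : X < Y := by
  have h0 := h.le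
  have h1 := h.ne
  have h2 : X.ev = Y.ev := h.2.2.1.trans h.2.2.2.1.symm
  refine Label.lt_of h2 ?_
  by_contra hc
  have : X.pos = Y.pos := Fin.ext (by omega)
  have h3 : (X.len : ℕ) ≠ Y.len := fun h' => h1 (Label.ext h2 (Fin.ext h') (by omega))
  omega

end WeyrData

namespace ParamProblem

variable {k : Type u} [Field k] {P : ParamProblem k} {s : Reduction.Splitting k P.V P.Par}
  {p q : P.T} {ρ : Matrix P.T P.T k} {D : Set (P.Par ⊕ Fin s.β → k)}

/-! ### Loop reduction -/

/-- The splitting of the indices by a loop reduction at `I₀` with the Weyr matrix `W`. -/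
structure LoopSplitting (s : Reduction.Splitting k P.V P.Par) (I₀ : P.V) (W : WeyrData k) where
  lbl : W.Label → s.Lab
  lt : ∀ X Y, X < Y → lbl X < lbl Y
  par : Fin W.β ≃ Fin s.β
  allowed_iff : ∀ a, s.allowed I₀ a ↔ ∃ X : W.Label, X.Valid ∧ a = lbl X
  allowed_ne : ∀ I a b, I ≠ I₀ → s.allowed I a → s.allowed I b → a = b
  vars_U : ∀ a b c, Sum.inl c ∉ (s.U a b).vars
  U_self : ∀ X, s.U (lbl X) (lbl X) =
    Sum.elim (fun i => C (W.c i)) (fun b => MvPolynomial.X (Sum.inr (par b))) X.ev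
  U_next : ∀ X Y, X.ev = Y.ev → X.len = Y.len → (Y.pos : ℕ) = X.pos + 1 →
    s.U (lbl X) (lbl Y) = 1
  U_zero : ∀ X Y, X ≠ Y → ¬ (X.ev = Y.ev ∧ X.len = Y.len ∧ (Y.pos : ℕ) = X.pos + 1) →
    s.U (lbl X) (lbl Y) = 0
  code_iff : ∀ X Y, s.code I₀ (lbl X) = s.code I₀ (lbl Y) ↔ X.ev = Y.ev ∧ X.len = Y.len
  code_inj : ∀ I J a b, s.allowed I a → s.allowed J b → s.code I a = s.code J b → I = J

namespace LoopSplitting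

variable {I₀ : P.V} {W : WeyrData k} (E : LoopSplitting s I₀ W)

/-- The eigenvalues at given values of the parameters. -/
def val (x : P.Par ⊕ Fin s.β → k) : Fin W.α ⊕ Fin W.β → k :=
  Sum.elim W.c fun b => x (Sum.inr (E.par b))

theorem eval_U_self (x : P.Par ⊕ Fin s.β → k) (X : W.Label) :
    eval x (s.U (E.lbl X) (E.lbl X)) = E.val x X.ev := by
  rw [E.U_self, val]
  rcases X.ev with i | b <;> simp

theorem lbl_inj {X Y : W.Label} (h : E.lbl X = E.lbl Y) : X = Y := by
  rcases lt_trichotomy X Y with h' | h' | h'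
  · exact absurd h (E.lt _ _ h').ne
  · exact h'
  · exact absurd h (E.lt _ _ h').ne'

theorem code_of_U_ne_zero (E : LoopSplitting s I₀ W) {a b : s.Lab}
    (ha : s.allowed I₀ a) (hb : s.allowed I₀ b)
    (h : s.U a b ≠ 0) : s.code I₀ a = s.code I₀ b := by
  obtain ⟨X, -, rfl⟩ := (E.allowed_iff a).1 ha
  obtain ⟨Y, -, rfl⟩ := (E.allowed_iff b).1 hb
  by_cases hXY : X = Y
  · rw [hXY]
  · by_contra hc
    exact h (E.U_zero X Y hXY fun h' => hc ((E.code_iff X Y).2 ⟨h'.1, h'.2.1⟩))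

theorem lbl_allowed {X : W.Label} (hX : X.Valid) : s.allowed I₀ (E.lbl X) :=
  (E.allowed_iff _).2 ⟨X, hX, rfl⟩

theorem sum_U_right {t : P.V → s.Lab → s.Lab → k}
    (ht : ∀ I a b, t I a b ≠ 0 → s.allowed I a ∧ s.allowed I b) (y : P.Par ⊕ Fin s.β → k)
    (a : s.Lab) {Y : W.Label} (hY : Y.Valid) :
    ∑ e, eval y (s.U e (E.lbl Y)) * t I₀ a e = E.val y Y.ev * t I₀ a (E.lbl Y) +
      if 0 < (Y.pos : ℕ) then t I₀ a (E.lbl (W.lb Y.ev Y.len (Y.pos - 1))) else 0 := by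
  classical
  have h0 : ∀ e, e ≠ E.lbl Y → ¬ (0 < (Y.pos : ℕ) ∧ e = E.lbl (W.lb Y.ev Y.len (Y.pos - 1))) →
      eval y (s.U e (E.lbl Y)) * t I₀ a e = 0 := by
    intro e he he'
    by_contra h
    obtain ⟨X, hX, rfl⟩ := (E.allowed_iff _).1 (ht _ _ _ (right_ne_zero_of_mul h)).2
    have hXY : X ≠ Y := fun h => he (congrArg _ h)
    rw [E.U_zero X Y hXY, map_zero, zero_mul] at h
    · exact h rfl
    · rintro ⟨h1, h2, h3⟩
      refine he' ⟨by omega, ?_⟩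
      rw [← WeyrData.lb_self hX, h1, h2, show (X.pos : ℕ) = Y.pos - 1 by omega]
  split_ifs with hpos
  · have hlen : (Y.pos : ℕ) ≤ Y.len := hY.1
    have hp : ((W.lb Y.ev Y.len (Y.pos - 1)).pos : ℕ) = Y.pos - 1 :=
      WeyrData.pos_lb (by omega)
    have hne : E.lbl (W.lb Y.ev Y.len (Y.pos - 1)) ≠ E.lbl Y := by
      intro h
      have := E.lbl_inj h
      rw [this] at hp
      omega
    rw [Finset.sum_eq_add (E.lbl Y) (E.lbl (W.lb Y.ev Y.len (Y.pos - 1))) hne.symm, eval_U_self,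
      E.U_next _ _ (WeyrData.ev_lb ..) (WeyrData.len_lb ..) (by rw [hp]; omega), map_one, one_mul]
    · exact fun e _ he => h0 e he.1 fun h => he.2 h.2
    · simp
    · simp
  · rw [Finset.sum_eq_single (E.lbl Y), eval_U_self, add_zero]
    · exact fun e _ he => h0 e he fun h => hpos h.1
    · simp

theorem sum_U_left {t : P.V → s.Lab → s.Lab → k}
    (ht : ∀ I a b, t I a b ≠ 0 → s.allowed I a ∧ s.allowed I b) (x : P.Par ⊕ Fin s.β → k)
    (b : s.Lab) {X : W.Label} :
    ∑ e, eval x (s.U (E.lbl X) e) * t I₀ e b = E.val x X.ev * t I₀ (E.lbl X) b +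
      if (X.pos : ℕ) < X.len then t I₀ (E.lbl (W.lb X.ev X.len (X.pos + 1))) b else 0 := by
  classical
  have h0 : ∀ e, e ≠ E.lbl X → ¬ ((X.pos : ℕ) < X.len ∧
      e = E.lbl (W.lb X.ev X.len (X.pos + 1))) →
      eval x (s.U (E.lbl X) e) * t I₀ e b = 0 := by
    intro e he he'
    by_contra h
    obtain ⟨Y, hY, rfl⟩ := (E.allowed_iff _).1 (ht _ _ _ (right_ne_zero_of_mul h)).1
    have hXY : X ≠ Y := fun h => he (congrArg _ h.symm)
    rw [E.U_zero X Y hXY, map_zero, zero_mul] at h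
    · exact h rfl
    · rintro ⟨h1, h2, h3⟩
      have hlen : (Y.pos : ℕ) ≤ Y.len := hY.1
      refine he' ⟨by rw [h2]; omega, ?_⟩
      rw [← WeyrData.lb_self hY, h1, h2, h3]
  split_ifs with hpos
  · have hp : ((W.lb X.ev X.len (X.pos + 1)).pos : ℕ) = X.pos + 1 :=
      WeyrData.pos_lb (by omega)
    have hne : E.lbl (W.lb X.ev X.len (X.pos + 1)) ≠ E.lbl X := by
      intro h
      have := E.lbl_inj h
      rw [this] at hp
      omega
    rw [Finset.sum_eq_add (E.lbl X) (E.lbl (W.lb X.ev X.len (X.pos + 1))) hne.symm, eval_U_self,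
      E.U_next _ _ (WeyrData.ev_lb ..).symm (WeyrData.len_lb ..).symm hp, map_one, one_mul]
    · exact fun e _ he => h0 e he.1 fun h => he.2 h.2
    · simp
    · simp
  · rw [Finset.sum_eq_single (E.lbl X), eval_U_self, add_zero]
    · exact fun e _ he => h0 e he fun h => hpos h.1
    · simp

/-- The diagonal part with row labels `(l, _, r)` and column labels `(l', _, r')`. -/
def tau (t : P.V → s.Lab → s.Lab → k) (l l' : Fin W.α ⊕ Fin W.β) (r r' : Fin W.d) (g g' : ℕ) : k :=
  t I₀ (E.lbl (W.lb l r g)) (E.lbl (W.lb l' r' g'))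

theorem tau_self (t : P.V → s.Lab → s.Lab → k) {X Y : W.Label} (hX : X.Valid) (hY : Y.Valid) :
    E.tau t X.ev Y.ev X.len Y.len X.pos Y.pos = t I₀ (E.lbl X) (E.lbl Y) := by
  rw [tau, WeyrData.lb_self hX, WeyrData.lb_self hY]

/-- The equations for the diagonal parts are those for matrices which intertwine Jordan blocks. -/
theorem equation_iff {t : P.V → s.Lab → s.Lab → k}
    (ht : ∀ I a b, t I a b ≠ 0 → s.allowed I a ∧ s.allowed I b) (x y : P.Par ⊕ Fin s.β → k)
    {X Y : W.Label} (hX : X.Valid) (hY : Y.Valid) :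
    ∑ e, eval y (s.U e (E.lbl Y)) * t I₀ (E.lbl X) e =
        ∑ e, eval x (s.U (E.lbl X) e) * t I₀ e (E.lbl Y) ↔
      JordanEq X.len (E.val x X.ev) (E.val y Y.ev) (E.tau t X.ev Y.ev X.len Y.len)
        X.pos Y.pos := by
  rw [E.sum_U_right ht y _ hY, E.sum_U_left ht x _, JordanEq, tau, WeyrData.lb_self hX,
    WeyrData.lb_self hY]
  simp only [tau, WeyrData.lb_self hX, WeyrData.lb_self hY]

open Classical in
/-- The Toeplitz matrix with the entries `1` on one diagonal. -/
noncomputable def toeplitz (v : WeyrData.Shift W) (I : P.V) (a b : s.Lab) : k :=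
  if ∃ X Y, v.On X Y ∧ I = I₀ ∧ a = E.lbl X ∧ b = E.lbl Y then 1 else 0

theorem toeplitz_eq_one {v : WeyrData.Shift W} {X Y : W.Label} (h : v.On X Y) :
    E.toeplitz v I₀ (E.lbl X) (E.lbl Y) = 1 := if_pos ⟨X, Y, h, rfl, rfl, rfl⟩

theorem toeplitz_eq_zero {v : WeyrData.Shift W} {X Y : W.Label} (h : ¬ v.On X Y) :
    E.toeplitz v I₀ (E.lbl X) (E.lbl Y) = 0 := if_neg fun ⟨_, _, h', _, h1, h2⟩ => by
  rw [E.lbl_inj h1, E.lbl_inj h2] at h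
  exact h h'

theorem sum_toeplitz (f : WeyrData.Shift W → k) {X Y : W.Label} {v : WeyrData.Shift W}
    (h : v.On X Y) :
    ∑ v, f v * E.toeplitz v I₀ (E.lbl X) (E.lbl Y) = f v := by
  rw [Finset.sum_eq_single v, E.toeplitz_eq_one h, mul_one]
  · intro v' _ hv
    rw [E.toeplitz_eq_zero fun h' => hv (WeyrData.Shift.eq_of_on h' h), mul_zero]
  · simp

theorem sum_toeplitz_eq_zero (f : WeyrData.Shift W → k) {X Y : W.Label}
    (h : ∀ v : WeyrData.Shift W, ¬ v.On X Y) :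
    ∑ v, f v * E.toeplitz v I₀ (E.lbl X) (E.lbl Y) = 0 :=
  Finset.sum_eq_zero fun v _ => by rw [E.toeplitz_eq_zero (h v), mul_zero]

/-- A new parameter is attached to the classes of the blocks having it as eigenvalue. -/
theorem attached_inr_iff (E : LoopSplitting s (P.cls p) W) (hρ : P.IsFirst p q ρ)
    (hpq : P.cls q = P.cls p) {β : Fin s.β} {c : (induced s p q ρ D).V} :
    (induced s p q ρ D).Attached (Sum.inr β) c ↔
      ∃ (X : W.Label) (b : Fin W.β), X.Valid ∧ X.ev = Sum.inr b ∧ E.par b = β ∧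
        s.code (P.cls p) (E.lbl X) = c.1 := by
  classical
  constructor
  · rintro ⟨i, j, hi, -, h⟩
    rcases mem_vars_newH h with ⟨-, a, h1, -⟩ | ⟨h1, h2⟩
    · cases h1
    have hp := hρ.comp.2 _ _ h1
    obtain ⟨X, hX, hX'⟩ := (E.allowed_iff _).1 (hp.1 ▸ NewT.allowed i)
    obtain ⟨Y, hY, hY'⟩ := (E.allowed_iff _).1 ((hp.2.trans hpq) ▸ NewT.allowed j)
    rw [hX', hY'] at h2
    have hXY : X = Y := by
      by_contra hXY
      by_cases hn : X.ev = Y.ev ∧ X.len = Y.len ∧ (Y.pos : ℕ) = X.pos + 1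
      · rw [E.U_next X Y hn.1 hn.2.1 hn.2.2, vars_one] at h2
        exact Finset.notMem_empty _ h2
      · rw [E.U_zero X Y hXY hn, vars_0] at h2
        exact Finset.notMem_empty _ h2
    subst hXY
    rw [E.U_self] at h2
    rcases hl : X.ev with l | b
    · rw [hl, Sum.elim_inl, vars_C] at h2
      exact absurd h2 (Finset.notMem_empty _)
    · rw [hl, Sum.elim_inr, vars_X, Finset.mem_singleton] at h2
      refine ⟨X, b, hX, hl, (Sum.inr_injective h2).symm, ?_⟩
      rw [← hX', ← hp.1]
      exact congrArg Subtype.val hi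
  · rintro ⟨X, b, hX, hev, rfl, hc⟩
    have h1 := E.lbl_allowed hX
    refine ⟨NewT.mk' p (E.lbl X) h1, NewT.mk' q (E.lbl X) (hpq.symm ▸ h1), Subtype.ext hc,
      Subtype.ext (Eq.trans ?_ hc), ?_⟩
    · exact congrArg (fun I => s.code I (E.lbl X)) hpq
    · have e : newH s ρ (NewT.mk' p (E.lbl X) h1) (NewT.mk' q (E.lbl X) (hpq.symm ▸ h1)) =
          rename Sum.inl (P.H p q) + MvPolynomial.X (Sum.inr (E.par b)) := by
        simp [newH, hρ.lead, E.U_self, hev]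
      change _ ∈ (newH s ρ _ _).vars
      rw [e]
      have h2 : Sum.inr (E.par b) ∈
          (MvPolynomial.X (Sum.inr (E.par b)) : MvPolynomial (P.Par ⊕ Fin s.β) k).vars := by
        simp
      rw [eq_sub_of_add_eq' (rfl : rename Sum.inl (P.H p q) +
        MvPolynomial.X (Sum.inr (E.par b)) = _)] at h2
      rcases Finset.mem_union.1 (vars_sub_subset _ h2) with h | h
      · exact h
      · obtain ⟨a, -, h⟩ := mem_vars_rename _ _ h
        cases h

/-- The diagonal parts for a loop reduction: scalars on the new classes and Toeplitz matrices. A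
new parameter may occur in a block of size `1` only, and its left values have to differ from the
other right eigenvalues and conversely. -/
noncomputable def splitFrame (hP : P.IsFreelyParameterized) (hρ : P.IsFirst p q ρ)
    (hpq : P.cls q = P.cls p)
    (E : LoopSplitting s (P.cls p) W)
    (hsingle : ∀ r I a b, P.Attached r I → s.allowed I a → s.allowed I b → a = b)
    (hone : ∀ b r, W.e (Sum.inr b) r ≠ 0 → (r : ℕ) = 0)
    (hval : ∀ x ∈ D, ∀ y ∈ D, ∀ l l', l ≠ l' → E.val x l ≠ E.val y l') :
    SplitFrame s p q ρ D := by
  classical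
  refine SplitFrame.mk' hP E.vars_U hsingle (WeyrData.Shift W) (fun _ => P.cls p)
    (fun v => E.lbl (W.lb v.1.1 v.1.2.1 0)) (fun v => E.lbl (W.lb v.1.1 v.1.2.2.1 v.1.2.2.2))
    E.toeplitz ?_ ?_ ?_ ?_ ?_
  · intro v I a b h
    obtain ⟨X, Y, hXY, rfl, rfl, rfl⟩ : ∃ X Y, v.On X Y ∧ I = P.cls p ∧ a = E.lbl X ∧
        b = E.lbl Y := by
      by_contra h0
      exact h (if_neg h0)
    exact ⟨E.lt _ _ hXY.lt, E.lbl_allowed hXY.1, E.lbl_allowed hXY.2.1,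
      (E.code_iff _ _).2 ⟨hXY.2.2.1, hXY.2.2.2.2.1⟩,
      (E.code_iff _ _).2 ⟨hXY.2.2.2.1, hXY.2.2.2.2.2.1⟩⟩
  · exact fun v => E.toeplitz_eq_one v.on_pivot
  · exact fun v v' hv => E.toeplitz_eq_zero fun h => hv (WeyrData.Shift.eq_of_on v.on_pivot h)
  · intro x hx y hy t ht heq
    rw [hpq] at heq
    have hJ : ∀ l l' r r', W.e l r ≠ 0 → W.e l' r' ≠ 0 → ∀ g ≤ (r : ℕ), ∀ g' ≤ (r' : ℕ),
        JordanEq r (E.val x l) (E.val y l') (E.tau t l l' r r') g g' := by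
      intro l l' r r' h h' g hg g' hg'
      have h1 := WeyrData.valid_lb h g
      have h2 := WeyrData.valid_lb h' g'
      have := (E.equation_iff ht x y h1 h2).1 (heq _ _ (E.lbl_allowed h1) (E.lbl_allowed h2))
      rwa [WeyrData.pos_lb hg, WeyrData.pos_lb hg'] at this
    have hzero : ∀ X Y : W.Label, X.Valid → Y.Valid → E.val x X.ev ≠ E.val y Y.ev →
        t (P.cls p) (E.lbl X) (E.lbl Y) = 0 := by
      intro X Y hX hY h
      rw [← E.tau_self t hX hY]
      exact eq_zero_of_jordanEq (hJ _ _ _ _ hX.2 hY.2) h _ hX.1 _ hY.1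
    have htoep : ∀ X Y : W.Label, X.Valid → Y.Valid → X.ev = Y.ev →
        E.val x X.ev = E.val y Y.ev → t (P.cls p) (E.lbl X) (E.lbl Y) =
          if (X.pos : ℕ) ≤ Y.pos ∧ (Y.len : ℕ) + X.pos ≤ X.len + Y.pos then
            E.tau t X.ev Y.ev X.len Y.len 0 (Y.pos - X.pos) else 0 := by
      intro X Y hX hY _ h
      rw [← E.tau_self t hX hY]
      refine toeplitz_of_jordanEq (r := X.len) (r' := Y.len) (μ := E.val x X.ev) ?_ hX.1 hY.1
      have := hJ _ _ _ _ hX.2 hY.2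
      rwa [← h] at this
    refine ⟨?_, ?_, ?_⟩
    · intro I J a b ha hb hab
      obtain rfl := E.code_inj I J a b ha hb hab
      by_cases hI : I = P.cls p
      · subst hI
        obtain ⟨X, hX, rfl⟩ := (E.allowed_iff a).1 ha
        obtain ⟨Y, hY, rfl⟩ := (E.allowed_iff b).1 hb
        obtain ⟨h1, h2⟩ := (E.code_iff X Y).1 hab
        by_cases hv : E.val x X.ev = E.val y X.ev
        · rw [htoep X X hX hX rfl hv, htoep Y Y hY hY rfl (h1 ▸ hv), if_pos (by omega),
            if_pos (by omega), h1, h2, Nat.sub_self, Nat.sub_self]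
        · rw [hzero X X hX hX hv, hzero Y Y hY hY (h1 ▸ hv)]
      · rw [E.allowed_ne I a b hI ha hb]
    · intro I a b ha hb hab
      by_cases hI : I = P.cls p
      swap
      · exact absurd (E.allowed_ne I a b hI ha hb) hab
      subst hI
      obtain ⟨X, hX, rfl⟩ := (E.allowed_iff a).1 ha
      obtain ⟨Y, hY, rfl⟩ := (E.allowed_iff b).1 hb
      have hne : X ≠ Y := fun h => hab (congrArg _ h)
      by_cases hev : X.ev = Y.ev
      · by_cases hv : E.val x X.ev = E.val y Y.ev
        · rw [htoep X Y hX hY hev hv]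
          split_ifs with h
          · rw [E.sum_toeplitz _ (WeyrData.Shift.on_mk' hX hY hev hne h), ← hev]
            rfl
          · exact (E.sum_toeplitz_eq_zero _ fun v hv => h hv.le).symm
        · refine absurd (WeyrData.Label.ext hev ?_ ?_) hne
          all_goals
            rcases hl : X.ev with i | b
            · rw [← hev, hl] at hv
              exact absurd rfl hv
            · have h1 := hone b X.len (hl ▸ hX.2)
              have h2 := hone b Y.len (hl ▸ hev ▸ hY.2)
              have h3 : (X.pos : ℕ) ≤ X.len := hX.1
              have h4 : (Y.pos : ℕ) ≤ Y.len := hY.1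
              first | exact Fin.ext (h1.trans h2.symm) | omega
      · rw [hzero X Y hX hY (hval x hx y hy _ _ hev)]
        exact (E.sum_toeplitz_eq_zero _ fun v hv => hev (hv.2.2.1.trans hv.2.2.2.1.symm)).symm
    · intro z β hβ hz
      obtain ⟨X, b, hX, hev, rfl, h3⟩ := (E.attached_inr_iff hρ hpq).1 hβ
      have h1 : P.cls z.idx = P.cls p :=
        (E.code_inj _ _ _ _ (E.lbl_allowed hX) z.allowed h3).symm
      obtain ⟨Y, hY, h2⟩ := (E.allowed_iff z.lab).1 (h1 ▸ z.allowed)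
      have h4 : s.code (P.cls p) (E.lbl X) = s.code (P.cls p) (E.lbl Y) := by
        rw [h3, ← h2, ← h1]; rfl
      obtain ⟨h5, -⟩ := (E.code_iff _ _).1 h4
      rw [hev] at h5
      by_contra hxy
      rw [h1, h2] at hz
      refine hz (hzero Y Y hY hY ?_)
      rw [← h5]
      exact hxy
  · intro x hx y hy t ξ ht hcode hne hnew a b ha hb
    rw [hpq] at hb ⊢
    obtain ⟨X, hX, rfl⟩ := (E.allowed_iff a).1 ha
    obtain ⟨Y, hY, rfl⟩ := (E.allowed_iff b).1 hb
    rw [E.equation_iff ht x y hX hY]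
    have hval : ∀ g g', E.tau t X.ev Y.ev X.len Y.len g g' =
        t (P.cls p) (E.lbl (W.lb X.ev X.len g)) (E.lbl (W.lb Y.ev Y.len g')) := fun _ _ => rfl
    by_cases hev : X.ev = Y.ev
    · have hto : ∀ g ≤ (X.len : ℕ), ∀ g' ≤ (Y.len : ℕ), E.tau t X.ev Y.ev X.len Y.len g g' =
          if g ≤ g' ∧ (Y.len : ℕ) + g ≤ X.len + g' then
            E.tau t X.ev Y.ev X.len Y.len 0 (g' - g) else 0 := by
        intro g hg g' hg'
        have hX' := WeyrData.valid_lb hX.2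
        have hY' := WeyrData.valid_lb hY.2
        by_cases hXY : X.len = Y.len ∧ g = g'
        · obtain ⟨h1, rfl⟩ := hXY
          rw [if_pos (by rw [h1]; omega), Nat.sub_self, hval, hval, ← hev, ← h1]
          exact hcode _ _ _ _ (E.lbl_allowed (hX' g)) (E.lbl_allowed (hX' 0))
            ((E.code_iff _ _).2 ⟨rfl, rfl⟩)
        · have hn : ∀ g g', g ≤ (X.len : ℕ) → g' ≤ (Y.len : ℕ) → ¬ (X.len = Y.len ∧ g = g') →
              W.lb X.ev X.len g ≠ W.lb Y.ev Y.len g' := by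
            intro g g' hg hg' h h'
            have h'' := congrArg WeyrData.Label.len h'
            refine h ⟨h'', ?_⟩
            rw [← WeyrData.pos_lb hg, h', WeyrData.pos_lb hg']
          have hn1 := hn g g' hg hg' hXY
          rw [hval, hval, hne _ _ _ (E.lbl_allowed (hX' g)) (E.lbl_allowed (hY' g'))
            fun h => hn1 (E.lbl_inj h)]
          split_ifs with h
          · have hn2 := hn 0 (g' - g) (Nat.zero_le _) (by omega) fun h' => hXY ⟨h'.1, by omega⟩
            have h3 : ((W.lb X.ev X.len g).pos : ℕ) ≤ (W.lb Y.ev Y.len g').pos ∧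
                ((W.lb Y.ev Y.len g').len : ℕ) + (W.lb X.ev X.len g).pos ≤
                  (W.lb X.ev X.len g).len + (W.lb Y.ev Y.len g').pos := by
              rw [WeyrData.pos_lb hg, WeyrData.pos_lb hg']
              exact h
            have h4 := WeyrData.Shift.on_mk' (hX' g) (hY' g') hev hn1 h3
            rw [hne _ _ _ (E.lbl_allowed (hX' 0)) (E.lbl_allowed (hY' (g' - g)))
              fun h => hn2 (E.lbl_inj h), E.sum_toeplitz ξ h4, E.sum_toeplitz ξ (v :=
                WeyrData.Shift.mk' (hX' g) (hY' g') hev hn1 h3)]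
            refine ⟨hX' 0, hY' _, rfl, hev.symm, rfl, rfl, ?_⟩
            have h5 := h4.2.2.2.2.2.2
            rw [WeyrData.pos_lb hg, WeyrData.pos_lb hg'] at h5
            rw [WeyrData.pos_lb (Nat.zero_le _), WeyrData.pos_lb (by omega)]
            omega
          · refine E.sum_toeplitz_eq_zero ξ fun v hv => h ?_
            have := hv.le
            rwa [WeyrData.pos_lb hg, WeyrData.pos_lb hg'] at this
      by_cases hv : E.val x X.ev = E.val y Y.ev
      · rw [← hv]
        exact jordanEq_of_toeplitz hto hX.1 hY.1
      · -- the eigenvalue is a new parameter, and the block has size one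
        rcases hl : X.ev with i | b
        · rw [← hev, hl] at hv
          exact absurd rfl hv
        · have h1 := hone b X.len (hl ▸ hX.2)
          have h2 := hone b Y.len (hl ▸ hev ▸ hY.2)
          have h3 : (X.pos : ℕ) ≤ X.len := hX.1
          have h4 : (Y.pos : ℕ) ≤ Y.len := hY.1
          obtain rfl : X = Y := WeyrData.Label.ext hev (Fin.ext (by omega)) (by omega)
          rw [JordanEq, if_neg (by omega), if_neg (by omega), ← hl, E.tau_self t hX hX]
          have h0 : t (P.cls p) (E.lbl X) (E.lbl X) = 0 := by
            by_contra h0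
            refine hv ?_
            rw [hl]
            refine hnew (NewT.mk' p (E.lbl X) ha) (E.par b) ?_ h0
            exact (E.attached_inr_iff hρ hpq).2 ⟨X, b, hX, hl, rfl, rfl⟩
          rw [h0]; simp
    · have hz : ∀ g g', E.tau t X.ev Y.ev X.len Y.len g g' = 0 := by
        intro g g'
        have h1 : ∀ v : WeyrData.Shift W, ¬ v.On (W.lb X.ev X.len g) (W.lb Y.ev Y.len g') :=
          fun v hv => hev (hv.2.2.1.trans hv.2.2.2.1.symm)
        rw [hval, hne _ _ _ (E.lbl_allowed (WeyrData.valid_lb hX.2 _))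
          (E.lbl_allowed (WeyrData.valid_lb hY.2 _)), E.sum_toeplitz_eq_zero ξ h1]
        intro h
        have h' := congrArg WeyrData.Label.ev (E.lbl_inj h)
        exact hev h'
      simp [JordanEq, hz]

theorem existsUnique_attached_inr (E : LoopSplitting s (P.cls p) W)
    (hρ : P.IsFirst p q ρ) (hpq : P.cls q = P.cls p)
    (hone : ∀ b r, W.e (Sum.inr b) r ≠ 0 → (r : ℕ) = 0) (β : Fin s.β) :
    ∃! c, (induced s p q ρ D).Attached (Sum.inr β) c := by
  obtain ⟨b, rfl⟩ := E.par.surjective β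
  obtain ⟨r, hr⟩ := W.e_ne (Sum.inr b)
  have hX := WeyrData.valid_lb hr 0
  refine ⟨⟨_, NewT.mk' p (E.lbl (W.lb (Sum.inr b) r 0)) (E.lbl_allowed hX), rfl⟩,
    (E.attached_inr_iff hρ hpq).2 ⟨_, b, hX, rfl, rfl, rfl⟩, ?_⟩
  intro c hc
  obtain ⟨Y, b', hY, hev, hb, hY'⟩ := (E.attached_inr_iff hρ hpq).1 hc
  obtain rfl := E.par.injective hb
  refine Subtype.ext (hY'.symm.trans ((E.code_iff _ _).2 ⟨hev, Fin.ext ?_⟩))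
  rw [hone b' Y.len (hev ▸ hY.2)]
  exact (hone b' r hr).symm

theorem eq_of_attached_inr (E : LoopSplitting s (P.cls p) W) (hP : P.IsFreelyParameterized)
    (hρ : P.IsFirst p q ρ) (hpq : P.cls q = P.cls p)
    (htriv : Nonempty (Fin s.β) → P.Trivial (P.cls p)) {c : (induced s p q ρ D).V} {β : Fin s.β}
    {r : P.Par ⊕ Fin s.β} (h : (induced s p q ρ D).Attached (Sum.inr β) c)
    (h' : (induced s p q ρ D).Attached r c) : r = Sum.inr β := by
  obtain ⟨X, b, hX, hev, rfl, hc⟩ := (E.attached_inr_iff hρ hpq).1 h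
  rcases r with r | β'
  · obtain ⟨z, hz, h2⟩ := (attached_inl_iff hP E.vars_U).1 h'
    have h1 : P.cls z.idx = P.cls p :=
      (E.code_inj _ _ _ _ (E.lbl_allowed hX) z.allowed (hc.trans hz.symm)).symm
    exact absurd (h1 ▸ h2) (htriv ⟨E.par b⟩ r)
  · obtain ⟨X', b', hX', hev', rfl, hc'⟩ := (E.attached_inr_iff hρ hpq).1 h'
    have := ((E.code_iff X X').1 (hc.trans hc'.symm)).1
    rw [hev, hev'] at this
    rw [Sum.inr_injective this]

end LoopSplitting

open Classical in
/-- A loop reduction splits the indices as the name says. -/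
noncomputable def loopSplitting (n : P.V → ℕ) (I₀ : P.V) (W : WeyrData k) :
    LoopSplitting (Reduction.splitLoop n I₀ W : Reduction.Splitting k P.V P.Par) I₀ W where
  lbl X := (X : WithBot W.Label)
  lt X Y h := WithBot.coe_lt_coe.2 h
  par := Equiv.refl _
  allowed_iff a := by
    simp only [Reduction.splitLoop, if_true]
    exact exists_congr fun X => and_comm
  allowed_ne I a b hI ha hb := by
    simp only [Reduction.splitLoop, if_neg hI] at ha hb
    exact ha.trans hb.symm
  vars_U := fun (a : WithBot W.Label) (b : WithBot W.Label) c => by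
    rcases a with _ | X <;> rcases b with _ | Y
    iterate 3
      · simp only [Reduction.splitLoop, vars_0]
        exact Finset.notMem_empty _
    · simp only [Reduction.splitLoop]
      split_ifs
      · rcases X.ev with i | b
        · simp only [Sum.elim_inl, vars_C]
          exact Finset.notMem_empty _
        · simp only [Sum.elim_inr, vars_X]
          exact fun h => by cases Finset.mem_singleton.1 h
      · simp only [vars_one]
        exact Finset.notMem_empty _
      · simp only [vars_0]
        exact Finset.notMem_empty _
  U_self X := if_pos rfl
  U_next X Y h₁ h₂ h₃ := by
    have h : X ≠ Y := by rintro rfl; omega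
    exact (if_neg h).trans (if_pos ⟨h₁, h₂, h₃⟩)
  U_zero X Y h h' := (if_neg h).trans (if_neg h')
  code_iff X Y := by
    refine ⟨fun h => ?_, fun h => ?_⟩
    · exact Prod.ext_iff.1 (Sum.inr_injective h)
    · exact congrArg Sum.inr (Prod.ext h.1 h.2)
  code_inj I J a b ha hb hab := by
    simp only [Reduction.splitLoop] at ha hb hab
    by_cases hI : I = I₀ <;> by_cases hJ : J = I₀
    · rw [hI, hJ]
    · rw [if_pos hI] at ha
      rw [if_neg hJ] at hb
      obtain ⟨X, rfl, -⟩ := ha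
      subst hb
      cases hab
    · rw [if_neg hI] at ha
      rw [if_pos hJ] at hb
      obtain ⟨X, rfl, -⟩ := hb
      subst ha
      cases hab
    · rw [if_neg hI] at ha
      rw [if_neg hJ] at hb
      subst ha hb
      exact Sum.inl_injective hab

end ParamProblem

/-! ### Reductions after which the problem is freely parameterized -/

namespace WeyrData

variable {k : Type u} {W : WeyrData k}

theorem exists_valid (h : 0 < W.size) : ∃ X : W.Label, X.Valid := by
  obtain ⟨l, -, hl⟩ := Finset.exists_ne_zero_of_sum_ne_zero h.ne'
  obtain ⟨r, -, hr⟩ := Finset.exists_ne_zero_of_sum_ne_zero hl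
  exact ⟨W.lb l r 0, valid_lb (right_ne_zero_of_mul hr) 0⟩

theorem size_eq (W : WeyrData k) : W.size =
    ∑ v : (Fin W.α ⊕ Fin W.β) × Fin W.d, (v.2.val + 1) * W.e v.1 v.2 := by
  rw [size, Fintype.sum_prod_type]

theorem mul_le_size (l : Fin W.α ⊕ Fin W.β) (r : Fin W.d) : (r.val + 1) * W.e l r ≤ W.size := by
  rw [size_eq]
  exact Finset.single_le_sum (f := fun v : (Fin W.α ⊕ Fin W.β) × Fin W.d =>
    (v.2.val + 1) * W.e v.1 v.2) (fun _ _ => Nat.zero_le _) (Finset.mem_univ (l, r))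

theorem valid_unique (h : W.size = 1) {X Y : W.Label} (hX : X.Valid) (hY : Y.Valid) : X = Y := by
  classical
  have h0 : ∀ X : W.Label, X.Valid → (X.len : ℕ) = 0 := fun X hX => by
    have h1 := W.mul_le_size X.ev X.len
    have h2 := Nat.pos_of_ne_zero hX.2
    nlinarith
  have hX0 := h0 X hX
  have hY0 := h0 Y hY
  have hX1 : (X.pos : ℕ) ≤ X.len := hX.1
  have hY1 : (Y.pos : ℕ) ≤ Y.len := hY.1
  refine Label.ext ?_ (Fin.ext (by omega)) (by omega)
  by_contra hne
  have hsub : ∑ v ∈ {(X.ev, X.len), (Y.ev, Y.len)}, (v.2.val + 1) * W.e v.1 v.2 ≤ W.size := by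
    rw [size_eq]
    exact Finset.sum_le_sum_of_subset (Finset.subset_univ _)
  have hpair : (X.ev, X.len) ≠ (Y.ev, Y.len) := fun h => hne (Prod.ext_iff.1 h).1
  rw [Finset.sum_pair hpair, h] at hsub
  have h2 := Nat.pos_of_ne_zero hX.2
  have h3 := Nat.pos_of_ne_zero hY.2
  nlinarith

end WeyrData

namespace ParamProblem

variable {k : Type u} [Field k] {P : ParamProblem k} {n : P.V → ℕ} {p q : P.T}
  {ρ : Matrix P.T P.T k}

theorem splitEdge_pos_of_allowed {I₀ J₀ : P.V} {r : ℕ}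
    (h : (Reduction.splitEdge n I₀ J₀ r : Reduction.Splitting k P.V P.Par).allowed I₀
      (0 : Fin 2)) : 0 < r := by
  simpa [Reduction.splitEdge] using h

theorem splitEdge_allowed_of_pos {I₀ J₀ : P.V} {r : ℕ} (h : 0 < r) :
    (Reduction.splitEdge n I₀ J₀ r : Reduction.Splitting k P.V P.Par).allowed I₀ (0 : Fin 2) := by
  simpa [Reduction.splitEdge] using h

theorem isSize_induced (hP : P.IsFreelyParameterized) {s : Reduction.Splitting k P.V P.Par}
    {D : Set (P.Par ⊕ Fin s.β → k)} (hU : ∀ a b c, Sum.inl c ∉ (s.U a b).vars)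
    (hpos : ∀ I a, s.allowed I a → 0 < s.size (s.code I a))
    (hone : ∀ r I a, P.Attached r I → s.allowed I a → s.size (s.code I a) = 1)
    (hnew : ∀ β c, (induced s p q ρ D).Attached (Sum.inr β) c → s.size c.1 = 1) :
    (induced s p q ρ D).IsSize fun c => s.size c.1 := by
  constructor
  · rintro ⟨_, z, rfl⟩
    exact hpos _ _ z.allowed
  · rintro c (r | β) h
    · obtain ⟨z, hz, hr⟩ := (attached_inl_iff hP hU).1 h
      exact (congrArg s.size hz).symm.trans (hone r _ _ hr z.allowed)
    · exact hnew β c h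

/-- An edge reduction does not merge two parameters if its rank is `0` or one of the classes is
trivial. -/
theorem staysFree_edge [Infinite k] (hP : P.IsFreelyParameterized) (hn : P.IsSize n)
    (hρ : P.IsFirst p q ρ) {L : P.Layer} (hδ : ∀ w, P.delta L p q w = 0) {r : ℕ}
    (hne : P.cls p ≠ P.cls q) (h₁ : r ≤ n (P.cls p)) (h₂ : r ≤ n (P.cls q))
    (htriv : r = 0 ∨ P.Trivial (P.cls p) ∨ P.Trivial (P.cls q))
    {D : Set (P.Par ⊕ Fin (P.split n p q (Reduction.edge r)).β → k)}
    (hD : ∀ x ∈ D, x ∘ Sum.inl ∈ P.dom)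
    (hdom : ∃ g : P.Par ⊕ Fin (P.split n p q (Reduction.edge r)).β → Polynomial k,
      (∀ a, g a ≠ 0) ∧ D = domOf g) :
    P.StaysFree n p q ρ (Reduction.edge r) D := by
  let E : EdgeSplitting (P.split n p q (Reduction.edge r)) (P.cls p) (P.cls q) :=
    edgeSplitting n hne r
  have hsingle : ∀ (r' : P.Par) I a b, P.Attached r' I →
      (P.split n p q (Reduction.edge r)).allowed I a →
      (P.split n p q (Reduction.edge r)).allowed I b → a = b := fun r' I a b h ha hb =>
    splitEdge_allowed_unique (hn.2 I r' h) ha hb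
  have hfalse : ∀ r₁ r₂, P.Attached r₁ (P.cls p) → P.Attached r₂ (P.cls q) →
      (P.split n p q (Reduction.edge r)).allowed (P.cls p) E.a₀ → False := by
    intro r₁ r₂ h h' ha
    rcases htriv with h0 | h0 | h0
    · exact (splitEdge_pos_of_allowed ha).ne' h0
    · exact h0 _ h
    · exact h0 _ h'
  refine ⟨hD, fun x hx y hy => (implies_iff hP L p q (hD x hx) (hD y hy)).2 fun w => by
    rw [hδ, map_zero], ?_, ?_⟩
  · refine induced_free_of_frame hP hρ (KernelFrame.ofZero hδ) (E.splitFrame hP hsingle) E.vars_U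
      (fun a b _ _ => E.code_of_U_ne_zero) (Or.inl hδ) hD (fun _ _ => trivial) hdom
      (splitEdge_exists_allowed hn.1 hne h₁ h₂) hsingle ?_ (fun β => (E.isEmpty.false β).elim)
      (fun _ β => (E.isEmpty.false β).elim)
    intro r₁ r₂ I J a b h h' ha hb hab
    rcases E.code_inj I J a b ha hb hab with h0 | ⟨rfl, rfl, rfl, rfl⟩ | ⟨rfl, rfl, rfl, rfl⟩
    · exact h0.1
    · exact (hfalse _ _ h h' ha).elim
    · exact (hfalse _ _ h' h hb).elim
  · exact isSize_induced hP E.vars_U (fun I a => splitEdge_size_pos hn.1 hne)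
      (fun r' I a h ha => splitEdge_size_one hne h₁ h₂ (hn.2 I r' h) ha)
      fun β => (E.isEmpty.false β).elim

/-- The domain only has to keep a new parameter away from the fixed eigenvalues. -/
theorem staysFree_loop [Infinite k] (hP : P.IsFreelyParameterized) (hn : P.IsSize n)
    (hρ : P.IsFirst p q ρ) {L : P.Layer} (hδ : ∀ w, P.delta L p q w = 0) {W : WeyrData k}
    (hpq : P.cls p = P.cls q) (hsize : W.size = n (P.cls p))
    (hW : W.β = 0 ∨ W.IsAddParam ∧ P.Trivial (P.cls p))
    {D : Set (P.Par ⊕ Fin (P.split n p q (Reduction.loop W)).β → k)}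
    (hD : ∀ x ∈ D, x ∘ Sum.inl ∈ P.dom)
    (hdom : ∃ g : P.Par ⊕ Fin (P.split n p q (Reduction.loop W)).β → Polynomial k,
      (∀ a, g a ≠ 0) ∧ D = domOf g)
    (hval : ∀ x ∈ D, ∀ i b, x (Sum.inr b) ≠ W.c i) :
    P.StaysFree n p q ρ (Reduction.loop W) D := by
  let E : LoopSplitting (P.split n p q (Reduction.loop W)) (P.cls p) W := loopSplitting n _ W
  have hbot : ∀ I, I ≠ P.cls p → ∀ a, (P.split n p q (Reduction.loop W)).allowed I a →
      a = (⊥ : WithBot W.Label) := fun I hI a ha => by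
    simpa [split, Reduction.splitting, Reduction.splitLoop, hI] using ha
  have hsingle : ∀ (r : P.Par) I a b, P.Attached r I →
      (P.split n p q (Reduction.loop W)).allowed I a →
      (P.split n p q (Reduction.loop W)).allowed I b → a = b := by
    intro r I a b h ha hb
    by_cases hI : I = P.cls p
    · subst hI
      obtain ⟨X, hX, rfl⟩ := (E.allowed_iff a).1 ha
      obtain ⟨Y, hY, rfl⟩ := (E.allowed_iff b).1 hb
      rw [WeyrData.valid_unique (hsize.trans (hn.2 _ r h)) hX hY]
    · exact E.allowed_ne I a b hI ha hb
  have hinr : ∀ b r, W.e (Sum.inr b) r ≠ 0 → (r : ℕ) = 0 ∧ W.e (Sum.inr b) r = 1 := by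
    intro b r h
    rcases hW with hW | ⟨hW, -⟩
    · rw [hW] at b
      exact b.elim0
    · have := hW.2 b r
      split_ifs at this with h0
      · exact ⟨h0, this⟩
      · exact absurd this h
  have hone : ∀ b r, W.e (Sum.inr b) r ≠ 0 → (r : ℕ) = 0 := fun b r h => (hinr b r h).1
  have hval' : ∀ x ∈ D, ∀ y ∈ D, ∀ l l', l ≠ l' → E.val x l ≠ E.val y l' := by
    rintro x hx y hy (i | b) (j | b') hl
    · exact fun h => hl (congrArg _ (W.c_inj h))
    · exact (hval y hy i b').symm
    · exact hval x hx j b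
    · rcases hW with hW | ⟨hW, -⟩
      · rw [hW] at b
        exact b.elim0
      · have := hW.1
        exact absurd (congrArg Sum.inr (Fin.ext (by omega) : b = b')) hl
  refine ⟨hD, fun x hx y hy => (implies_iff hP L p q (hD x hx) (hD y hy)).2 fun w => by
    rw [hδ, map_zero], ?_, ?_⟩
  · refine induced_free_of_frame hP hρ (KernelFrame.ofZero hδ)
      (E.splitFrame hP hρ hpq.symm hsingle hone hval') E.vars_U
      (fun a b ha hb => ?_) (Or.inl hδ) hD (fun _ _ => trivial) hdom
      ?_ hsingle (fun _ _ I J a b _ _ => E.code_inj I J a b)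
      (E.existsUnique_attached_inr hρ hpq.symm hone)
      (fun c β r => E.eq_of_attached_inr hP hρ hpq.symm ?_)
    · rw [← hpq] at hb ⊢
      exact E.code_of_U_ne_zero ha hb
    · intro I
      by_cases hI : I = P.cls p
      · subst hI
        obtain ⟨X, hX⟩ := WeyrData.exists_valid (hsize ▸ hn.1 (P.cls p))
        exact ⟨_, E.lbl_allowed hX⟩
      · exact ⟨(⊥ : WithBot W.Label), by
          simp [split, Reduction.splitting, Reduction.splitLoop, hI]⟩
    · rintro ⟨b⟩
      rcases hW with hW | hW
      · have b' : Fin W.β := b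
        rw [hW] at b'
        exact b'.elim0
      · exact hW.2
  · refine isSize_induced hP E.vars_U ?_ ?_ ?_
    · intro I a ha
      by_cases hI : I = P.cls p
      · subst hI
        obtain ⟨X, hX, rfl⟩ := (E.allowed_iff a).1 ha
        exact Nat.pos_of_ne_zero hX.2
      · obtain rfl := hbot I hI a ha
        exact hn.1 I
    · intro r I a h ha
      have h1 := hn.2 I r h
      by_cases hI : I = P.cls p
      · subst hI
        obtain ⟨X, hX, rfl⟩ := (E.allowed_iff a).1 ha
        change W.e X.ev X.len = 1
        have h2 := W.mul_le_size X.ev X.len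
        have h3 := Nat.pos_of_ne_zero hX.2
        rw [hsize, h1] at h2
        nlinarith
      · obtain rfl := hbot I hI a ha
        exact h1
    · intro β c h
      obtain ⟨X, b, hX, hev, -, hc⟩ := (E.attached_inr_iff hρ hpq.symm).1 h
      rw [← hc]
      change W.e X.ev X.len = 1
      rw [hev]
      exact (hinr b X.len (hev ▸ hX.2)).2

/-- Regularization stays free where neither the common factor `f` nor the localizer `c` vanishes, as
there the kernel of the differential is free of corank one. -/
theorem staysFree_reg [Infinite k] (hP : P.IsFreelyParameterized) (hn : P.IsSize n)
    (hρ : P.IsFirst p q ρ) {L : P.Layer} {f : Polynomial (Polynomial k)}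
    {Q s : L.ι → Polynomial (Polynomial k)} {c : Polynomial k}
    (hf : ∀ w, P.toBi (P.cls p) (P.cls q) (P.delta L p q w) = f * Q w)
    (hs : ∑ w, s w * Q w = Polynomial.C c)
    {D : Set (P.Par ⊕ Fin (P.split n p q Reduction.reg).β → k)}
    (hD : ∀ x ∈ D, x ∘ Sum.inl ∈ P.dom)
    (hdom : ∃ g : P.Par ⊕ Fin (P.split n p q Reduction.reg).β → Polynomial k,
      (∀ a, g a ≠ 0) ∧ D = domOf g)
    (hval : ∀ x ∈ D, ∀ y ∈ D, f.evalEval (P.parVal (P.cls p) (x ∘ Sum.inl))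
      (P.parVal (P.cls q) (y ∘ Sum.inl)) ≠ 0 ∧ c.eval (P.parVal (P.cls p) (x ∘ Sum.inl)) ≠ 0) :
    P.StaysFree n p q ρ Reduction.reg D := by
  have hβ : IsEmpty (Fin (P.split n p q Reduction.reg).β) := inferInstanceAs (IsEmpty (Fin 0))
  have hU : ∀ a b, (P.split n p q Reduction.reg).U a b = 0 := fun _ _ => rfl
  have hU' : ∀ a b c, Sum.inl c ∉ ((P.split n p q Reduction.reg).U a b).vars := fun a b c => by
    rw [hU, vars_0]
    exact Finset.notMem_empty _
  have hlab : ∀ a b : (P.split n p q Reduction.reg).Lab, a = b :=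
    fun a b => show (a : Unit) = b from rfl
  have hcode : ∀ I J a b, (P.split n p q Reduction.reg).code I a =
    (P.split n p q Reduction.reg).code J b → I = J := fun _ _ _ _ h => h
  obtain ⟨x₀, hx₀⟩ : D.Nonempty := by
    obtain ⟨g, hg, rfl⟩ := hdom
    exact domOf_nonempty g hg
  obtain ⟨F⟩ := nonempty_kernelFrame hP L p q f Q s c hf hs ((fun x => x ∘ Sum.inl) '' D)
    ⟨_, x₀, hx₀, rfl⟩ (by
      rintro _ ⟨x, hx, rfl⟩ _ ⟨y, hy, rfl⟩
      exact hval x hx y hy)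
  refine ⟨hD, fun x hx y hy h => ?_, ?_, ?_⟩
  · have h0 := (implies_iff hP L p q (hD x hx) (hD y hy)).1 h
    have h1 := congrArg (Polynomial.evalEval (P.parVal (P.cls p) (x ∘ Sum.inl))
      (P.parVal (P.cls q) (y ∘ Sum.inl))) hs
    rw [Polynomial.evalEval_finsetSum, Polynomial.evalEval_C, Finset.sum_eq_zero] at h1
    · exact (hval x hx y hy).2 h1.symm
    · intro w _
      have h2 := h0 w
      rw [eval_delta_bi hP, hf, Polynomial.evalEval_mul] at h2
      rw [Polynomial.evalEval_mul, (mul_eq_zero.1 h2).resolve_left (hval x hx y hy).1, mul_zero]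
  · exact induced_free_of_frame hP hρ F (SplitFrame.ofRegular hP hlab hcode hU hβ) hU'
      (fun a b _ _ h => absurd (hU a b) h) (Or.inr hU) hD (fun x hx => ⟨x, hx, rfl⟩) hdom
      (fun _ => ⟨(() : Unit), trivial⟩) (fun _ _ a b _ _ _ => hlab a b)
      (fun _ _ I J a b _ _ _ _ => hcode I J a b) (fun β => (hβ.false β).elim)
      (fun _ β => (hβ.false β).elim)
  · exact isSize_induced hP hU' (fun I _ _ => hn.1 I) (fun r I _ h _ => hn.2 I r h)
      fun β => (hβ.false β).elim

end ParamProblem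

namespace ParamProblem

variable {k : Type u} [Field k] {P : ParamProblem k} {n : P.V → ℕ} {p q : P.T}
  {ρ : Matrix P.T P.T k}

theorem toBi_eq_mul_of_eq_mul {I J : P.V} {ι : Type*} [Fintype ι]
    {F Q s : ι → MvPolynomial (P.Par ⊕ P.Par) k} {f c : MvPolynomial (P.Par ⊕ P.Par) k}
    (hf : ∀ w, F w = f * Q w) (hs : c = ∑ w, s w * Q w) :
    (∀ w, P.toBi I J (F w) = P.toBi I J f * P.toBi I J (Q w)) ∧
      ∑ w, P.toBi I J (s w) * P.toBi I J (Q w) = P.toBi I J c := by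
  refine ⟨fun w => by rw [hf, map_mul], ?_⟩
  rw [hs, map_sum]
  exact Finset.sum_congr rfl fun w _ => (map_mul _ _ _).symm

theorem parVar_of_trivial {I : P.V} (h : P.Trivial I) (f : P.Par → P.Par ⊕ P.Par) :
    P.parVar I f = 0 := dif_neg fun ⟨a, ha⟩ => h a ha

theorem exists_eq_leftPoly (hP : P.IsFreelyParameterized) {I J : P.V} {a : P.Par}
    (hI : P.Attached a I) (hJ : P.Trivial J) {φ : MvPolynomial (P.Par ⊕ P.Par) k}
    (hφ : ∀ b ∈ φ.vars, b ∈ P.sideVars I J) : ∃ f : Polynomial k, φ = leftPoly a f := by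
  refine ⟨(P.toBi I J φ).coeff 0, ?_⟩
  rw [← ofBi_C_eq hP hI (J := J)]
  conv_lhs => rw [← ofBi_toBi hP hφ]
  simp only [ofBi, parVar_of_trivial hJ, Polynomial.coe_eval₂RingHom, Polynomial.eval₂_at_zero,
    Polynomial.eval₂_C]

theorem exists_eq_rightPoly (hP : P.IsFreelyParameterized) {I J : P.V} {a : P.Par}
    (hI : P.Trivial I) (hJ : P.Attached a J) {φ : MvPolynomial (P.Par ⊕ P.Par) k}
    (hφ : ∀ b ∈ φ.vars, b ∈ P.sideVars I J) : ∃ f : Polynomial k, φ = rightPoly a f := by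
  refine ⟨(P.toBi I J φ).map (Polynomial.evalRingHom 0), ?_⟩
  rw [← ofBi_map_C_eq hP hJ (I := I)]
  conv_lhs => rw [← ofBi_toBi hP hφ]
  have h : (Polynomial.eval₂RingHom (C : k →+* MvPolynomial (P.Par ⊕ P.Par) k) 0).comp
      (Polynomial.C.comp (Polynomial.evalRingHom 0)) =
      Polynomial.eval₂RingHom (C : k →+* MvPolynomial (P.Par ⊕ P.Par) k) 0 := by
    ext <;> simp
  rw [Polynomial.map_map, ofBi, parVar_of_trivial hI, Polynomial.coe_eval₂RingHom,
    Polynomial.eval₂_map, h]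

theorem exists_eq_C {I J : P.V} (hI : P.Trivial I) (hJ : P.Trivial J)
    {φ : MvPolynomial (P.Par ⊕ P.Par) k} (hφ : ∀ b ∈ φ.vars, b ∈ P.sideVars I J) :
    ∃ r : k, φ = C r := by
  refine ⟨φ.coeff 0, vars_eq_empty_iff_eq_C.1 (Finset.eq_empty_of_forall_notMem fun b hb => ?_)⟩
  have h := hφ b hb
  rcases b with b | b
  · exact hI b h
  · exact hJ b h

/-- Polynomials in one of the variables have the same divisors among each other as in one variable.
-/
theorem dvd_of_aeval_X_dvd {A : Type*} {v : A} {f h : Polynomial k}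
    (hd : Polynomial.aeval (MvPolynomial.X v : MvPolynomial A k) f ∣
      Polynomial.aeval (MvPolynomial.X v : MvPolynomial A k) h) : f ∣ h := by
  have key : ∀ f : Polynomial k, MvPolynomial.aeval (fun _ : A => (Polynomial.X : Polynomial k))
      (Polynomial.aeval (MvPolynomial.X v : MvPolynomial A k) f) = f := fun f => by
    rw [← Polynomial.aeval_algHom_apply, aeval_X, Polynomial.aeval_X_left_apply]
  have := map_dvd (MvPolynomial.aeval (fun _ : A => (Polynomial.X : Polynomial k))) hd
  rwa [key, key] at this

/-- Over a principal ideal domain a highest common factor is a combination. -/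
theorem exists_combination_of_hcf {R ι : Type*} [CommRing R] [IsDomain R] [IsPrincipalIdealRing R]
    [Fintype ι] (F : ι → R) : ∃ f, ∃ Q s : ι → R, (∀ w, F w = f * Q w) ∧ ∑ w, s w * F w = f := by
  obtain ⟨f, hf⟩ := IsPrincipalIdealRing.principal (Ideal.span (Set.range F))
  have h1 : ∀ w, f ∣ F w := fun w => by
    rw [← Ideal.mem_span_singleton]
    have : F w ∈ Ideal.span (Set.range F) := Ideal.subset_span ⟨w, rfl⟩
    rw [hf] at this
    exact this
  choose Q hQ using h1
  have h2 : f ∈ Ideal.span (Set.range F) := by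
    rw [hf]
    exact Ideal.mem_span_singleton_self f
  obtain ⟨s, hs⟩ := (Ideal.mem_span_range_iff_exists_fun (R := R)).1 h2
  exact ⟨f, Q, s, hQ, hs⟩

/-- In one variable the quotients by the highest common factor are unimodular. -/
theorem IsHCF.exists_unimodular {A ι : Type} [Fintype ι] {v : A} {f : Polynomial k}
    {F : ι → Polynomial k} {Φ : ι → MvPolynomial A k}
    (hΦ : ∀ w, Φ w = Polynomial.aeval (MvPolynomial.X v : MvPolynomial A k) (F w))
    (hf : IsHCF (Polynomial.aeval (MvPolynomial.X v : MvPolynomial A k) f) Φ) (hf0 : f ≠ 0) :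
    ∃ Q s : ι → Polynomial k, (∀ w, F w = f * Q w) ∧ ∑ w, s w * Q w = 1 := by
  have h1 : ∀ w, f ∣ F w := fun w => dvd_of_aeval_X_dvd (v := v) (by rw [← hΦ]; exact hf.1 w)
  choose Q hQ using h1
  obtain ⟨f₀, Q₀, s, hQ₀, hs⟩ := exists_combination_of_hcf F
  obtain ⟨e, rfl⟩ : f₀ ∣ f := dvd_of_aeval_X_dvd (v := v) (hf.2 _ fun w => by
    rw [hΦ, hQ₀, map_mul]
    exact dvd_mul_right _ _)
  refine ⟨Q, fun w => e * s w, hQ, mul_left_cancel₀ (left_ne_zero_of_mul hf0) ?_⟩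
  rw [mul_one, Finset.mul_sum]
  conv_rhs => rw [← hs]
  exact Finset.sum_congr rfl fun w _ => by rw [hQ w]; ring

theorem domOf_elim_subset {A : Type} {β : ℕ} {g gN : A → Polynomial k} {gNew : ℕ → Polynomial k}
    (h : ∀ a, g a ∣ gN a) :
    ∀ x ∈ domOf (Sum.elim gN fun b : Fin β => gNew b.val), x ∘ Sum.inl ∈ domOf g := by
  intro x hx a h0
  obtain ⟨e, he⟩ := h a
  refine hx (Sum.inl a) ?_
  rw [Sum.elim_inl, he, Polynomial.eval_mul]
  exact mul_eq_zero_of_left h0 _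

theorem exists_domOf_elim {A : Type} {β : ℕ} {gN : A → Polynomial k} {gNew : ℕ → Polynomial k}
    (h : ∀ a, gN a ≠ 0) (h' : ∀ b : Fin β, gNew b.val ≠ 0) :
    ∃ g : A ⊕ Fin β → Polynomial k, (∀ a, g a ≠ 0) ∧
      domOf (Sum.elim gN fun b : Fin β => gNew b.val) = domOf g :=
  ⟨_, by rintro (a | b); exacts [h a, h' b], rfl⟩

theorem staysFree_of_listedA1 [Infinite k] (hP : P.IsFreelyParameterized) (hn : P.IsSize n)
    (hρ : P.IsFirst p q ρ) {g : P.Par → Polynomial k} (hg : ∀ a, g a ≠ 0) (hdom : P.dom = domOf g)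
    (L : P.Layer) {R : Reduction k} (hR : R.Fits n (P.cls p) (P.cls q))
    {gN : P.Par → Polynomial k} {gNew : ℕ → Polynomial k} {lam mu : P.Par}
    (hlam : P.Attached lam (P.cls p)) (hmu : P.Attached mu (P.cls q))
    (h : P.ListedA1 L p q g R gN lam mu) :
    P.StaysFree n p q ρ R (domOf (Sum.elim gN fun b => gNew b.val)) := by
  rcases h with ⟨hδ, rfl, ⟨hpq, W, c₀, rfl, hW⟩ | ⟨hpq, rfl⟩⟩ |
    ⟨⟨w₀, hw₀⟩, rfl, fP, fQ, c, hF, ⟨hc, Q, s, hQ, hs⟩, hother, hgN⟩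
  · have hD := domOf_elim_subset (β := W.β) (g := gN) (gN := gN) (gNew := gNew) fun a => dvd_rfl
    rw [← hdom] at hD
    have hβ : IsEmpty (Fin W.β) := by rw [hW.2.1]; infer_instance
    exact staysFree_loop hP hn hρ hδ hpq hR.2 (Or.inl hW.2.1) hD
      (exists_domOf_elim hg fun b : Fin W.β => hβ.elim b) fun x _ i b => hβ.elim b
  · have hD := domOf_elim_subset (β := 0) (g := gN) (gN := gN) (gNew := gNew) fun a => dvd_rfl
    rw [← hdom] at hD
    exact staysFree_edge hP hn hρ hδ hpq hR.2.1 hR.2.2 (Or.inl rfl) hD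
      (exists_domOf_elim hg fun b : Fin 0 => b.elim0)
  · have hf0 : leftPoly lam fP * rightPoly mu fQ ≠ 0 := fun h0 => hw₀ (by
      rw [hQ, h0, zero_mul])
    have hfP : fP ≠ 0 := fun h0 => hf0 (by rw [h0, leftPoly, map_zero, zero_mul])
    have hfQ : fQ ≠ 0 := fun h0 => hf0 (by rw [h0, rightPoly, map_zero, mul_zero])
    obtain ⟨hQ', hs'⟩ := toBi_eq_mul_of_eq_mul (P := P) (I := P.cls p) (J := P.cls q) hQ hs
    have hbi : P.toBi (P.cls p) (P.cls q) (leftPoly lam fP * rightPoly mu fQ) =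
        Polynomial.C fP * fQ.map Polynomial.C := by
      rw [map_mul, toBi_leftPoly hlam, toBi_rightPoly hmu]
    rw [hbi] at hQ'
    rw [toBi_leftPoly hlam] at hs'
    -- what is needed of the new localizing polynomials
    have hdiv : (∀ a, g a ∣ gN a) ∧ (∀ a, gN a ≠ 0) ∧ c ∣ gN lam ∧ fP ∣ gN lam ∧ fQ ∣ gN mu := by
      rcases hgN with ⟨hpq, h1⟩ | ⟨hpq, h1, h2⟩
      · obtain rfl : mu = lam := hP.att_subsingleton _ _ _ hmu (hpq ▸ hlam)
        refine ⟨fun a => ?_, fun a => ?_, ?_, ?_, ?_⟩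
        · by_cases ha : a = mu
          · subst ha; rw [h1, mul_assoc, mul_assoc]; exact dvd_mul_right _ _
          · rw [hother a ha ha]
        · by_cases ha : a = mu
          · subst ha; rw [h1]
            exact mul_ne_zero (mul_ne_zero (mul_ne_zero (hg _) hc) hfP) hfQ
          · rw [hother a ha ha]; exact hg a
        · exact ⟨g mu * fP * fQ, by rw [h1]; ring⟩
        · exact ⟨g mu * c * fQ, by rw [h1]; ring⟩
        · exact ⟨g mu * c * fP, by rw [h1]; ring⟩
      · have hne : lam ≠ mu := by
          rintro rfl
          exact hpq ((hP.att_unique lam).unique hlam hmu)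
        refine ⟨fun a => ?_, fun a => ?_, ?_, ?_, ?_⟩
        · by_cases ha : a = lam
          · subst ha; rw [h1, mul_assoc]; exact dvd_mul_right _ _
          · by_cases ha' : a = mu
            · subst ha'; rw [h2]; exact dvd_mul_right _ _
            · rw [hother a ha ha']
        · by_cases ha : a = lam
          · subst ha; rw [h1]; exact mul_ne_zero (mul_ne_zero (hg _) hc) hfP
          · by_cases ha' : a = mu
            · subst ha'; rw [h2]; exact mul_ne_zero (hg _) hfQ
            · rw [hother a ha ha']; exact hg a
        · exact ⟨g lam * fP, by rw [h1]; ring⟩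
        · exact ⟨g lam * c, by rw [h1]; ring⟩
        · exact ⟨g mu, by rw [h2]; ring⟩
    have hD := domOf_elim_subset (β := 0) (gNew := gNew) hdiv.1
    rw [← hdom] at hD
    refine staysFree_reg hP hn hρ hQ' hs' hD
      (exists_domOf_elim hdiv.2.1 fun b : Fin 0 => b.elim0) fun x hx y hy => ?_
    rw [parVal_eq hP hlam, parVal_eq hP hmu, Polynomial.evalEval_mul, Polynomial.evalEval_C,
      Polynomial.evalEval_map_C]
    have hroot : ∀ {e : Polynomial k} {a : P.Par} {x : P.Par ⊕ Fin 0 → k}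
        (_ : x ∈ domOf (Sum.elim gN fun b : Fin 0 => gNew b.val)), e ∣ gN a →
        e.eval (x (Sum.inl a)) ≠ 0 := by
      rintro e a x hx ⟨d, hd⟩ h0
      refine hx (Sum.inl a) ?_
      rw [Sum.elim_inl, hd, Polynomial.eval_mul, h0, zero_mul]
    exact ⟨mul_ne_zero (hroot hx hdiv.2.2.2.1) (hroot hy hdiv.2.2.2.2), hroot hx hdiv.2.2.1⟩

theorem staysFree_of_listedA2 [Infinite k] (hP : P.IsFreelyParameterized) (hn : P.IsSize n)
    (hρ : P.IsFirst p q ρ) {g : P.Par → Polynomial k} (hg : ∀ a, g a ≠ 0) (hdom : P.dom = domOf g)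
    (L : P.Layer) {R : Reduction k} (hR : R.Fits n (P.cls p) (P.cls q))
    {gN : P.Par → Polynomial k} {gNew : ℕ → Polynomial k} {lam : P.Par}
    (hlam : P.Attached lam (P.cls p)) (htriv : P.Trivial (P.cls q))
    (h : P.ListedA2 L p q g R gN lam) :
    P.StaysFree n p q ρ R (domOf (Sum.elim gN fun b => gNew b.val)) := by
  rcases h with ⟨hδ, rfl, hedge⟩ | ⟨⟨w₀, hw₀⟩, rfl, f, hF, hother, hgN⟩
  · have hD := domOf_elim_subset (β := 0) (g := gN) (gN := gN) (gNew := gNew) fun a => dvd_rfl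
    rw [← hdom] at hD
    rcases hedge with rfl | rfl
    all_goals
      exact staysFree_edge hP hn hρ hδ hR.1 hR.2.1 hR.2.2 (Or.inr (Or.inr htriv)) hD
        (exists_domOf_elim hg fun b : Fin 0 => b.elim0)
  · have hf0 : f ≠ 0 := by
      rintro rfl
      have h1 := hF.1 w₀
      rw [leftPoly, map_zero, zero_dvd_iff] at h1
      exact hw₀ h1
    choose F hδ using fun w => exists_eq_leftPoly hP hlam htriv (vars_delta_sideVars hP L p q w)
    obtain ⟨Q, s, hQ, hs⟩ := hF.exists_unimodular hδ hf0
    have hdvd : ∀ a, g a ∣ gN a := fun a => by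
      by_cases ha : a = lam
      · rw [ha, hgN]; exact dvd_mul_right _ _
      · rw [hother a ha]
    have hne : ∀ a, gN a ≠ 0 := fun a => by
      by_cases ha : a = lam
      · rw [ha, hgN]; exact mul_ne_zero (hg _) hf0
      · rw [hother a ha]; exact hg a
    have hD := domOf_elim_subset (β := 0) (gNew := gNew) hdvd
    rw [← hdom] at hD
    refine staysFree_reg hP hn hρ (f := Polynomial.C f) (Q := fun w => Polynomial.C (Q w))
      (s := fun w => Polynomial.C (s w)) (c := 1) (fun w => ?_) ?_ hD
      (exists_domOf_elim hne fun b : Fin 0 => b.elim0) fun x hx y hy => ⟨?_, ?_⟩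
    · rw [hδ, toBi_leftPoly hlam, hQ, Polynomial.C_mul]
    · rw [← hs, map_sum]
      exact Finset.sum_congr rfl fun w _ => (Polynomial.C_mul).symm
    · rw [Polynomial.evalEval_C, parVal_eq hP hlam]
      intro h0
      refine hx (Sum.inl lam) ?_
      rw [Sum.elim_inl, hgN, Polynomial.eval_mul]
      exact mul_eq_zero_of_right _ h0
    · rw [Polynomial.eval_one]; exact one_ne_zero

theorem staysFree_of_listedA2Dual [Infinite k] (hP : P.IsFreelyParameterized) (hn : P.IsSize n)
    (hρ : P.IsFirst p q ρ) {g : P.Par → Polynomial k} (hg : ∀ a, g a ≠ 0) (hdom : P.dom = domOf g)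
    (L : P.Layer) {R : Reduction k} (hR : R.Fits n (P.cls p) (P.cls q))
    {gN : P.Par → Polynomial k} {gNew : ℕ → Polynomial k} {mu : P.Par}
    (htriv : P.Trivial (P.cls p)) (hmu : P.Attached mu (P.cls q))
    (h : P.ListedA2Dual L p q g R gN mu) :
    P.StaysFree n p q ρ R (domOf (Sum.elim gN fun b => gNew b.val)) := by
  rcases h with ⟨hδ, rfl, hedge⟩ | ⟨⟨w₀, hw₀⟩, rfl, f, hF, hother, hgN⟩
  · have hD := domOf_elim_subset (β := 0) (g := gN) (gN := gN) (gNew := gNew) fun a => dvd_rfl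
    rw [← hdom] at hD
    rcases hedge with rfl | rfl
    all_goals
      exact staysFree_edge hP hn hρ hδ hR.1 hR.2.1 hR.2.2 (Or.inr (Or.inl htriv)) hD
        (exists_domOf_elim hg fun b : Fin 0 => b.elim0)
  · have hf0 : f ≠ 0 := by
      rintro rfl
      have h1 := hF.1 w₀
      rw [rightPoly, map_zero, zero_dvd_iff] at h1
      exact hw₀ h1
    choose F hδ using fun w => exists_eq_rightPoly hP htriv hmu (vars_delta_sideVars hP L p q w)
    obtain ⟨Q, s, hQ, hs⟩ := hF.exists_unimodular hδ hf0
    have hdvd : ∀ a, g a ∣ gN a := fun a => by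
      by_cases ha : a = mu
      · rw [ha, hgN]; exact dvd_mul_right _ _
      · rw [hother a ha]
    have hne : ∀ a, gN a ≠ 0 := fun a => by
      by_cases ha : a = mu
      · rw [ha, hgN]; exact mul_ne_zero (hg _) hf0
      · rw [hother a ha]; exact hg a
    have hD := domOf_elim_subset (β := 0) (gNew := gNew) hdvd
    rw [← hdom] at hD
    refine staysFree_reg hP hn hρ (f := f.map Polynomial.C) (Q := fun w => (Q w).map Polynomial.C)
      (s := fun w => (s w).map Polynomial.C) (c := 1) (fun w => ?_) ?_ hD
      (exists_domOf_elim hne fun b : Fin 0 => b.elim0) fun x hx y hy => ⟨?_, ?_⟩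
    · rw [hδ, toBi_rightPoly hmu, hQ, Polynomial.map_mul]
    · rw [map_one, ← Polynomial.map_one Polynomial.C, ← hs, Polynomial.map_sum]
      exact Finset.sum_congr rfl fun w _ => (Polynomial.map_mul _).symm
    · rw [Polynomial.evalEval_map_C, parVal_eq hP hmu]
      intro h0
      refine hy (Sum.inl mu) ?_
      rw [Sum.elim_inl, hgN, Polynomial.eval_mul]
      exact mul_eq_zero_of_right _ h0
    · rw [Polynomial.eval_one]; exact one_ne_zero

theorem staysFree_of_listedA3 [Infinite k] (hP : P.IsFreelyParameterized) (hn : P.IsSize n)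
    (hρ : P.IsFirst p q ρ) {g : P.Par → Polynomial k} (hg : ∀ a, g a ≠ 0) (hdom : P.dom = domOf g)
    (L : P.Layer) {R : Reduction k} (hR : R.Fits n (P.cls p) (P.cls q))
    {gN : P.Par → Polynomial k} {gNew : ℕ → Polynomial k}
    (hp : P.Trivial (P.cls p)) (hq : P.Trivial (P.cls q))
    (h : P.ListedA3 L p q g R gN gNew) :
    P.StaysFree n p q ρ R (domOf (Sum.elim gN fun b => gNew b.val)) := by
  have hD : ∀ {β : ℕ}, ∀ x ∈ domOf (Sum.elim g fun b : Fin β => gNew b.val), x ∘ Sum.inl ∈ P.dom :=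
    fun {β} => hdom ▸ domOf_elim_subset (β := β) (g := g) (gN := g) (gNew := gNew) fun a => dvd_rfl
  obtain ⟨rfl, ⟨hδ, ⟨hpq, W, rfl, hW⟩ | ⟨hpq, r, rfl⟩⟩ | ⟨⟨w₀, hw₀⟩, rfl⟩ |
    ⟨hδ, hpq, W, rfl, hW, hnew⟩⟩ := h
  · have hβ : IsEmpty (Fin W.β) := by rw [hW]; infer_instance
    exact staysFree_loop hP hn hρ hδ hpq hR.2 (Or.inl hW) hD
      (exists_domOf_elim hg fun b : Fin W.β => hβ.elim b) fun x _ i b => hβ.elim b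
  · exact staysFree_edge hP hn hρ hδ hpq hR.2.1 hR.2.2 (Or.inr (Or.inl hp)) hD
      (exists_domOf_elim hg fun b : Fin 0 => b.elim0)
  · classical
    choose r hδ using fun w => exists_eq_C hp hq (vars_delta_sideVars hP L p q w)
    have hr : r w₀ ≠ 0 := fun h0 => hw₀ (by rw [hδ, h0, C_0])
    refine staysFree_reg hP hn hρ (f := 1)
      (Q := fun w => P.toBi (P.cls p) (P.cls q) (P.delta L p q w))
      (s := fun w => if w = w₀ then Polynomial.C (Polynomial.C (r w₀)⁻¹) else 0) (c := 1)
      (fun w => (one_mul _).symm) ?_ hD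
      (exists_domOf_elim hg fun b : Fin 0 => b.elim0) fun x hx y hy => ⟨?_, ?_⟩
    · simp only [ite_mul, zero_mul, Finset.sum_ite_eq', Finset.mem_univ, if_true, hδ]
      simp only [toBi, coe_eval₂Hom, eval₂_C, RingHom.comp_apply]
      rw [← Polynomial.C_mul, ← Polynomial.C_mul, inv_mul_cancel₀ hr, Polynomial.C_1]
    · rw [Polynomial.evalEval_one]; exact one_ne_zero
    · rw [Polynomial.eval_one]; exact one_ne_zero
  · have hβ : ∀ b : Fin W.β, gNew b.val = ∏ i, (Polynomial.X - Polynomial.C (W.c i)) := fun b => by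
      have := hW.1
      rw [show b.val = 0 by omega, hnew]
    refine staysFree_loop hP hn hρ hδ hpq hR.2 (Or.inr ⟨hW, hp⟩) hD
      (exists_domOf_elim hg fun b : Fin W.β => ?_) fun x hx i b h0 => hx (Sum.inr b) ?_
    · rw [hβ]
      exact Finset.prod_ne_zero_iff.2 fun i _ => Polynomial.X_sub_C_ne_zero _
    · refine (congrArg (Polynomial.eval (x (Sum.inr b))) (hβ b)).trans ?_
      rw [Polynomial.eval_prod]
      exact Finset.prod_eq_zero (Finset.mem_univ i) (by simp [h0])

theorem staysFree_of_listed [Infinite k] (hP : P.IsFreelyParameterized) (hn : P.IsSize n)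
    (hρ : P.IsFirst p q ρ) {g : P.Par → Polynomial k} (hg : ∀ a, g a ≠ 0) (hdom : P.dom = domOf g)
    (L : P.Layer) {R : Reduction k} (hR : R.Fits n (P.cls p) (P.cls q))
    {gN : P.Par → Polynomial k} {gNew : ℕ → Polynomial k}
    (h : P.Listed L p q g R gN gNew) :
    P.StaysFree n p q ρ R (domOf (Sum.elim gN fun b => gNew b.val)) := by
  rcases h with ⟨lam, mu, h1, h2, h⟩ | ⟨lam, h1, h2, h⟩ | ⟨mu, h1, h2, h⟩ | ⟨h1, h2, h⟩
  · exact staysFree_of_listedA1 hP hn hρ hg hdom L hR h1 h2 h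
  · exact staysFree_of_listedA2 hP hn hρ hg hdom L hR h1 h2 h
  · exact staysFree_of_listedA2Dual hP hn hρ hg hdom L hR h1 h2 h
  · exact staysFree_of_listedA3 hP hn hρ hg hdom L hR h1 h2 h

end ParamProblem

namespace ParamProblem

variable {k : Type u} [Field k] {P : ParamProblem k} {s : Reduction.Splitting k P.V P.Par}
  {p q : P.T} {ρ : Matrix P.T P.T k} {D : Set (P.Par ⊕ Fin s.β → k)}

/-! ### The dimension of the radical -/

/-- The radical of `𝒦`: the matrices with zero diagonal. -/
def radical (P : ParamProblem k) (x y : P.Par → k) : Submodule k (Matrix P.T P.T k) where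
  carrier := {S | S ∈ P.K x y ∧ ∀ i, S i i = 0}
  zero_mem' := ⟨Submodule.zero_mem _, fun _ => rfl⟩
  add_mem' := fun h h' => ⟨Submodule.add_mem _ h.1 h'.1, fun i => by
    rw [Matrix.add_apply, h.2, h'.2, add_zero]⟩
  smul_mem' := fun c _ h => ⟨Submodule.smul_mem _ c h.1, fun i => by
    rw [Matrix.smul_apply, h.2, smul_zero]⟩

theorem Layer.radical_eq (L : P.Layer) {x y : P.Par → k} (hx : x ∈ P.dom) (hy : y ∈ P.dom) :
    P.radical x y = Submodule.span k (Set.range fun w => L.zeta w x y) := by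
  refine le_antisymm ?_ ?_
  · rintro S ⟨hS, hd⟩
    obtain ⟨t, c, -, rfl⟩ := (L.mem_iff' hx hy).1 hS
    have ht : Matrix.diagonal (fun i => t (P.cls i)) = (0 : Matrix P.T P.T k) := by
      ext i j
      by_cases hij : i = j
      · subst hij
        have := hd i
        rw [Matrix.add_apply, L.sum_zeta_diag, add_zero] at this
        exact this
      · rw [Matrix.diagonal_apply_ne _ hij]; rfl
    rw [ht, zero_add]
    exact Submodule.sum_mem _ fun w _ => Submodule.smul_mem _ _ (Submodule.subset_span ⟨w, rfl⟩)
  · rw [Submodule.span_le]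
    rintro _ ⟨w, rfl⟩
    exact ⟨L.zeta_mem hx hy w, L.zeta_diag w x y⟩

/-- The radical has the same dimension at all values of the parameters. -/
theorem Layer.finrank_radical (L : P.Layer) {x y : P.Par → k} (hx : x ∈ P.dom) (hy : y ∈ P.dom) :
    Module.finrank k (P.radical x y) = Fintype.card L.ι := by
  rw [L.radical_eq hx hy]
  exact finrank_span_eq_card (L.indep x hx y hy)

theorem Layer.radical_eq_of_le (L : P.Layer) {x y x' y' : P.Par → k} (hx : x ∈ P.dom)
    (hy : y ∈ P.dom) (hx' : x' ∈ P.dom) (hy' : y' ∈ P.dom)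
    (h : P.radical x y ≤ P.radical x' y') : P.radical x y = P.radical x' y' :=
  Submodule.eq_of_le_of_finrank_eq h (by
    rw [L.finrank_radical hx hy, L.finrank_radical hx' hy'])

theorem exists_generic [Infinite k] {A : Type} {β : ℕ} (g : A ⊕ Fin β → Polynomial k)
    (hg : ∀ a, g a ≠ 0) (v : Finset k) : ∃ x ∈ domOf g, ∀ b, x (Sum.inr b) ∉ v := by
  obtain ⟨x, hx⟩ := domOf_nonempty
    (fun a => g a * ∏ i ∈ v, (Polynomial.X - Polynomial.C i)) fun a => mul_ne_zero (hg a)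
      (Finset.prod_ne_zero_iff.2 fun i _ => Polynomial.X_sub_C_ne_zero _)
  have hx' : ∀ a, (g a).eval (x a) * ∏ i ∈ v, (x a - i) ≠ 0 := fun a => by
    have := hx a
    rw [Polynomial.eval_mul, Polynomial.eval_prod] at this
    simpa using this
  refine ⟨x, fun a => left_ne_zero_of_mul (hx' a), fun b hb => ?_⟩
  exact Finset.prod_ne_zero_iff.1 (right_ne_zero_of_mul (hx' (Sum.inr b))) _ hb (sub_self _)

namespace LoopSplitting

variable {W : WeyrData k}

/-- If new parameters `ν₁` and `ν₂` were the eigenvalues of two blocks, or of one block of size at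
least two, then the radical would become larger where the left value of `ν₁` is the right value of
`ν₂`: it would contain the matrix with the only entry `1` at the first row of the first and the
last column of the second block. -/
theorem not_isFreelyParameterized [Infinite k] (E : LoopSplitting s (P.cls p) W)
    (hP : P.IsFreelyParameterized) (hρ : P.IsFirst p q ρ) (hpq : P.cls q = P.cls p)
    (htriv : P.Trivial (P.cls p)) {L : P.Layer} (hδ : ∀ w, P.delta L p q w = 0)
    (hD : ∀ x ∈ D, x ∘ Sum.inl ∈ P.dom)
    {X Y : W.Label} (hX : X.Valid) (hY : Y.Valid) (hXY : X ≠ Y) (hX0 : (X.pos : ℕ) = 0)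
    (hY0 : Y.pos = Y.len) {ν₁ ν₂ : Fin W.β} (hν₁ : X.ev = Sum.inr ν₁) (hν₂ : Y.ev = Sum.inr ν₂) :
    ¬ (induced s p q ρ D).IsFreelyParameterized := by
  classical
  intro hfree
  obtain ⟨L'⟩ := hfree.layer
  obtain ⟨g, hg, hDg⟩ : ∃ g : P.Par ⊕ Fin s.β → Polynomial k, (∀ a, g a ≠ 0) ∧ D = domOf g :=
    hfree.dom_eq
  -- values at which all eigenvalues are different
  obtain ⟨x, hx, hxv⟩ := exists_generic g hg (Finset.univ.image W.c)
  obtain ⟨y, hy, hyv⟩ := exists_generic g hg (Finset.univ.image W.c ∪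
    Finset.univ.image fun b : Fin s.β => x (Sum.inr b))
  have hval : ∀ l l', E.val x l = E.val y l' → l = l' ∧ ∃ i, l = Sum.inl i := by
    rintro (i | b) (j | b') h
    · exact ⟨congrArg _ (W.c_inj h), i, rfl⟩
    · exact absurd (Finset.mem_union_left _ (Finset.mem_image.2 ⟨i, Finset.mem_univ _, h⟩))
        (hyv (E.par b'))
    · exact absurd (Finset.mem_image.2 ⟨j, Finset.mem_univ _, h.symm⟩) (hxv (E.par b))
    · exact absurd (Finset.mem_union_right _ (Finset.mem_image.2 ⟨E.par b, Finset.mem_univ _, h⟩))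
        (hyv (E.par b'))
  -- values which agree with these except that the left value of `ν₁` is the right value of `ν₂`
  obtain ⟨u, hu⟩ : ∃ u, (g (Sum.inr (E.par ν₁)) * g (Sum.inr (E.par ν₂))).eval u ≠ 0 := by
    by_contra! h
    exact mul_ne_zero (hg _) (hg _) (Polynomial.funext fun u => by rw [h u, Polynomial.eval_zero])
  rw [Polynomial.eval_mul] at hu
  let x' := Function.update x (Sum.inr (E.par ν₁)) u
  let y' := Function.update y (Sum.inr (E.par ν₂)) u
  have hx' : x' ∈ domOf g := fun a => by
    by_cases ha : a = Sum.inr (E.par ν₁)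
    · subst ha; simpa [x'] using left_ne_zero_of_mul hu
    · simpa [x', ha] using hx a
  have hy' : y' ∈ domOf g := fun a => by
    by_cases ha : a = Sum.inr (E.par ν₂)
    · subst ha; simpa [y'] using right_ne_zero_of_mul hu
    · simpa [y', ha] using hy a
  have hxl : x' ∘ Sum.inl = x ∘ Sum.inl := funext fun a => by simp [x']
  have hyl : y' ∘ Sum.inl = y ∘ Sum.inl := funext fun a => by simp [y']
  have hxl' : ∀ a, x' (Sum.inl a) = x (Sum.inl a) := fun a => congrFun hxl a
  have hyl' : ∀ a, y' (Sum.inl a) = y (Sum.inl a) := fun a => congrFun hyl a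
  rw [← hDg] at hx hy hx' hy'
  -- the equations for the diagonal parts
  have heq : ∀ {x y : P.Par ⊕ Fin s.β → k} {t : P.V → s.Lab → s.Lab → k}
      {c : s.Lab → s.Lab → L.ι → k} (_ : ∀ I a b, t I a b ≠ 0 → s.allowed I a ∧ s.allowed I b),
      (∀ a b, s.allowed (P.cls p) a → s.allowed (P.cls q) b →
          ∑ w, c a b w * eval (Sum.elim (x ∘ Sum.inl) (y ∘ Sum.inl)) (P.delta L p q w) +
            (∑ e, eval y (s.U e b) * t (P.cls p) a e -
              ∑ e, eval x (s.U a e) * t (P.cls q) e b) = 0) ↔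
      ∀ X Y : W.Label, X.Valid → Y.Valid → JordanEq X.len (E.val x X.ev) (E.val y Y.ev)
        (E.tau t X.ev Y.ev X.len Y.len) X.pos Y.pos := by
    intro x y t c ht
    simp only [hδ, map_zero, mul_zero, Finset.sum_const_zero, zero_add, sub_eq_zero, hpq]
    constructor
    · exact fun h X Y hX hY => (E.equation_iff ht x y hX hY).1
        (h _ _ (E.lbl_allowed hX) (E.lbl_allowed hY))
    · intro h a b ha hb
      obtain ⟨X, hX, rfl⟩ := (E.allowed_iff a).1 ha
      obtain ⟨Y, hY, rfl⟩ := (E.allowed_iff b).1 hb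
      exact (E.equation_iff ht x y hX hY).2 (h X Y hX hY)
  have hJ : ∀ {x y : P.Par ⊕ Fin s.β → k} {t : P.V → s.Lab → s.Lab → k}
      (_ : ∀ X Y : W.Label, X.Valid → Y.Valid → JordanEq X.len (E.val x X.ev) (E.val y Y.ev)
        (E.tau t X.ev Y.ev X.len Y.len) X.pos Y.pos) (X Y : W.Label) (_ : X.Valid) (_ : Y.Valid)
      (_ : E.val x X.ev ≠ E.val y Y.ev), ∀ g ≤ (X.len : ℕ), ∀ g' ≤ (Y.len : ℕ),
        E.tau t X.ev Y.ev X.len Y.len g g' = 0 := by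
    intro x y t h X Y hX hY hne
    refine eq_zero_of_jordanEq (fun g hg g' hg' => ?_) hne
    have := h _ _ (WeyrData.valid_lb hX.2 g) (WeyrData.valid_lb hY.2 g')
    rwa [WeyrData.pos_lb hg, WeyrData.pos_lb hg'] at this
  have hle : (induced s p q ρ D).radical x y ≤ (induced s p q ρ D).radical x' y' := by
    rintro S ⟨hS, hd⟩
    refine ⟨?_, hd⟩
    obtain ⟨t, c, ht, htr, hc, he, hS⟩ := (mem_K_iff_comb hP hρ L (hD x hx) (hD y hy) S).1 hS
    refine (mem_K_iff_comb hP hρ L (hD x' hx') (hD y' hy') S).2 ⟨t, c, ht, ?_, hc, ?_, ?_⟩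
    · intro I a b r hr h
      rw [hxl', hyl']
      exact htr I a b r hr h
    · have h0 := (heq ht).1 he
      refine (heq ht).2 fun X Y hX hY => ?_
      by_cases hv : E.val x X.ev = E.val y Y.ev
      · obtain ⟨h1, i, h2⟩ := hval _ _ hv
        have h3 := h0 X Y hX hY
        rw [← h1, h2] at h3 ⊢
        exact h3
      · have h1 := hJ h0 X Y hX hY hv
        have hX1 : (X.pos : ℕ) ≤ X.len := hX.1
        have hY1 : (Y.pos : ℕ) ≤ Y.len := hY.1
        rw [JordanEq, h1 _ hX1 _ hY1]
        congr 1
        · rw [mul_zero, mul_zero]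
        · rw [show (if 0 < (Y.pos : ℕ) then E.tau t X.ev Y.ev X.len Y.len X.pos (Y.pos - 1) else 0)
            = 0 by split_ifs; exacts [h1 _ hX1 _ (by omega), rfl],
            show (if (X.pos : ℕ) < X.len then E.tau t X.ev Y.ev X.len Y.len (X.pos + 1) Y.pos
              else 0) = 0 by split_ifs; exacts [h1 _ (by omega) _ hY1, rfl]]
    · rw [hxl, hyl]
      exact hS
  have hrad := L'.radical_eq_of_le hx hy hx' hy' hle
  -- the additional element at the values with a coincidence
  let t : P.V → s.Lab → s.Lab → k := fun I a b =>
    if I = P.cls p ∧ a = E.lbl X ∧ b = E.lbl Y then 1 else 0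
  have ht : ∀ I a b, t I a b ≠ 0 → I = P.cls p ∧ a = E.lbl X ∧ b = E.lbl Y := fun I a b h => by
    by_contra h0
    exact h (if_neg h0)
  have htX : ∀ {Z Z' : W.Label}, Z.Valid → Z'.Valid → ¬ (Z = X ∧ Z' = Y) →
      t (P.cls p) (E.lbl Z) (E.lbl Z') = 0 := fun _ _ h => by
    by_contra h0
    have := ht _ _ _ h0
    exact h ⟨E.lbl_inj this.2.1, E.lbl_inj this.2.2⟩
  have hta : ∀ I a b, t I a b ≠ 0 → s.allowed I a ∧ s.allowed I b := fun I a b h => by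
    obtain ⟨rfl, rfl, rfl⟩ := ht I a b h
    exact ⟨E.lbl_allowed hX, E.lbl_allowed hY⟩
  have hmem : comb L (x' ∘ Sum.inl) (y' ∘ Sum.inl) t (fun _ _ _ => 0) ∈
      (induced s p q ρ D).radical x' y' := by
    refine ⟨(mem_K_iff_comb hP hρ L (hD x' hx') (hD y' hy') _).2
      ⟨t, _, hta, ?_, fun _ _ _ h => absurd rfl h, ?_, rfl⟩, ?_⟩
    · intro I a b r hr h
      exact absurd hr ((ht I a b h).1 ▸ htriv r)
    · refine (heq hta).2 fun Z Z' hZ hZ' => ?_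
      have hZ1 : (Z.pos : ℕ) ≤ Z.len := hZ.1
      have hZ1' : (Z'.pos : ℕ) ≤ Z'.len := hZ'.1
      have hA : (if 0 < (Z'.pos : ℕ) then E.tau t Z.ev Z'.ev Z.len Z'.len Z.pos (Z'.pos - 1)
          else 0) = 0 := by
        split_ifs with h
        · refine htX (WeyrData.valid_lb hZ.2 _) (WeyrData.valid_lb hZ'.2 _) fun h' => ?_
          have h1 := WeyrData.pos_lb (W := W) (l := Z'.ev) (r := Z'.len) (g := Z'.pos - 1)
            (by omega)
          rw [h'.2, hY0, ← h'.2, WeyrData.len_lb] at h1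
          omega
        · rfl
      have hB : (if (Z.pos : ℕ) < Z.len then E.tau t Z.ev Z'.ev Z.len Z'.len (Z.pos + 1) Z'.pos
          else 0) = 0 := by
        split_ifs with h
        · refine htX (WeyrData.valid_lb hZ.2 _) (WeyrData.valid_lb hZ'.2 _) fun h' => ?_
          have h1 := WeyrData.pos_lb (W := W) (l := Z.ev) (r := Z.len) (g := Z.pos + 1) h
          rw [h'.1, hX0] at h1
          omega
        · rfl
      rw [JordanEq, hA, hB, E.tau_self t hZ hZ']
      by_cases h : Z = X ∧ Z' = Y
      · rw [h.1, h.2, hν₁, hν₂]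
        simp [val, x', y']
      · rw [htX hZ hZ' h, mul_zero, mul_zero]
    · intro z
      change (if z.idx = z.idx then t (P.cls z.idx) z.lab z.lab else 0) + _ = (0 : k)
      rw [if_pos rfl, show t (P.cls z.idx) z.lab z.lab = 0 from if_neg fun h =>
        hXY (E.lbl_inj (h.2.1.symm.trans h.2.2)), zero_add]
      exact Finset.sum_eq_zero fun w _ => zero_mul _
  rw [← hrad] at hmem
  obtain ⟨t', c', hta', -, -, he', hS'⟩ := (mem_K_iff_comb hP hρ L (hD x hx) (hD y hy) _).1 hmem.1
  have h0 := hJ ((heq hta').1 he') X Y hX hY (fun h => by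
    obtain ⟨-, i, hi⟩ := hval _ _ h
    rw [hν₁] at hi
    cases hi) X.pos hX.1 Y.pos hY.1
  rw [E.tau_self t' hX hY] at h0
  have h1 := congrFun (congrFun hS' (NewT.mk' p (E.lbl X) (E.lbl_allowed hX)))
    (NewT.mk' p (E.lbl Y) (E.lbl_allowed hY))
  simp [comb, L.zeta_diag, h0, t] at h1

end LoopSplitting

end ParamProblem

/-! ### Necessity of the listed forms -/

/-- A finite family in a factorial ring has a highest common factor. -/
theorem exists_hcf {R ι : Type*} [CommRing R] [IsDomain R] [UniqueFactorizationMonoid R]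
    [Fintype ι] (F : ι → R) : ∃ h, (∀ w, h ∣ F w) ∧ ∀ d, (∀ w, d ∣ F w) → d ∣ h := by
  classical
  obtain ⟨_⟩ : Nonempty (NormalizedGCDMonoid R) := inferInstance
  exact ⟨Finset.univ.gcd F, fun w => Finset.gcd_dvd (Finset.mem_univ w),
    fun d hd => Finset.dvd_gcd fun w _ => hd w⟩

theorem mem_vars_of_dvd {k A : Type*} [Field k] {h f : MvPolynomial A k} (hd : h ∣ f) (hf : f ≠ 0)
    {b : A} (hb : b ∈ h.vars) : b ∈ f.vars := by
  obtain ⟨e, rfl⟩ := hd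
  rw [mem_vars_iff_degreeOf_ne_zero] at hb ⊢
  rw [degreeOf_mul_eq (left_ne_zero_of_mul hf) (right_ne_zero_of_mul hf)]
  omega

namespace ParamProblem

variable {k : Type u} [Field k] {P : ParamProblem k} {n : P.V → ℕ} {p q : P.T}
  {ρ : Matrix P.T P.T k}

theorem StaysFree.exists_dom {R : Reduction k} {D} (h : P.StaysFree n p q ρ R D) :
    ∃ g : P.Par ⊕ Fin (P.split n p q R).β → Polynomial k, (∀ a, g a ≠ 0) ∧ D = domOf g :=
  h.free.dom_eq

theorem StaysFree.delta_eq_zero [Infinite k] (hP : P.IsFreelyParameterized) (L : P.Layer)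
    {R : Reduction k} {D} (h : P.StaysFree n p q ρ R D)
    (hR : ∀ x ∈ D, ∀ y ∈ D, P.Implies p q (x ∘ Sum.inl) (y ∘ Sum.inl)) (w : L.ι) :
    P.delta L p q w = 0 := by
  obtain ⟨g, hg, hD⟩ := h.exists_dom
  let i : P.Par → P.Par ⊕ Fin (P.split n p q R).β := Sum.inl
  have hi : Function.Injective i := Sum.inl_injective
  refine rename_injective (R := k) (Sum.map i i) (Sum.map_injective.2 ⟨hi, hi⟩) ?_
  rw [map_zero]
  refine eq_zero_of_eval_domOf g hg _ fun x hx y hy => ?_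
  rw [← hD] at hx hy
  rw [eval_rename_inl]
  exact (implies_iff hP L p q (h.sub x hx) (h.sub y hy)).1 (hR x hx y hy) w

theorem StaysFree.exists_delta_ne_zero [Infinite k] (hP : P.IsFreelyParameterized) (L : P.Layer)
    {D} (h : P.StaysFree n p q ρ Reduction.reg D) : ∃ w, P.delta L p q w ≠ 0 := by
  by_contra! h0
  obtain ⟨g, hg, hD⟩ := h.exists_dom
  obtain ⟨x, hx⟩ := domOf_nonempty g hg
  rw [← hD] at hx
  exact h.applies x hx x hx ((implies_iff hP L p q (h.sub x hx) (h.sub x hx)).2 fun w => by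
    rw [h0, map_zero])

/-- If regularization is possible everywhere on a domain then the highest common factor of the
coefficients of the differential vanishes nowhere on it, and therefore it is a product. -/
theorem StaysFree.exists_hcf_localizer [IsAlgClosed k] (hP : P.IsFreelyParameterized)
    (L : P.Layer) {lam mu : P.Par} (hlam : P.Attached lam (P.cls p))
    (hmu : P.Attached mu (P.cls q)) {D} (h : P.StaysFree n p q ρ Reduction.reg D) :
    ∃ fP fQ c : Polynomial k,
      IsHCF (leftPoly lam fP * rightPoly mu fQ) (P.delta L p q) ∧
      IsLocalizer lam (leftPoly lam fP * rightPoly mu fQ) (P.delta L p q) c := by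
  have : Infinite k := IsAlgClosed.instInfinite
  obtain ⟨w₀, hw₀⟩ := h.exists_delta_ne_zero hP L
  obtain ⟨g, hg, hD⟩ := h.exists_dom
  have hside := vars_delta_sideVars hP L p q
  obtain ⟨h', hdvd, hmax⟩ := exists_hcf fun w => P.toBi (P.cls p) (P.cls q) (P.delta L p q w)
  choose Q hQ using hdvd
  have hofBi : ∀ w, P.delta L p q w =
      P.ofBi (P.cls p) (P.cls q) h' * P.ofBi (P.cls p) (P.cls q) (Q w) := fun w => by
    rw [← map_mul, ← hQ, ofBi_toBi hP (hside w)]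
  have hh0 : h' ≠ 0 := by
    rintro rfl
    exact hw₀ (by rw [hofBi, map_zero, zero_mul])
  -- the quotients have no common factor
  obtain ⟨c, s, hc, hs⟩ := Polynomial.exists_bezout_of_no_common_factor Q fun d hd => by
    obtain ⟨e, he⟩ := hmax (h' * d) fun w => by
      rw [hQ]
      exact mul_dvd_mul_left _ (hd w)
    refine IsUnit.of_mul_eq_one e (mul_left_cancel₀ hh0 ?_)
    rw [← mul_assoc, ← he, mul_one]
  obtain ⟨fP, fQ, hf⟩ := Polynomial.exists_eq_mul_of_ne_zero (g (Sum.inl lam)) (g (Sum.inl mu))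
    (hg _) (hg _) h' fun a b ha hb h0 => by
      classical
      obtain ⟨x₀, hx₀⟩ := domOf_nonempty g hg
      have hup : ∀ r u, (g (Sum.inl r)).eval u ≠ 0 → Function.update x₀ (Sum.inl r) u ∈ D := by
        intro r u hu
        rw [hD]
        intro a
        by_cases ha : a = Sum.inl r
        · subst ha; simpa using hu
        · simpa [ha] using hx₀ a
      have h1 := hup lam a ha
      have h2 := hup mu b hb
      refine h.applies _ h1 _ h2 ((implies_iff hP L p q (h.sub _ h1) (h.sub _ h2)).2 fun w => ?_)
      rw [eval_delta_bi hP, hQ, Polynomial.evalEval_mul, parVal_eq hP hlam, parVal_eq hP hmu]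
      refine mul_eq_zero_of_left ?_ _
      simpa using h0
  have hF : leftPoly lam fP * rightPoly mu fQ = P.ofBi (P.cls p) (P.cls q) h' := by
    rw [hf, map_mul, ofBi_C_eq hP hlam, ofBi_map_C_eq hP hmu]
  refine ⟨fP, fQ, c, ⟨fun w => ?_, fun d hd => ?_⟩, hc, fun w => P.ofBi (P.cls p) (P.cls q) (Q w),
    fun w => P.ofBi (P.cls p) (P.cls q) (s w), fun w => ?_, ?_⟩
  · rw [hF, hofBi]
    exact dvd_mul_right _ _
  · rw [hF, ← ofBi_toBi hP (I := P.cls p) (J := P.cls q) (f := d) fun b hb =>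
      hside w₀ b (mem_vars_of_dvd (hd w₀) hw₀ hb)]
    exact map_dvd _ (hmax _ fun w => map_dvd _ (hd w))
  · rw [hF, hofBi]
  · rw [← ofBi_C_eq hP hlam (J := P.cls q), ← hs, map_sum]
    exact Finset.sum_congr rfl fun w _ => map_mul _ _ _

/-- In one variable there always is a highest common factor. -/
theorem exists_isHCF_aeval {A ι : Type} [Fintype ι] {v : A} {F : ι → Polynomial k}
    {Φ : ι → MvPolynomial A k}
    (hΦ : ∀ w, Φ w = Polynomial.aeval (MvPolynomial.X v : MvPolynomial A k) (F w)) :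
    ∃ f : Polynomial k, IsHCF (Polynomial.aeval (MvPolynomial.X v : MvPolynomial A k) f) Φ := by
  obtain ⟨f, Q, s, hQ, hs⟩ := exists_combination_of_hcf F
  refine ⟨f, fun w => ?_, fun h hh => ?_⟩
  · rw [hΦ, hQ, map_mul]
    exact dvd_mul_right _ _
  · rw [← hs, map_sum]
    refine Finset.dvd_sum fun w _ => ?_
    rw [map_mul, ← hΦ]
    exact (hh w).mul_left _

/-- A parameter is not attached to both parts of a new class of an edge reduction. -/
theorem StaysFree.rank_eq_zero (hP : P.IsFreelyParameterized) {lam mu : P.Par}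
    (hlam : P.Attached lam (P.cls p)) (hmu : P.Attached mu (P.cls q)) {r : ℕ}
    (hne : P.cls p ≠ P.cls q) {D} (h : P.StaysFree n p q ρ (Reduction.edge r) D) : r = 0 := by
  by_contra hr
  let E : EdgeSplitting (P.split n p q (Reduction.edge r)) (P.cls p) (P.cls q) :=
    edgeSplitting n hne r
  have ha : (P.split n p q (Reduction.edge r)).allowed (P.cls p) E.a₀ :=
    splitEdge_allowed_of_pos (Nat.pos_of_ne_zero hr)
  have hb := E.allowed_iff.1 ha
  have h1 : (induced (P.split n p q (Reduction.edge r)) p q ρ D).Attached (Sum.inl lam)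
      ⟨_, NewT.mk' p E.a₀ ha, rfl⟩ :=
    (attached_inl_iff hP E.vars_U).2 ⟨NewT.mk' p E.a₀ ha, rfl, hlam⟩
  have h2 : (induced (P.split n p q (Reduction.edge r)) p q ρ D).Attached (Sum.inl mu)
      ⟨_, NewT.mk' p E.a₀ ha, rfl⟩ :=
    (attached_inl_iff hP E.vars_U).2 ⟨NewT.mk' q E.a₁ hb, E.code_eq.symm, hmu⟩
  obtain rfl := Sum.inl_injective (h.free.att_subsingleton _ _ _ h1 h2)
  exact hne ((hP.att_unique lam).unique hlam hmu)

/-- A loop reduction at a class with a parameter has no new parameter, and the size vector at this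
class is `1`. -/
theorem StaysFree.isScalar (hP : P.IsFreelyParameterized) (hn : P.IsSize n)
    (hρ : P.IsFirst p q ρ) {lam : P.Par} (hlam : P.Attached lam (P.cls p)) {W : WeyrData k}
    (hpq : P.cls p = P.cls q) (hsize : W.size = n (P.cls p)) {D}
    (h : P.StaysFree n p q ρ (Reduction.loop W) D) : ∃ c₀, W.IsScalar c₀ := by
  let E : LoopSplitting (P.split n p q (Reduction.loop W)) (P.cls p) W := loopSplitting n _ W
  have hone : W.size = 1 := hsize.trans (hn.2 _ _ hlam)
  have hβ : W.β = 0 := by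
    by_contra hβ
    let b : Fin W.β := ⟨0, Nat.pos_of_ne_zero hβ⟩
    obtain ⟨r, hr⟩ := W.e_ne (Sum.inr b)
    have hX := WeyrData.valid_lb hr 0
    have ha := E.lbl_allowed hX
    have h1 : (induced (P.split n p q (Reduction.loop W)) p q ρ D).Attached (Sum.inl lam)
        ⟨_, NewT.mk' p _ ha, rfl⟩ :=
      (attached_inl_iff hP E.vars_U).2 ⟨NewT.mk' p _ ha, rfl, hlam⟩
    have h2 : (induced (P.split n p q (Reduction.loop W)) p q ρ D).Attached (Sum.inr (E.par b))
        ⟨_, NewT.mk' p _ ha, rfl⟩ :=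
      (E.attached_inr_iff hρ hpq.symm).2 ⟨_, b, hX, rfl, rfl, rfl⟩
    have h3 := h.free.att_subsingleton _ _ _ h1 h2
    cases h3
  obtain ⟨X, hX⟩ := WeyrData.exists_valid (hone ▸ Nat.one_pos)
  have huniq : ∀ l r, W.e l r ≠ 0 → l = X.ev ∧ r = X.len := fun l r hr => by
    have := WeyrData.valid_unique hone (WeyrData.valid_lb hr 0) hX
    rw [← this]
    exact ⟨rfl, rfl⟩
  have hev : ∀ l, l = X.ev := fun l => by
    obtain ⟨r, hr⟩ := W.e_ne l
    exact (huniq l r hr).1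
  have h1 := W.mul_le_size X.ev X.len
  have h2 := Nat.pos_of_ne_zero hX.2
  rw [hone] at h1
  have hlen : (X.len : ℕ) = 0 := by nlinarith
  have he : W.e X.ev X.len = 1 := by nlinarith
  rcases hl : X.ev with i | b
  swap
  · rw [hβ] at b
    exact b.elim0
  refine ⟨W.c i, ?_, hβ, fun j => ?_, fun l r => ?_⟩
  · have hi : ∀ j, j = i := fun j => Sum.inl_injective ((hev _).trans hl)
    have h3 : Fintype.card (Fin W.α) = 1 := Fintype.card_eq_one_iff.2 ⟨i, hi⟩
    rwa [Fintype.card_fin] at h3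
  · rw [Sum.inl_injective ((hev (Sum.inl j)).trans hl)]
  · split_ifs with hr
    · rw [hev l, Fin.ext (hr.trans hlen.symm)]
      exact he
    · by_contra h0
      exact hr ((huniq l r h0).2 ▸ hlen)

/-- A loop reduction at a trivial class introduces at most one parameter, with a block of size
one. -/
theorem StaysFree.isAddParam [Infinite k] (hP : P.IsFreelyParameterized)
    (hρ : P.IsFirst p q ρ) (htriv : P.Trivial (P.cls p)) {L : P.Layer}
    (hδ : ∀ w, P.delta L p q w = 0) {W : WeyrData k}
    (hpq : P.cls p = P.cls q) {D}
    (h : P.StaysFree n p q ρ (Reduction.loop W) D) (hβ : W.β ≠ 0) : W.IsAddParam := by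
  let E : LoopSplitting (P.split n p q (Reduction.loop W)) (P.cls p) W := loopSplitting n _ W
  have hnot : ∀ {X Y : W.Label}, X.Valid → Y.Valid → X ≠ Y → (X.pos : ℕ) = 0 → Y.pos = Y.len →
      ∀ {ν₁ ν₂}, X.ev = Sum.inr ν₁ → Y.ev = Sum.inr ν₂ → False :=
    fun hX hY hXY hX0 hY0 _ _ h1 h2 => E.not_isFreelyParameterized hP hρ hpq.symm htriv hδ h.sub
      hX hY hXY hX0 hY0 h1 h2 h.free
  have hpos : ∀ {r : Fin W.d} {l}, (W.lb l r r).pos = (W.lb l r r).len := fun {r l} =>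
    Fin.ext (WeyrData.pos_lb le_rfl)
  have hzero : ∀ b r, W.e (Sum.inr b) r ≠ 0 → (r : ℕ) = 0 := by
    intro b r hr
    by_contra h0
    refine hnot (WeyrData.valid_lb hr 0) (WeyrData.valid_lb hr r) (fun h1 => h0 ?_)
      (WeyrData.pos_lb (Nat.zero_le _)) hpos rfl rfl
    rw [← WeyrData.pos_lb (W := W) (l := Sum.inr b) (le_refl (r : ℕ)), ← h1,
      WeyrData.pos_lb (Nat.zero_le _)]
  refine ⟨?_, fun b r => ?_⟩
  · by_contra h1
    obtain ⟨r₁, hr₁⟩ := W.e_ne (Sum.inr ⟨0, by omega⟩)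
    obtain ⟨r₂, hr₂⟩ := W.e_ne (Sum.inr ⟨1, by omega⟩)
    refine hnot (WeyrData.valid_lb hr₁ 0) (WeyrData.valid_lb hr₂ r₂) (fun h2 => ?_)
      (WeyrData.pos_lb (Nat.zero_le _)) hpos rfl rfl
    have h3 := congrArg WeyrData.Label.ev h2
    rw [WeyrData.ev_lb, WeyrData.ev_lb] at h3
    have := congrArg Fin.val (Sum.inr_injective h3)
    simp at this
  · split_ifs with hr
    · obtain ⟨r₀, hr₀⟩ := W.e_ne (Sum.inr b)
      obtain rfl : r₀ = r := Fin.ext ((hzero b r₀ hr₀).trans hr.symm)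
      have hX := WeyrData.valid_lb hr₀ 0
      exact h.size.2 ⟨_, NewT.mk' p _ (E.lbl_allowed hX), rfl⟩ (Sum.inr (E.par b))
        ((E.attached_inr_iff hρ hpq.symm).2 ⟨_, b, hX, rfl, rfl, rfl⟩)
    · by_contra h0
      exact hr (hzero b r h0)

/-- The localizing polynomials of the listed form are constructed from the old ones, not from the
domain on which the reduction stays free. -/
theorem StaysFree.exists_listed [IsAlgClosed k] (hP : P.IsFreelyParameterized) (hn : P.IsSize n)
    (hρ : P.IsFirst p q ρ) (g : P.Par → Polynomial k) (L : P.Layer) {R : Reduction k}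
    (hR : R.Fits n (P.cls p) (P.cls q)) {D} (h : P.StaysFree n p q ρ R D) :
    ∃ gN gNew, P.Listed L p q g R gN gNew := by
  classical
  have : Infinite k := IsAlgClosed.instInfinite
  have hside := vars_delta_sideVars hP L p q
  by_cases hp : ∃ lam, P.Attached lam (P.cls p) <;> by_cases hq : ∃ mu, P.Attached mu (P.cls q)
  · obtain ⟨lam, hlam⟩ := hp
    obtain ⟨mu, hmu⟩ := hq
    rcases R with _ | r | W
    · obtain ⟨fP, fQ, c, hF, hc⟩ := h.exists_hcf_localizer hP L hlam hmu
      by_cases hpq : P.cls p = P.cls q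
      · exact ⟨Function.update g lam (g lam * c * fP * fQ), fun _ => 0, Or.inl ⟨lam, mu, hlam, hmu,
          Or.inr ⟨h.exists_delta_ne_zero hP L, rfl, fP, fQ, c, hF, hc,
            fun a ha _ => Function.update_of_ne ha _ _,
            Or.inl ⟨hpq, Function.update_self _ _ _⟩⟩⟩⟩
      · have hne : lam ≠ mu := by
          rintro rfl
          exact hpq ((hP.att_unique lam).unique hlam hmu)
        refine ⟨Function.update (Function.update g lam (g lam * c * fP)) mu (g mu * fQ), fun _ => 0,
          Or.inl ⟨lam, mu, hlam, hmu, Or.inr ⟨h.exists_delta_ne_zero hP L, rfl, fP, fQ, c, hF, hc,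
            fun a ha ha' => ?_, Or.inr ⟨hpq, ?_, Function.update_self _ _ _⟩⟩⟩⟩
        · rw [Function.update_of_ne ha', Function.update_of_ne ha]
        · rw [Function.update_of_ne hne, Function.update_self]
    · have hr := h.rank_eq_zero hP hlam hmu hR.1
      exact ⟨g, fun _ => 0, Or.inl ⟨lam, mu, hlam, hmu, Or.inl ⟨h.delta_eq_zero hP L h.applies, rfl,
        Or.inr ⟨hR.1, by rw [hr]⟩⟩⟩⟩
    · obtain ⟨c₀, hW⟩ := h.isScalar hP hn hρ hlam hR.1 hR.2
      exact ⟨g, fun _ => 0, Or.inl ⟨lam, mu, hlam, hmu, Or.inl ⟨h.delta_eq_zero hP L h.applies, rfl,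
        Or.inl ⟨hR.1, W, c₀, rfl, hW⟩⟩⟩⟩
  · obtain ⟨lam, hlam⟩ := hp
    have hq' : P.Trivial (P.cls q) := fun a ha => hq ⟨a, ha⟩
    rcases R with _ | r | W
    · choose F hδ using fun w => exists_eq_leftPoly hP hlam hq' (hside w)
      obtain ⟨f, hf⟩ := exists_isHCF_aeval hδ
      exact ⟨Function.update g lam (g lam * f), fun _ => 0, Or.inr (Or.inl ⟨lam, hlam, hq',
        Or.inr ⟨h.exists_delta_ne_zero hP L, rfl, f, hf, fun a ha => Function.update_of_ne ha _ _,
          Function.update_self _ _ _⟩⟩)⟩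
    · have h1 := hn.2 _ _ hlam
      have h2 := hR.2.1
      have hr : r = 0 ∨ r = 1 := by omega
      exact ⟨g, fun _ => 0, Or.inr (Or.inl ⟨lam, hlam, hq', Or.inl ⟨h.delta_eq_zero hP L h.applies,
        rfl, hr.imp (congrArg _) (congrArg _)⟩⟩)⟩
    · exact absurd (hR.1 ▸ hlam) (hq' lam)
  · obtain ⟨mu, hmu⟩ := hq
    have hp' : P.Trivial (P.cls p) := fun a ha => hp ⟨a, ha⟩
    rcases R with _ | r | W
    · choose F hδ using fun w => exists_eq_rightPoly hP hp' hmu (hside w)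
      obtain ⟨f, hf⟩ := exists_isHCF_aeval hδ
      exact ⟨Function.update g mu (g mu * f), fun _ => 0, Or.inr (Or.inr (Or.inl ⟨mu, hp', hmu,
        Or.inr ⟨h.exists_delta_ne_zero hP L, rfl, f, hf, fun a ha => Function.update_of_ne ha _ _,
          Function.update_self _ _ _⟩⟩))⟩
    · have h1 := hn.2 _ _ hmu
      have h2 := hR.2.2
      have hr : r = 0 ∨ r = 1 := by omega
      exact ⟨g, fun _ => 0, Or.inr (Or.inr (Or.inl ⟨mu, hp', hmu,
        Or.inl ⟨h.delta_eq_zero hP L h.applies, rfl, hr.imp (congrArg _) (congrArg _)⟩⟩))⟩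
    · exact absurd (hR.1 ▸ hmu) (hp' mu)
  · have hp' : P.Trivial (P.cls p) := fun a ha => hp ⟨a, ha⟩
    have hq' : P.Trivial (P.cls q) := fun a ha => hq ⟨a, ha⟩
    rcases R with _ | r | W
    · exact ⟨g, fun _ => 0, Or.inr (Or.inr (Or.inr ⟨hp', hq', rfl,
        Or.inr (Or.inl ⟨h.exists_delta_ne_zero hP L, rfl⟩)⟩))⟩
    · exact ⟨g, fun _ => 0, Or.inr (Or.inr (Or.inr ⟨hp', hq', rfl,
        Or.inl ⟨h.delta_eq_zero hP L h.applies, Or.inr ⟨hR.1, r, rfl⟩⟩⟩))⟩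
    · have hδ := h.delta_eq_zero hP L h.applies
      refine ⟨g, fun _ => ∏ i, (Polynomial.X - Polynomial.C (W.c i)),
        Or.inr (Or.inr (Or.inr ⟨hp', hq', rfl, ?_⟩))⟩
      by_cases hβ : W.β = 0
      · exact Or.inl ⟨hδ, Or.inl ⟨hR.1, W, rfl, hβ⟩⟩
      · exact Or.inr (Or.inr ⟨hδ, hR.1, W, rfl, h.isAddParam hP hρ hp' hδ hR.1 hβ, rfl⟩)

end ParamProblem

theorem proposition4p3p1 {k : Type u} [Field k] [IsAlgClosed k]
    (P : ParamProblem k) (hP : P.IsFreelyParameterized)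
    (n : P.V → ℕ) (hn : P.IsSize n)
    (g : P.Par → Polynomial k) (hg : ∀ a, g a ≠ 0) (hdom : P.dom = ParamProblem.domOf g)
    (L : P.Layer)
    (p q : P.T) (ρ : Matrix P.T P.T k) (hρ : P.IsFirst p q ρ)
    (R : Reduction k) (hR : R.Fits n (P.cls p) (P.cls q)) :
    ((∃ D, P.StaysFree n p q ρ R D) ↔ ∃ gN gNew, P.Listed L p q g R gN gNew) ∧
    ∀ gN gNew, P.Listed L p q g R gN gNew →
      P.StaysFree n p q ρ R
        (ParamProblem.domOf (Sum.elim gN fun b => gNew b.val)) := by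
  have : Infinite k := IsAlgClosed.instInfinite
  have h : ∀ gN gNew, P.Listed L p q g R gN gNew →
      P.StaysFree n p q ρ R (ParamProblem.domOf (Sum.elim gN fun b => gNew b.val)) :=
    fun _ _ => ParamProblem.staysFree_of_listed hP hn hρ hg hdom L hR
  exact ⟨⟨fun ⟨_, hD⟩ => hD.exists_listed hP hn hρ g L hR,
    fun ⟨gN, gNew, hl⟩ => ⟨_, h gN gNew hl⟩⟩, h⟩
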